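/- Let $k$ be a field (of arbitrary characteristic), let $N$ be a free abelian group of finite rank, $M=\mathrm{Hom}(N,\mathbb Z)$, and let $X=X_\Sigma$ be the toric variety over $k$ of a smooth complete fan $\Sigma$ in $N$. Write $\rho$ for the rays of $\Sigma$ and also for their primitive generators in $N$, $D_\rho$ for the corresponding torus-invariant prime divisors, $\beta_\rho=[D_\rho]\in\mathrm{Pic}(X)$, $S=k[x_\rho]_\rho$ for the Cox ring, graded by $\deg x_\rho=\beta_\rho$, and $N_1(X)=\mathrm{Hom}(\mathrm{Pic}(X),\mathbb Z)$. For a nonzero homogeneous $G\in S$ with divisor $E$, sections of $\mathcal O_X(E)$ (rational functions $s$) are identified with homogeneous fractions of degree $\deg G$ in the variables $x_\rho$ by $s\mapsto sG$, where the character $\chi^m$ ($m\in M$) is read as $\prod_\rho x_\rho^{\langle m,\rho\rangle}$. Let $F\in S$ be a nonzero homogeneous polynomial of degree $\beta\in\mathrm{Pic}(X)$, and let $D$ be the effective Cartier divisor (possibly non-reduced) that is the zero locus of $F$. Let $T_X$ be the sheaf of $k$-derivations of $\mathcal O_X$, let $\mathcal N_{D/X}=\mathcal Hom(\mathcal O_X(-D),\mathcal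 O_D)$, and let $\pi:\mathcal O_X\to\mathcal O_D$ be the quotient map. Then there is a commutative diagram of coherent sheaves on $X$ with exact rows $$\begin{array}{ccccccccc} 0&\to& N_1(X)\otimes_{\mathbb Z}\mathcal O_X&\xrightarrow{(\beta_\rho x_\rho)_\rho}&\bigoplus_\rho\mathcal O_X(D_\rho)&\to& T_X&\to&0\\ &&\downarrow{\scriptstyle\beta}&&\downarrow{\scriptstyle(\partial F/\partial x_\rho)_\rho}&&\downarrow{\scriptstyle d}&&\\ 0&\to&\mathcal O_X&\xrightarrow{\;F\;}&\mathcal O_X(D)&\to&\mathcal N_{D/X}&\to&0 \end{array}$$ with the following maps, described on local sections. The first map of the top row sends $\varphi\otimes g$ to $(\varphi(\beta_\rho)\,g\,x_\rho)_\rho$. The second sends a local section $s$ of $\mathcal O_X(D_\rho)$ (a rational function) to the derivation $\chi^u\mapsto\langle u,\rho\rangle\, s\,\chi^u$ for $u\in M$. The first map of the bottom row is $g\mapsto gF$. The second sends a section $t$ of $\mathcal O_X(D)$ to the homomorphism $s\mapsto\pi(ts)$. The vertical maps are the evaluation $\varphi\otimes g\mapsto\varphi(\beta)g$ at $\beta$;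 multiplication by $\partial F/\partial x_\rho$ on $\mathcal O_X(D_\rho)$; and $d$, which sends a derivation $\partial$ to $\pi\circ\partial|_{\mathcal O_X(-D)}$. -/

import Mathlib

open CategoryTheory TopologicalSpace Opposite AlgebraicGeometry
open scoped TensorProduct

universe u

/-- The data of a sheaf of `O_X`-modules: sections over every open set, restriction maps, and
the unique gluing of compatible families. -/
structure SectionData (X : Scheme.{u}) where
  sec : X.Opens → Type u
  acg : ∀ U, AddCommGroup (sec U)
  mod : ∀ U, Module Γ(X, U) (sec U)
  res : ∀ {U V : X.Opens}, V ≤ U → sec U →+ sec V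
  res_id : ∀ (U : X.Opens) (s : sec U), res le_rfl s = s
  res_comp : ∀ {U V W : X.Opens} (h : V ≤ U) (h' : W ≤ V) (s : sec U),
    res h' (res h s) = res (h'.trans h) s
  res_smul : ∀ {U V : X.Opens} (h : V ≤ U) (r : Γ(X, U)) (s : sec U),
    res h (r • s) = X.presheaf.map (homOfLE h).op r • res h s
  glue : ∀ {ι : Type u} (U : ι → X.Opens) (s : ∀ i, sec (U i)),
    (∀ i j, res (inf_le_left : U i ⊓ U j ≤ U i) (s i) = res inf_le_right (s j)) →
    ∃! t : sec (iSup U), ∀ i, res (le_iSup U i) t = s i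

namespace SectionData

variable {X : Scheme.{u}} (A : SectionData X)

instance (U : X.Opens) : AddCommGroup (A.sec U) := A.acg U
instance (U : X.Opens) : Module Γ(X, U) (A.sec U) := A.mod U

/-- The underlying presheaf of abelian groups. -/
noncomputable def abPresheaf : TopCat.Presheaf Ab.{u} X where
  obj U := AddCommGrpCat.of (A.sec U.unop)
  map i := AddCommGrpCat.ofHom (A.res i.unop.le)
  map_id U := by
    ext s
    exact A.res_id _ s
  map_comp i j := by
    ext s
    exact (A.res_comp _ _ s).symm

instance (U : X.Opensᵒᵖ) : Module (X.ringCatSheaf.obj.obj U) (A.abPresheaf.obj U) :=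
  A.mod U.unop

/-- The sheaf of `O_X`-modules given by the data. -/
noncomputable def modules : X.Modules where
  val := PresheafOfModules.ofPresheaf A.abPresheaf fun _ _ i r s => A.res_smul i.unop.le r s
  isSheaf := by
    refine (TopCat.Presheaf.isSheaf_iff_isSheafUniqueGluing _).mpr ?_
    intro ι U s hs
    exact A.glue U s hs

end SectionData

/-- A sheaf of modules whose sections over `U` are those functions `x ↦ s x ∈ T x` on `U`, with
`T x` an `O_{X,x}`-module, that satisfy a given local condition `sec U`. -/
structure StalkwiseData (X : Scheme.{u}) where
  T : X → Type u
  acg : ∀ x, AddCommGroup (T x)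
  mod : ∀ x, Module (X.presheaf.stalk x) (T x)
  sec : ∀ U : X.Opens, AddSubgroup (∀ x : U, T x)
  smul_mem : ∀ (U : X.Opens) (r : Γ(X, U)) (s : ∀ x : U, T x), s ∈ sec U →
    (fun x : U => X.presheaf.germ U x x.2 r • s x) ∈ sec U
  res_mem : ∀ (U V : X.Opens) (h : V ≤ U) (s : ∀ x : U, T x), s ∈ sec U →
    (fun x : V => s ⟨x, h x.2⟩) ∈ sec V
  local_mem : ∀ (U : X.Opens) (s : ∀ x : U, T x),
    (∀ x : U, ∃ (V : X.Opens) (h : V ≤ U), x.1 ∈ V ∧ (fun y : V => s ⟨y, h y.2⟩) ∈ sec V) →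
    s ∈ sec U

namespace StalkwiseData

variable {X : Scheme.{u}} (A : StalkwiseData X)

instance (x : X) : AddCommGroup (A.T x) := A.acg x
instance (x : X) : Module (X.presheaf.stalk x) (A.T x) := A.mod x

noncomputable instance (U : X.Opens) : Module Γ(X, U) (A.sec U) where
  smul r s := ⟨fun x => X.presheaf.germ U x x.2 r • s.1 x, A.smul_mem U r s.1 s.2⟩
  one_smul s := Subtype.ext <| funext fun x => by
    change X.presheaf.germ U x x.2 1 • s.1 x = s.1 x
    rw [map_one, one_smul]
  mul_smul a b s := Subtype.ext <| funext fun x => by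
    change X.presheaf.germ U x x.2 (a * b) • s.1 x =
      X.presheaf.germ U x x.2 a • X.presheaf.germ U x x.2 b • s.1 x
    rw [map_mul, mul_smul]
  smul_zero a := Subtype.ext <| funext fun x => smul_zero (X.presheaf.germ U x x.2 a)
  smul_add a s t := Subtype.ext <| funext fun x =>
    smul_add (X.presheaf.germ U x x.2 a) (s.1 x) (t.1 x)
  add_smul a b s := Subtype.ext <| funext fun x => by
    change X.presheaf.germ U x x.2 (a + b) • s.1 x =
      X.presheaf.germ U x x.2 a • s.1 x + X.presheaf.germ U x x.2 b • s.1 x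
    rw [map_add, add_smul]
  zero_smul s := Subtype.ext <| funext fun x => by
    change X.presheaf.germ U x x.2 0 • s.1 x = 0
    rw [map_zero, zero_smul]

/-- Functions restrict and glue pointwise. -/
noncomputable def sectionData : SectionData X where
  sec U := A.sec U
  acg U := inferInstance
  mod U := inferInstance
  res {U V} h :=
    { toFun := fun s => ⟨fun x => s.1 ⟨x, h x.2⟩, A.res_mem U V h s.1 s.2⟩
      map_zero' := rfl
      map_add' := fun _ _ => rfl }
  res_id _ _ := rfl
  res_comp _ _ _ := rfl
  res_smul {U V} h r s := Subtype.ext <| funext fun x => by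
    change X.presheaf.germ U x _ r • s.1 ⟨x, _⟩ =
      X.presheaf.germ V x _ (X.presheaf.map (homOfLE h).op r) • s.1 ⟨x, _⟩
    rw [TopCat.Presheaf.germ_res_apply]
  glue {ι} U s hs := by
    have key : ∀ (x : X) (i j : ι) (hi : x ∈ U i) (hj : x ∈ U j),
        (s i).1 ⟨x, hi⟩ = (s j).1 ⟨x, hj⟩ := fun x i j hi hj =>
      congrFun (congrArg Subtype.val (hs i j)) ⟨x, hi, hj⟩
    have cov : ∀ x : (iSup U : X.Opens), ∃ i, x.1 ∈ U i := fun x => Opens.mem_iSup.mp x.2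
    choose i hi using cov
    refine ⟨⟨fun x => (s (i x)).1 ⟨x, hi x⟩, ?_⟩, ?_, ?_⟩
    · refine A.local_mem _ _ fun x => ⟨U (i x), le_iSup U _, hi x, ?_⟩
      convert (s (i x)).2 using 1
      funext y
      exact key y _ _ _ _
    · intro j
      exact Subtype.ext <| funext fun y => key y _ _ _ _
    · intro t ht
      refine Subtype.ext <| funext fun x => ?_
      exact congrFun (congrArg Subtype.val (ht (i x))) ⟨x, hi x⟩

/-- The sheaf of modules given by the data. -/
noncomputable def modules : X.Modules := A.sectionData.modules

end StalkwiseData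

/-- A sheaf of modules whose sections over `U` are families of additive maps
`M(V) → P(V)`, for `V ⊆ U` open, compatible with restriction and satisfying a given condition
`cond V` of a local nature. -/
structure OperatorData {X : Scheme.{u}} (M P : X.Modules) where
  cond : ∀ V : X.Opens, AddSubgroup (Γ(M, V) →+ Γ(P, V))
  smul_mem : ∀ (V : X.Opens) (r : Γ(X, V)) (φ : Γ(M, V) →+ Γ(P, V)), φ ∈ cond V → r • φ ∈ cond V
  local_mem : ∀ (V : X.Opens) (φ : Γ(M, V) →+ Γ(P, V)),
    (∀ x ∈ V, ∃ (W : X.Opens) (h : W ≤ V) (_ : x ∈ W) (ψ : Γ(M, W) →+ Γ(P, W)), ψ ∈ cond W ∧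
      ∀ s, ψ (M.presheaf.map (homOfLE h).op s) = P.presheaf.map (homOfLE h).op (φ s)) →
    φ ∈ cond V

namespace OperatorData

variable {X : Scheme.{u}} {M P : X.Modules} (A : OperatorData M P)

/-- The compatible families of operators over `U`. -/
def sec (U : X.Opens) : AddSubgroup (∀ V : {V : X.Opens // V ≤ U}, Γ(M, V.1) →+ Γ(P, V.1)) where
  carrier := {φ | (∀ V, φ V ∈ A.cond V.1) ∧
    ∀ (V W : {V : X.Opens // V ≤ U}) (h : W.1 ≤ V.1) (s : Γ(M, V.1)),
      φ W (M.presheaf.map (homOfLE h).op s) = P.presheaf.map (homOfLE h).op (φ V s)}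
  zero_mem' := ⟨fun V => zero_mem _, fun V W h s => (map_zero _).symm⟩
  add_mem' := fun {φ ψ} hφ hψ => ⟨fun V => add_mem (hφ.1 V) (hψ.1 V), fun V W h s => by
    simp only [Pi.add_apply, AddMonoidHom.add_apply, map_add, hφ.2 V W h s, hψ.2 V W h s]⟩
  neg_mem' := fun {φ} hφ => ⟨fun V => neg_mem (hφ.1 V), fun V W h s => by
    simp only [Pi.neg_apply, AddMonoidHom.neg_apply, map_neg, hφ.2 V W h s]⟩

noncomputable instance (U : X.Opens) : Module Γ(X, U) (A.sec U) where
  smul r φ := ⟨fun V => X.presheaf.map (homOfLE V.2).op r • φ.1 V,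
    fun V => A.smul_mem _ _ _ (φ.2.1 V), fun V W h s => by
      simp only [AddMonoidHom.smul_apply, φ.2.2 V W h s, Scheme.Modules.map_smul]
      rw [← ConcreteCategory.comp_apply, ← X.presheaf.map_comp]
      rfl⟩
  one_smul φ := Subtype.ext <| funext fun V => by
    change X.presheaf.map (homOfLE V.2).op 1 • φ.1 V = φ.1 V
    rw [map_one, one_smul]
  mul_smul a b φ := Subtype.ext <| funext fun V => by
    change X.presheaf.map (homOfLE V.2).op (a * b) • φ.1 V =
      X.presheaf.map (homOfLE V.2).op a • X.presheaf.map (homOfLE V.2).op b • φ.1 V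
    rw [map_mul, mul_smul]
  smul_zero a := Subtype.ext <| funext fun V => smul_zero (X.presheaf.map (homOfLE V.2).op a)
  smul_add a φ ψ := Subtype.ext <| funext fun V =>
    smul_add (X.presheaf.map (homOfLE V.2).op a) (φ.1 V) (ψ.1 V)
  add_smul a b φ := Subtype.ext <| funext fun V => by
    change X.presheaf.map (homOfLE V.2).op (a + b) • φ.1 V =
      X.presheaf.map (homOfLE V.2).op a • φ.1 V + X.presheaf.map (homOfLE V.2).op b • φ.1 V
    rw [map_add, add_smul]
  zero_smul φ := Subtype.ext <| funext fun V => by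
    change X.presheaf.map (homOfLE V.2).op 0 • φ.1 V = 0
    rw [map_zero, zero_smul]

/-- Families of operators restrict and glue. -/
noncomputable def sectionData : SectionData X where
  sec U := A.sec U
  acg U := inferInstance
  mod U := inferInstance
  res {U V} h :=
    { toFun := fun φ => ⟨fun W => φ.1 ⟨W.1, W.2.trans h⟩, fun W => φ.2.1 ⟨W.1, W.2.trans h⟩,
        fun W W' h' s => φ.2.2 ⟨W.1, W.2.trans h⟩ ⟨W'.1, W'.2.trans h⟩ h' s⟩
      map_zero' := rfl
      map_add' := fun _ _ => rfl }
  res_id _ _ := rfl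
  res_comp _ _ _ := rfl
  res_smul {U V} h r φ := Subtype.ext <| funext fun W => by
    change X.presheaf.map (homOfLE _).op r • φ.1 ⟨W.1, W.2.trans h⟩ =
      X.presheaf.map (homOfLE W.2).op (X.presheaf.map (homOfLE h).op r) • φ.1 ⟨W.1, W.2.trans h⟩
    rw [← ConcreteCategory.comp_apply, ← X.presheaf.map_comp]
    rfl
  glue {ι} U φ hφ := by
    let PS : TopCat.Sheaf Ab.{u} X := ⟨P.presheaf, P.isSheaf⟩
    have Pc : ∀ {V₁ V₂ V₃ : X.Opens} (h : V₂ ≤ V₁) (h' : V₃ ≤ V₂) (h'' : V₃ ≤ V₁) (s : Γ(P, V₁)),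
        P.presheaf.map (homOfLE h').op (P.presheaf.map (homOfLE h).op s) =
          P.presheaf.map (homOfLE h'').op s := fun h h' h'' s => by
      rw [← ConcreteCategory.comp_apply, ← P.presheaf.map_comp]; rfl
    have Mc : ∀ {V₁ V₂ V₃ : X.Opens} (h : V₂ ≤ V₁) (h' : V₃ ≤ V₂) (h'' : V₃ ≤ V₁) (s : Γ(M, V₁)),
        M.presheaf.map (homOfLE h').op (M.presheaf.map (homOfLE h).op s) =
          M.presheaf.map (homOfLE h'').op s := fun h h' h'' s => by
      rw [← ConcreteCategory.comp_apply, ← M.presheaf.map_comp]; rfl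
    have key : ∀ (W : X.Opens) (i j : ι) (hi : W ≤ U i) (hj : W ≤ U j),
        (φ i).1 ⟨W, hi⟩ = (φ j).1 ⟨W, hj⟩ := fun W i j hi hj =>
      congrFun (congrArg Subtype.val (hφ i j)) ⟨W, le_inf hi hj⟩
    have hcov : ∀ V : X.Opens, V ≤ iSup U → V ≤ ⨆ i, V ⊓ U i := fun V hV => by
      rw [← inf_iSup_eq]; exact le_inf le_rfl hV
    have sep : ∀ (V : X.Opens) (_ : V ≤ iSup U) (s t : Γ(P, V)),
        (∀ i, P.presheaf.map (homOfLE (inf_le_left : V ⊓ U i ≤ V)).op s =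
          P.presheaf.map (homOfLE (inf_le_left : V ⊓ U i ≤ V)).op t) → s = t := fun V hV s t h =>
      PS.eq_of_locally_eq' (fun i => V ⊓ U i) V (fun i => homOfLE inf_le_left) (hcov V hV) s t h
    have ex : ∀ (V : {V : X.Opens // V ≤ iSup U}) (s : Γ(M, V.1)), ∃ t : Γ(P, V.1),
        ∀ i, P.presheaf.map (homOfLE (inf_le_left : V.1 ⊓ U i ≤ V.1)).op t =
          (φ i).1 ⟨V.1 ⊓ U i, inf_le_right⟩ (M.presheaf.map (homOfLE inf_le_left).op s) := by
      intro V s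
      refine (PS.existsUnique_gluing' (fun i => V.1 ⊓ U i) V.1 (fun i => homOfLE inf_le_left)
        (hcov V.1 V.2) (fun i => (φ i).1 ⟨V.1 ⊓ U i, inf_le_right⟩
          (M.presheaf.map (homOfLE inf_le_left).op s)) ?_).exists
      intro i j
      have h1 := (φ i).2.2 ⟨V.1 ⊓ U i, inf_le_right⟩
        ⟨(V.1 ⊓ U i) ⊓ (V.1 ⊓ U j), inf_le_left.trans inf_le_right⟩ inf_le_left
        (M.presheaf.map (homOfLE inf_le_left).op s)
      have h2 := (φ j).2.2 ⟨V.1 ⊓ U j, inf_le_right⟩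
        ⟨(V.1 ⊓ U i) ⊓ (V.1 ⊓ U j), inf_le_right.trans inf_le_right⟩ inf_le_right
        (M.presheaf.map (homOfLE inf_le_left).op s)
      refine h1.symm.trans (Eq.trans ?_ h2)
      rw [Mc _ _ (inf_le_left.trans inf_le_left), Mc _ _ (inf_le_left.trans inf_le_left),
        key _ i j]
    choose Φ hΦ using ex
    have uniq : ∀ (V : {V : X.Opens // V ≤ iSup U}) (s : Γ(M, V.1)) (t : Γ(P, V.1)),
        (∀ i, P.presheaf.map (homOfLE (inf_le_left : V.1 ⊓ U i ≤ V.1)).op t =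
          (φ i).1 ⟨V.1 ⊓ U i, inf_le_right⟩ (M.presheaf.map (homOfLE inf_le_left).op s)) →
        t = Φ V s := fun V s t h => sep V.1 V.2 _ _ fun i => (h i).trans (hΦ V s i).symm
    let Ψ : ∀ V : {V : X.Opens // V ≤ iSup U}, Γ(M, V.1) →+ Γ(P, V.1) := fun V =>
      AddMonoidHom.mk' (Φ V) fun s t => (uniq V (s + t) _ fun i => by
        simp only [map_add, hΦ V s i, hΦ V t i]).symm
    have hle : ∀ (V : {V : X.Opens // V ≤ iSup U}) (i : ι) (h : V.1 ≤ U i),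
        Ψ V = (φ i).1 ⟨V.1, h⟩ := by
      intro V i h
      ext s
      refine (uniq V s _ fun j => ?_).symm
      rw [← (φ i).2.2 ⟨V.1, h⟩ ⟨V.1 ⊓ U j, inf_le_left.trans h⟩ inf_le_left s,
        key _ i j]
    have hres : ∀ (V W : {V : X.Opens // V ≤ iSup U}) (h : W.1 ≤ V.1) (s : Γ(M, V.1)),
        Ψ W (M.presheaf.map (homOfLE h).op s) = P.presheaf.map (homOfLE h).op (Ψ V s) := by
      intro V W h s
      refine (uniq W _ _ fun i => ?_).symm
      have h3 := (φ i).2.2 ⟨V.1 ⊓ U i, inf_le_right⟩ ⟨W.1 ⊓ U i, inf_le_right⟩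
        (inf_le_inf_right _ h) (M.presheaf.map (homOfLE inf_le_left).op s)
      rw [Mc _ _ (inf_le_left.trans h), ← hΦ V s i, Pc _ _ (inf_le_left.trans h)] at h3
      rw [Mc _ _ (inf_le_left.trans h), h3, Pc _ _ (inf_le_left.trans h)]
      rfl
    refine ⟨⟨Ψ, fun V => ?_, hres⟩, ?_, ?_⟩
    · refine A.local_mem _ _ fun x hx => ?_
      obtain ⟨i, hi⟩ := Opens.mem_iSup.mp (V.2 hx)
      refine ⟨V.1 ⊓ U i, inf_le_left, ⟨hx, hi⟩, (φ i).1 ⟨V.1 ⊓ U i, inf_le_right⟩,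
        (φ i).2.1 ⟨V.1 ⊓ U i, inf_le_right⟩,
        fun s => (hΦ V s i).symm⟩
    · intro i
      refine Subtype.ext <| funext fun V => hle ⟨V.1, V.2.trans (le_iSup U i)⟩ i V.2
    · intro t ht
      refine Subtype.ext <| funext fun V => ?_
      ext s
      refine uniq V s _ fun i => ?_
      rw [← t.2.2 V ⟨V.1 ⊓ U i, inf_le_left.trans V.2⟩ inf_le_left s]
      exact congrArg (fun f : Γ(M, V.1 ⊓ U i) →+ Γ(P, V.1 ⊓ U i) =>
        f (M.presheaf.map (homOfLE inf_le_left).op s))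
        (congrFun (congrArg Subtype.val (ht i)) ⟨V.1 ⊓ U i, inf_le_right⟩)

/-- The sheaf of modules given by the data. -/
noncomputable def modules : X.Modules := A.sectionData.modules

end OperatorData

section Geometry

variable {X : Scheme.{u}}

/-- The structure sheaf as a module over itself. -/
noncomputable abbrev structureModule (X : Scheme.{u}) : X.Modules :=
  SheafOfModules.unit X.ringCatSheaf

/-- `O_X(V)`-linear maps `M(V) → P(V)`. -/
noncomputable def internalHomData (M P : X.Modules) : OperatorData M P where
  cond V :=
    { carrier := {φ | ∀ (r : Γ(X, V)) (s : Γ(M, V)), φ (r • s) = r • φ s}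
      zero_mem' := fun r s => (smul_zero r).symm
      add_mem' := fun {φ ψ} hφ hψ r s => by
        simp only [AddMonoidHom.add_apply, hφ r s, hψ r s, smul_add]
      neg_mem' := fun {φ} hφ r s => by
        simp only [AddMonoidHom.neg_apply, hφ r s, smul_neg] }
  smul_mem V a φ hφ r s := by
    simp only [AddMonoidHom.smul_apply, hφ r s, smul_comm a r]
  local_mem V φ h r s := by
    let PS : TopCat.Sheaf Ab.{u} X := ⟨P.presheaf, P.isSheaf⟩
    choose W hW hx ψ hψ hψφ using h
    refine PS.eq_of_locally_eq' (fun x : V => W x.1 x.2) V (fun x => homOfLE (hW x.1 x.2))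
      (fun x hxV => Opens.mem_iSup.mpr ⟨⟨x, hxV⟩, hx x hxV⟩) _ _ fun x => ?_
    refine (hψφ x.1 x.2 _).symm.trans ?_
    rw [Scheme.Modules.map_smul, hψ x.1 x.2 _ _, hψφ]
    exact (Scheme.Modules.map_smul _ _ _ _).symm

/-- The sheaf `Hom_{O_X}(M, P)`: a section over `U` is a family of `O_X(V)`-linear maps
`M(V) → P(V)`, `V ⊆ U`, compatible with restriction. -/
noncomputable def internalHom (M P : X.Modules) : X.Modules := (internalHomData M P).modules

/-- The constants `k → O_X(V)` of a scheme over `k`. -/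
noncomputable def constantSection {k : CommRingCat.{u}} (p : X ⟶ Spec k) (V : X.Opens) :
    k →+* Γ(X, V) :=
  ((Scheme.ΓSpecIso k).inv ≫ p.appTop ≫ X.presheaf.map (homOfLE le_top).op).hom

lemma constantSection_res {k : CommRingCat.{u}} (p : X ⟶ Spec k) {V W : X.Opens} (h : W ≤ V)
    (c : k) : X.presheaf.map (homOfLE h).op (constantSection p V c) = constantSection p W c := by
  simp only [constantSection, CommRingCat.hom_comp, RingHom.comp_apply]
  rw [← ConcreteCategory.comp_apply, ← X.presheaf.map_comp]
  rfl

/-- The `k`-derivations of the `k`-algebra `O_X(V)` into itself. -/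
noncomputable def derivationGroup {k : CommRingCat.{u}} (p : X ⟶ Spec k) (V : X.Opens) :
    AddSubgroup (Γ(X, V) →+ Γ(X, V)) where
  carrier := {δ | (∀ c : k, δ (constantSection p V c) = 0) ∧
    ∀ f g : Γ(X, V), δ (f * g) = f * δ g + g * δ f}
  zero_mem' := ⟨fun c => rfl, fun f g => by simp⟩
  add_mem' := fun {δ ε} hδ hε => ⟨fun c => by simp [hδ.1 c, hε.1 c], fun f g => by
    simp only [AddMonoidHom.add_apply, hδ.2 f g, hε.2 f g]
    ring⟩
  neg_mem' := fun {δ} hδ => ⟨fun c => by simp [hδ.1 c], fun f g => by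
    simp only [AddMonoidHom.neg_apply, hδ.2 f g]
    ring⟩

lemma mul_mem_derivationGroup {k : CommRingCat.{u}} (p : X ⟶ Spec k) (V : X.Opens)
    (a : Γ(X, V)) {δ : Γ(X, V) →+ Γ(X, V)} (hδ : δ ∈ derivationGroup p V) :
    (AddMonoidHom.mulLeft a).comp δ ∈ derivationGroup p V :=
  ⟨fun c => by simp [hδ.1 c], fun f g => by
    simp only [AddMonoidHom.comp_apply, AddMonoidHom.coe_mulLeft, hδ.2 f g]
    ring⟩

/-- `k`-derivations `O_X(V) → O_X(V)`. -/
noncomputable def tangentData {k : CommRingCat.{u}} (p : X ⟶ Spec k) :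
    OperatorData (structureModule X) (structureModule X) where
  cond V := derivationGroup p V
  smul_mem V a δ hδ := mul_mem_derivationGroup p V a hδ
  local_mem V δ h := by
    choose W hW hx ψ hψ hψδ using h
    have hψδ' : ∀ (x : X) (hxV : x ∈ V) (s : Γ(X, V)),
        X.presheaf.map (homOfLE (hW x hxV)).op (δ s : Γ(X, V)) =
          (ψ x hxV (X.presheaf.map (homOfLE (hW x hxV)).op s : Γ(X, W x hxV)) :
            Γ(X, W x hxV)) := fun x hxV s => (hψδ x hxV s).symm
    have sep : ∀ s t : Γ(X, V), (∀ (x : X) (hxV : x ∈ V),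
        X.presheaf.map (homOfLE (hW x hxV)).op s = X.presheaf.map (homOfLE (hW x hxV)).op t) →
        s = t := fun s t hst =>
      X.sheaf.eq_of_locally_eq' (fun x : V => W x.1 x.2) V (fun x => homOfLE (hW x.1 x.2))
        (fun x hxV => Opens.mem_iSup.mpr ⟨⟨x, hxV⟩, hx x hxV⟩) s t fun x => hst x.1 x.2
    refine ⟨fun c => sep _ _ fun x hxV => ?_, fun f g => sep _ _ fun x hxV => ?_⟩
    · refine (hψδ' x hxV _).trans ?_
      rw [constantSection_res, map_zero]
      exact (hψ x hxV).1 c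
    · refine (hψδ' x hxV _).trans ?_
      rw [map_mul, map_add, map_mul, map_mul]
      refine ((hψ x hxV).2 _ _).trans ?_
      exact congrArg₂ (· + ·) (congrArg₂ (· * ·) rfl (hψδ' x hxV g).symm)
        (congrArg₂ (· * ·) rfl (hψδ' x hxV f).symm)

/-- The tangent sheaf of a scheme over `k`: a section over `U` is a `k`-derivation of the sheaf of
rings `O_X|_U`. -/
noncomputable def tangentSheaf {k : CommRingCat.{u}} (p : X ⟶ Spec k) : X.Modules :=
  (tangentData p).modules

/-- The map `O_X(U) ⊗ A → O_{X,x} ⊗ A`. -/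
noncomputable def germTensor (A : Type u) [AddCommGroup A] (U : X.Opens) (x : U) :
    TensorProduct ℤ Γ(X, U) A →ₗ[ℤ] TensorProduct ℤ (X.presheaf.stalk x.1) A :=
  LinearMap.rTensor A (X.presheaf.germ U x.1 x.2).hom.toAddMonoidHom.toIntLinearMap

lemma exists_res_germTensor (A : Type u) [AddCommGroup A] {U V : X.Opens} (h : V ≤ U)
    (t : TensorProduct ℤ Γ(X, U) A) : ∃ t' : TensorProduct ℤ Γ(X, V) A,
      ∀ y : V, germTensor A V y t' = germTensor A U ⟨y, h y.2⟩ t := by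
  refine ⟨LinearMap.rTensor A (X.presheaf.map (homOfLE h).op).hom.toAddMonoidHom.toIntLinearMap t,
    fun y => ?_⟩
  induction t with
  | zero => simp only [map_zero]
  | add a b ha hb => simp only [map_add, ha, hb]
  | tmul f a =>
    change X.presheaf.germ V y y.2 (X.presheaf.map (homOfLE h).op f) ⊗ₜ[ℤ] a =
      X.presheaf.germ U y _ f ⊗ₜ[ℤ] a
    rw [TopCat.Presheaf.germ_res_apply]

lemma germTensor_smul (A : Type u) [AddCommGroup A] {U V : X.Opens} (h : V ≤ U) (r : Γ(X, U))
    (t : TensorProduct ℤ Γ(X, V) A) (y : V) :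
    germTensor A V y (X.presheaf.map (homOfLE h).op r • t) =
      X.presheaf.germ U y (h y.2) r • germTensor A V y t := by
  induction t with
  | zero => simp only [smul_zero, map_zero]
  | add a b ha hb => simp only [smul_add, map_add, ha, hb]
  | tmul f a =>
    change X.presheaf.germ V y y.2 (X.presheaf.map (homOfLE h).op r * f) ⊗ₜ[ℤ] a =
      (X.presheaf.germ U y _ r * X.presheaf.germ V y y.2 f) ⊗ₜ[ℤ] a
    rw [map_mul, TopCat.Presheaf.germ_res_apply]

/-- Functions `x ↦ s x ∈ O_{X,x} ⊗ A` that locally come from `O_X(V) ⊗ A`; these are the sections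
of the sheaf associated with `V ↦ O_X(V) ⊗ A`. -/
noncomputable def constantTensorData (A : Type u) [AddCommGroup A] (X : Scheme.{u}) :
    StalkwiseData X where
  T x := TensorProduct ℤ (X.presheaf.stalk x) A
  acg x := inferInstance
  mod x := inferInstance
  sec U :=
    { carrier := {s | ∀ x : U, ∃ (V : X.Opens) (h : V ≤ U), x.1 ∈ V ∧
        ∃ t : TensorProduct ℤ Γ(X, V) A, ∀ y : V, s ⟨y, h y.2⟩ = germTensor A V y t}
      zero_mem' := fun x => ⟨U, le_rfl, x.2, 0, fun y => (map_zero _).symm⟩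
      add_mem' := fun {s s'} hs hs' x => by
        obtain ⟨V, h, hx, t, ht⟩ := hs x
        obtain ⟨V', h', hx', t', ht'⟩ := hs' x
        obtain ⟨a, ha⟩ := exists_res_germTensor A (inf_le_left : V ⊓ V' ≤ V) t
        obtain ⟨a', ha'⟩ := exists_res_germTensor A (inf_le_right : V ⊓ V' ≤ V') t'
        refine ⟨V ⊓ V', inf_le_left.trans h, ⟨hx, hx'⟩, a + a', fun y => ?_⟩
        rw [map_add, ha, ha', ← ht, ← ht']
        rfl
      neg_mem' := fun {s} hs x => by
        obtain ⟨V, h, hx, t, ht⟩ := hs x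
        exact ⟨V, h, hx, -t, fun y => by rw [map_neg, ← ht y]; rfl⟩ }
  smul_mem U r s hs x := by
    obtain ⟨V, h, hx, t, ht⟩ := hs x
    refine ⟨V, h, hx, X.presheaf.map (homOfLE h).op r • t, fun y => ?_⟩
    rw [germTensor_smul A h, ← ht]
  res_mem U V h s hs x := by
    obtain ⟨W, hW, hx, t, ht⟩ := hs ⟨x, h x.2⟩
    obtain ⟨a, ha⟩ := exists_res_germTensor A (inf_le_left : W ⊓ V ≤ W) t
    exact ⟨W ⊓ V, inf_le_right, ⟨hx, x.2⟩, a, fun y => (ht ⟨y, y.2.1⟩).trans (ha y).symm⟩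
  local_mem U s h x := by
    obtain ⟨V, hV, hx, hs⟩ := h x
    obtain ⟨W, hW, hxW, t, ht⟩ := hs ⟨x, hx⟩
    exact ⟨W, hW.trans hV, hxW, t, ht⟩

/-- The sheaf `A ⊗_ℤ O_X` for an abelian group `A`. -/
noncomputable def constantTensor (A : Type u) [AddCommGroup A] (X : Scheme.{u}) : X.Modules :=
  (constantTensorData A X).modules

/-- The section of `A ⊗_ℤ O_X` given by the tensor of `a` and `g`. -/
noncomputable def constantTensor.tmul {A : Type u} [AddCommGroup A] {U : X.Opens} (g : Γ(X, U))
    (a : A) : Γ(constantTensor A X, U) :=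
  (⟨fun x => X.presheaf.germ U x.1 x.2 g ⊗ₜ[ℤ] a, fun x => ⟨U, le_rfl, x.2, g ⊗ₜ[ℤ] a,
    fun _ => rfl⟩⟩ : (constantTensorData A X).sec U)

end Geometry

section Divisors

variable (X : Scheme.{u}) [IsIntegral X]

/-- The image of `O_{X,x}ˣ` in `K(X)ˣ`. -/
noncomputable def stalkUnits (x : X) : Subgroup (X.functionField)ˣ :=
  (Units.map (algebraMap (X.presheaf.stalk x) X.functionField).toMonoidHom).range

/-- Cartier divisors on an integral scheme, written multiplicatively: sections of the sheaf
`Kˣ / O_Xˣ`, that is, families of classes `D x ∈ Kˣ / O_{X,x}ˣ` such that locally one rational function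
represents all of them. -/
noncomputable def cartierDivisors : Subgroup (∀ x : X, (X.functionField)ˣ ⧸ stalkUnits X x) where
  carrier := {D | ∀ x : X, ∃ (U : X.Opens) (f : (X.functionField)ˣ), x ∈ U ∧
    ∀ y ∈ U, D y = QuotientGroup.mk f}
  one_mem' := fun _ => ⟨⊤, 1, trivial, fun y _ => rfl⟩
  mul_mem' := fun {D E} hD hE x => by
    obtain ⟨U, f, hx, hf⟩ := hD x
    obtain ⟨V, g, hx', hg⟩ := hE x
    exact ⟨U ⊓ V, f * g, ⟨hx, hx'⟩, fun y hy => by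
      rw [Pi.mul_apply, hf y hy.1, hg y hy.2]; rfl⟩
  inv_mem' := fun {D} hD x => by
    obtain ⟨U, f, hx, hf⟩ := hD x
    exact ⟨U, f⁻¹, hx, fun y hy => by rw [Pi.inv_apply, hf y hy]; rfl⟩

/-- Cartier divisors, written additively. -/
def CartierDivisor : Type u := Additive (cartierDivisors X)

noncomputable instance : AddCommGroup (CartierDivisor X) :=
  inferInstanceAs (AddCommGroup (Additive (cartierDivisors X)))

/-- The divisor of a nonzero rational function. -/
noncomputable def principalDivisor : Additive (X.functionField)ˣ →+ CartierDivisor X :=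
  MonoidHom.toAdditive
    { toFun := fun f => ⟨fun _ => QuotientGroup.mk f, fun _ => ⟨⊤, f, trivial, fun _ _ => rfl⟩⟩
      map_one' := rfl
      map_mul' := fun _ _ => rfl }

/-- The Picard group of an integral scheme: Cartier divisors modulo principal ones. -/
abbrev Pic : Type u := CartierDivisor X ⧸ (principalDivisor X).range
variable {X}

/-- The rational function `f` is a local equation of `D` at `x`. -/
def CartierDivisor.IsLocalEquation (D : CartierDivisor X) (x : X) (f : (X.functionField)ˣ) : Prop :=
  (show Additive (cartierDivisors X) from D).toMul.1 x = QuotientGroup.mk f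

/-- The rational function defined by the function `g` near `x`. -/
noncomputable def rationalFunction {U : X.Opens} (x : U) (g : Γ(X, U)) : X.functionField :=
  algebraMap (X.presheaf.stalk x.1) X.functionField (X.presheaf.germ U x.1 x.2 g)

lemma rationalFunction_eq {U : X.Opens} (x y : U) (g : Γ(X, U)) :
    rationalFunction x g = rationalFunction y g := by
  have : Nonempty U := ⟨x⟩
  rw [rationalFunction, rationalFunction, Scheme.algebraMap_germ_eq_germToFunctionField,
    Scheme.algebraMap_germ_eq_germToFunctionField]

/-- Sections of `O_X(D)` over `U`: rational functions `s` with `s f ∈ O_{X,x}` for every `x ∈ U`, `f`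
being a local equation of `D` at `x`. They are written as (locally constant) functions
`U → K(X)` so that the definition is right for empty `U` as well. -/
noncomputable def lineBundleData (D : CartierDivisor X) : StalkwiseData X where
  T _ := X.functionField
  acg _ := inferInstance
  mod x := inferInstance
  sec U :=
    { carrier := {s | IsLocallyConstant s ∧ ∀ (x : U) (f : (X.functionField)ˣ),
        D.IsLocalEquation x f → s x * f ∈ (algebraMap (X.presheaf.stalk x.1) X.functionField).range}
      zero_mem' := ⟨IsLocallyConstant.const 0, fun _ _ _ => by simp⟩
      add_mem' := fun {s t} hs ht => ⟨hs.1.add ht.1, fun x f hf => by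
        rw [Pi.add_apply, add_mul]
        exact add_mem (hs.2 x f hf) (ht.2 x f hf)⟩
      neg_mem' := fun {s} hs => ⟨hs.1.neg, fun x f hf => by
        rw [Pi.neg_apply, neg_mul]
        exact neg_mem (hs.2 x f hf)⟩ }
  smul_mem U r s hs := by
    refine ⟨?_, fun x f hf => ?_⟩
    · refine IsLocallyConstant.mul (f := fun x : U => rationalFunction x r) (g := s) ?_ hs.1
      exact (IsLocallyConstant.iff_exists_open _).mpr fun x =>
        ⟨Set.univ, isOpen_univ, trivial, fun y _ => rationalFunction_eq y x r⟩
    · change (rationalFunction x r * s x) * f ∈ _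
      rw [mul_assoc]
      exact mul_mem ⟨_, rfl⟩ (hs.2 x f hf)
  res_mem U V h s hs :=
    ⟨hs.1.comp_continuous (continuous_inclusion h), fun x f hf => hs.2 ⟨x, h x.2⟩ f hf⟩
  local_mem U s h := by
    refine ⟨?_, fun x f hf => ?_⟩
    · rw [IsLocallyConstant.iff_eventually_eq]
      intro x
      obtain ⟨V, hV, hx, hs⟩ := h x
      have h1 := (IsLocallyConstant.iff_eventually_eq _).mp hs.1 ⟨x, hx⟩
      have h2 : Topology.IsOpenEmbedding (fun y : V => (⟨y.1, hV y.2⟩ : U)) :=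
        ⟨.inclusion hV, by
          change IsOpen (Set.range (Set.inclusion (show (V : Set X) ⊆ U from hV)))
          rw [Set.range_inclusion]
          exact V.2.preimage continuous_subtype_val⟩
      exact (h2.map_nhds_eq ⟨x, hx⟩).symm ▸ Filter.eventually_map.mpr h1
    · obtain ⟨V, hV, hx, hs⟩ := h x
      exact hs.2 ⟨x, hx⟩ f hf

/-- The invertible sheaf `O_X(D)`, as a subsheaf of the sheaf of rational functions. -/
noncomputable def lineBundle (D : CartierDivisor X) : X.Modules := (lineBundleData D).modules

/-- The rational function that is the section `s` of `O_X(D)`, near the point `x`. -/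
noncomputable def lineBundle.value {D : CartierDivisor X} {U : X.Opens} (s : Γ(lineBundle D, U))
    (x : U) : X.functionField := (show (lineBundleData D).sec U from s).1 x

/-- The ideal sheaf `O_X(-D) ⊆ O_X` of an effective divisor `D`: the functions that are
multiples of the local equations of `D`. -/
noncomputable def CartierDivisor.idealSheaf (D : CartierDivisor X) : X.IdealSheafData :=
  .ofIdeals fun U =>
    { carrier := {g | ∀ (x : U.1) (f : (X.functionField)ˣ), D.IsLocalEquation x f →
        ∃ a : X.presheaf.stalk x.1, rationalFunction x g = f * algebraMap _ X.functionField a}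
      zero_mem' := fun _ f _ => ⟨0, by simp [rationalFunction]⟩
      add_mem' := fun {g h} hg hh x f hf => by
        obtain ⟨a, ha⟩ := hg x f hf
        obtain ⟨b, hb⟩ := hh x f hf
        refine ⟨a + b, ?_⟩
        rw [map_add, mul_add, ← ha, ← hb, rationalFunction, map_add, map_add]
        rfl
      smul_mem' := fun c g hg x f hf => by
        obtain ⟨a, ha⟩ := hg x f hf
        refine ⟨X.presheaf.germ U.1 x.1 x.2 c * a, ?_⟩
        rw [map_mul, mul_left_comm, ← ha, rationalFunction, smul_eq_mul, map_mul, map_mul]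
        rfl }

/-- The closed subscheme `D` of `X`. -/
noncomputable abbrev CartierDivisor.subscheme (D : CartierDivisor X) : Scheme.{u} :=
  (CartierDivisor.idealSheaf D).subscheme

/-- The inclusion of the closed subscheme `D` in `X`. -/
noncomputable abbrev CartierDivisor.ι (D : CartierDivisor X) : D.subscheme ⟶ X :=
  (CartierDivisor.idealSheaf D).subschemeι

/-- The sheaf `O_D`, as a sheaf of modules on `X`. -/
noncomputable def divisorStructureSheaf (D : CartierDivisor X) : X.Modules :=
  (Scheme.Modules.pushforward D.ι).obj (structureModule D.subscheme)

/-- The quotient map `O_X → O_D`. -/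
noncomputable def restrictToDivisor (D : CartierDivisor X) {U : X.Opens} (g : Γ(X, U)) :
    Γ(divisorStructureSheaf D, U) := D.ι.app U g

/-- The normal sheaf `N_{D/X} = Hom(O_X(-D), O_D)`. -/
noncomputable def normalSheaf (D : CartierDivisor X) : X.Modules :=
  internalHom (lineBundle (-D)) (divisorStructureSheaf D)

end Divisors

section Toric

open scoped TensorProduct

variable {N : Type u} [AddCommGroup N]

/-- The cone in `N_ℝ = ℝ ⊗ N` generated by `σ ⊆ N`. -/
noncomputable def realCone (σ : Set N) : PointedCone ℝ (ℝ ⊗[ℤ] N) :=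
  PointedCone.hull ℝ ((fun v : N => (1 : ℝ) ⊗ₜ[ℤ] v) '' σ)

variable (N) in
/-- A smooth fan in `N`. A smooth cone is recorded through the set of the primitive generators of
its rays, which is part of a `ℤ`-basis of `N`; its faces are generated by the subsets. Any two cones
of the fan meet in the common face that is generated by their common generators. -/
structure SmoothFan where
  cones : Set (Set N)
  finite : cones.Finite
  empty_mem : ∅ ∈ cones
  face_mem : ∀ σ ∈ cones, ∀ τ ⊆ σ, τ ∈ cones
  smooth : ∀ σ ∈ cones, ∃ b : Module.Basis (Fin (Module.finrank ℤ N)) ℤ N, σ ⊆ Set.range b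
  inter : ∀ σ ∈ cones, ∀ τ ∈ cones, realCone σ ⊓ realCone τ = realCone (σ ∩ τ)

/-- The monoid `σ^∨ ∩ M`, where `M = Hom(N, ℤ)`. -/
def dualMonoid (σ : Set N) : AddSubmonoid (Module.Dual ℤ N) where
  carrier := {m | ∀ v ∈ σ, 0 ≤ m v}
  zero_mem' := fun _ _ => le_rfl
  add_mem' := fun hm hm' v hv => add_nonneg (hm v hv) (hm' v hv)

lemma dualMonoid_anti {σ τ : Set N} (h : τ ⊆ σ) : dualMonoid σ ≤ dualMonoid τ :=
  fun _ hm v hv => hm v (h hv)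

/-- The coordinate ring `k[σ^∨ ∩ M]` of the affine toric variety `U_σ`. -/
abbrev ChartRing (k : Type u) [Field k] (σ : Set N) : Type u :=
  AddMonoidAlgebra k (dualMonoid σ)

/-- The inclusion `k[σ^∨ ∩ M] ⊆ k[τ^∨ ∩ M]` for a face `τ` of `σ`. -/
noncomputable def chartMap (k : Type u) [Field k] {σ τ : Set N} (h : τ ⊆ σ) :
    ChartRing k σ →+* ChartRing k τ :=
  AddMonoidAlgebra.mapDomainRingHom k (AddSubmonoid.inclusion (dualMonoid_anti h))

lemma chartMap_single (k : Type u) [Field k] {σ τ : Set N} (h : τ ⊆ σ) (m : dualMonoid σ)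
    (c : k) : chartMap k h (.single m c) = .single ⟨m.1, dualMonoid_anti h m.2⟩ c :=
  AddMonoidAlgebra.mapDomain_single

lemma chartMap_injective (k : Type u) [Field k] {σ τ : Set N} (h : τ ⊆ σ) :
    Function.Injective (chartMap k h) :=
  AddMonoidAlgebra.mapDomain_injective (AddSubmonoid.inclusion_injective _)

lemma isLocalization_chartMap (k : Type u) [Field k] {σ τ : Set N} (h : τ ⊆ σ) (hσ : σ.Finite)
    (m : dualMonoid σ) (h0 : ∀ v ∈ τ, m.1 v = 0) (h1 : ∀ v ∈ σ \ τ, 0 < m.1 v) :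
    letI := (chartMap k h).toAlgebra
    IsLocalization.Away (.single m 1 : ChartRing k σ) (ChartRing k τ) := by
  let _ := (chartMap k h).toAlgebra
  have hpow : ∀ n : ℕ, (chartMap k h (.single m 1)) ^ n =
      .single ⟨n • m.1, nsmul_mem (dualMonoid_anti h m.2) n⟩ 1 := fun n => by
    rw [chartMap_single, AddMonoidAlgebra.single_pow, one_pow]
    rfl
  refine IsLocalization.Away.mk _ ?_ ?_ ?_
  · have hm : -m.1 ∈ dualMonoid τ := fun v hv => by
      rw [LinearMap.neg_apply, h0 v hv, neg_zero]
    refine IsUnit.of_mul_eq_one (.single ⟨-m.1, hm⟩ 1) ?_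
    change chartMap k h (.single m 1) * _ = 1
    rw [chartMap_single, AddMonoidAlgebra.single_mul_single, one_mul, AddMonoidAlgebra.one_def]
    congr 1
    exact Subtype.ext (add_neg_cancel m.1)
  · intro z
    change ∃ (n : ℕ) (a : ChartRing k σ), z * chartMap k h (.single m 1) ^ n = chartMap k h a
    induction z using AddMonoidAlgebra.induction_linear with
    | zero => exact ⟨0, 0, by simp⟩
    | add x y hx hy =>
      obtain ⟨n, a, ha⟩ := hx
      obtain ⟨n', a', ha'⟩ := hy
      refine ⟨n + n', a * .single m 1 ^ n' + a' * .single m 1 ^ n, ?_⟩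
      rw [map_add, map_mul, map_mul, ← ha, ← ha', map_pow, map_pow]
      ring
    | single u c =>
      have hmem : u.1 + (∑ v ∈ hσ.toFinset, (u.1 v).natAbs) • m.1 ∈ dualMonoid σ := by
        intro v hv
        rw [LinearMap.add_apply, LinearMap.smul_apply, nsmul_eq_mul]
        by_cases hvτ : v ∈ τ
        · rw [h0 v hvτ, mul_zero, add_zero]
          exact u.2 v hvτ
        · have h2 : (u.1 v).natAbs ≤ ∑ v ∈ hσ.toFinset, (u.1 v).natAbs :=
            Finset.single_le_sum (f := fun v => (u.1 v).natAbs) (fun _ _ => Nat.zero_le _)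
              (hσ.mem_toFinset.mpr hv)
          have h3 := h1 v ⟨hv, hvτ⟩
          have h4 : ((∑ v ∈ hσ.toFinset, (u.1 v).natAbs : ℕ) : ℤ) ≤
              (∑ v ∈ hσ.toFinset, (u.1 v).natAbs : ℕ) * m.1 v :=
            le_mul_of_one_le_right (by positivity) h3
          omega
      refine ⟨∑ v ∈ hσ.toFinset, (u.1 v).natAbs, .single ⟨_, hmem⟩ c, ?_⟩
      rw [hpow, chartMap_single, AddMonoidAlgebra.single_mul_single, mul_one]
      rfl
  · intro a b hab
    exact ⟨0, by rw [chartMap_injective k h hab]⟩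

instance (k : Type u) [Field k] [Module.Free ℤ N] (σ : Set N) : IsDomain (ChartRing k σ) := by
  have : UniqueSums (Module.Dual ℤ N) := UniqueSums.of_injective_addHom
    (AddMonoidHom.mk' (fun (m : Module.Dual ℤ N) (v : N) => m v) fun _ _ => rfl).toAddHom
    DFunLike.coe_injective inferInstance
  have : UniqueSums (dualMonoid σ) := UniqueSums.of_injective_addHom
    (dualMonoid σ).subtype.toAddHom Subtype.val_injective inferInstance
  infer_instance

namespace SmoothFan

variable (Δ : SmoothFan N)

lemma finite_of_mem {σ : Set N} (hσ : σ ∈ Δ.cones) : σ.Finite := by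
  obtain ⟨b, hb⟩ := Δ.smooth σ hσ
  exact (Set.finite_range b).subset hb

/-- Prescribing the values of a linear form on the generators of a cone. -/
lemma exists_dual {σ : Set N} (hσ : σ ∈ Δ.cones) (c : N → ℤ) :
    ∃ m : Module.Dual ℤ N, ∀ v ∈ σ, m v = c v := by
  obtain ⟨b, hb⟩ := Δ.smooth σ hσ
  refine ⟨b.constr ℤ fun i => c (b i), fun v hv => ?_⟩
  obtain ⟨i, rfl⟩ := hb hv
  exact b.constr_basis ℤ _ i

open Classical in
lemma exists_supporting {σ : Set N} (hσ : σ ∈ Δ.cones) (τ : Set N) :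
    ∃ m : dualMonoid σ, (∀ v ∈ σ ∩ τ, m.1 v = 0) ∧ ∀ v ∈ σ \ τ, 0 < m.1 v := by
  obtain ⟨m, hm⟩ := Δ.exists_dual hσ fun v => if v ∈ τ then 0 else 1
  refine ⟨⟨m, fun v hv => ?_⟩, fun v hv => ?_, fun v hv => ?_⟩
  · rw [hm v hv]
    split_ifs <;> simp
  · rw [hm v hv.1, if_pos hv.2]
  · rw [hm v hv.1, if_neg hv.2]
    exact one_pos

variable (k : Type u) [Field k]

/-- The affine toric varieties `U_σ = Spec k[σ^∨ ∩ M]` with the open immersions `U_τ → U_σ` for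
the faces `τ` of `σ`. -/
noncomputable def chart : Δ.cones ⥤ Scheme.{u} where
  obj σ := Spec (.of (ChartRing k σ.1))
  map f := Spec.map (CommRingCat.ofHom (chartMap k (leOfHom f)))
  map_id σ := by
    rw [← Spec.map_id]
    congr 1
    ext1
    exact AddMonoidAlgebra.mapDomainRingHom_id
  map_comp f g := by
    rw [← Spec.map_comp]
    congr 1
    ext1
    refine RingHom.ext fun x => ?_
    induction x using AddMonoidAlgebra.induction_linear with
    | zero => simp only [map_zero]
    | add x y hx hy => simp only [map_add, hx, hy]
    | single m c =>
      change chartMap k (leOfHom (f ≫ g)) (.single m c) =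
        chartMap k (leOfHom f) (chartMap k (leOfHom g) (.single m c))
      rw [chartMap_single, chartMap_single, chartMap_single]

instance {σ τ : Δ.cones} (f : σ ⟶ τ) : IsOpenImmersion ((Δ.chart k).map f) := by
  obtain ⟨m, h0, h1⟩ := Δ.exists_supporting τ.2 σ.1
  have hf : σ.1 ⊆ τ.1 := leOfHom f
  let _ := (chartMap k hf).toAlgebra
  have := isLocalization_chartMap k hf (Δ.finite_of_mem τ.2) m (fun v hv => h0 v ⟨hf hv, hv⟩) h1
  exact IsOpenImmersion.of_isLocalization (.single m 1 : ChartRing k τ.1)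

lemma range_chart_map {σ τ : Δ.cones} (f : σ ⟶ τ) (m : dualMonoid τ.1)
    (h0 : ∀ v ∈ σ.1, m.1 v = 0) (h1 : ∀ v ∈ τ.1 \ σ.1, 0 < m.1 v) :
    Set.range ((Δ.chart k).map f) =
      (PrimeSpectrum.basicOpen (.single m 1 : ChartRing k τ.1) :
        Set (PrimeSpectrum (ChartRing k τ.1))) := by
  have hf : σ.1 ⊆ τ.1 := leOfHom f
  let _ := (chartMap k hf).toAlgebra
  have := isLocalization_chartMap k hf (Δ.finite_of_mem τ.2) m h0 h1
  exact PrimeSpectrum.localization_away_comap_range (ChartRing k σ.1)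
    (.single m 1 : ChartRing k τ.1)

instance : (Δ.chart k ⋙ Scheme.forget).IsLocallyDirected where
  cond {σ τ κ} fσ fτ x y hxy := by
    change (Δ.chart k).map fσ x = (Δ.chart k).map fτ y at hxy
    let l : Δ.cones := ⟨σ.1 ∩ τ.1, Δ.face_mem _ σ.2 _ Set.inter_subset_left⟩
    let lσ : l ⟶ σ := homOfLE Set.inter_subset_left
    let lτ : l ⟶ τ := homOfLE Set.inter_subset_right
    obtain ⟨m, h0, h1⟩ := Δ.exists_supporting κ.2 σ.1
    obtain ⟨m', h0', h1'⟩ := Δ.exists_supporting κ.2 τ.1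
    have hσ : σ.1 ⊆ κ.1 := leOfHom fσ
    have hτ : τ.1 ⊆ κ.1 := leOfHom fτ
    have rσ := Δ.range_chart_map k fσ m (fun v hv => h0 v ⟨hσ hv, hv⟩) h1
    have rτ := Δ.range_chart_map k fτ m' (fun v hv => h0' v ⟨hτ hv, hv⟩) h1'
    have rl := Δ.range_chart_map k (lσ ≫ fσ) (m + m')
      (fun v hv => by
        change m.1 v + m'.1 v = 0
        rw [h0 v ⟨hσ hv.1, hv.1⟩, h0' v ⟨hτ hv.2, hv.2⟩, add_zero])
      (fun v hv => by
        change 0 < m.1 v + m'.1 v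
        have p := m.2 v hv.1
        have p' := m'.2 v hv.1
        by_cases hvσ : v ∈ σ.1
        · exact add_pos_of_nonneg_of_pos p (h1' v ⟨hv.1, fun hvτ => hv.2 ⟨hvσ, hvτ⟩⟩)
        · exact add_pos_of_pos_of_nonneg (h1 v ⟨hv.1, hvσ⟩) p')
    have hmul : (.single (m + m') 1 : ChartRing k κ.1) = .single m 1 * .single m' 1 := by
      rw [AddMonoidAlgebra.single_mul_single, one_mul]
    have hx : (Δ.chart k).map fσ x ∈ Set.range ((Δ.chart k).map (lσ ≫ fσ)) := by
      rw [rl, hmul, PrimeSpectrum.basicOpen_mul]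
      exact ⟨rσ ▸ ⟨x, rfl⟩, rτ ▸ ⟨y, hxy.symm⟩⟩
    obtain ⟨z, hz⟩ := hx
    refine ⟨l, lσ, lτ, z, ?_, ?_⟩
    · apply ((Δ.chart k).map fσ).isOpenEmbedding.injective
      rw [← hz, Functor.map_comp]
      rfl
    · apply ((Δ.chart k).map fτ).isOpenEmbedding.injective
      change (Δ.chart k).map fτ ((Δ.chart k).map lτ z) = (Δ.chart k).map fτ y
      rw [← hxy, ← hz, ← Scheme.Hom.comp_apply, ← Functor.map_comp]
      rfl

/-- The toric variety of the fan, glued from the affine toric varieties of the cones. -/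
noncomputable def toricVariety : Scheme.{u} := Limits.colimit (Δ.chart k)

/-- The inclusion of `U_σ`. -/
noncomputable def chartι (σ : Δ.cones) : (Δ.chart k).obj σ ⟶ Δ.toricVariety k :=
  Limits.colimit.ι (Δ.chart k) σ

instance (σ : Δ.cones) : IsOpenImmersion (Δ.chartι k σ) := by
  unfold chartι toricVariety
  infer_instance

lemma chartι_comp {σ τ : Δ.cones} (f : σ ⟶ τ) :
    (Δ.chart k).map f ≫ Δ.chartι k τ = Δ.chartι k σ :=
  Limits.colimit.w (Δ.chart k) f

/-- The structure morphism to `Spec k`. -/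
noncomputable def structureMorphism : Δ.toricVariety k ⟶ Spec (.of k) :=
  Limits.colimit.desc (Δ.chart k)
    { pt := Spec (.of k)
      ι :=
        { app := fun σ => Spec.map (CommRingCat.ofHom (algebraMap k (ChartRing k σ.1)))
          naturality := fun σ τ f => by
            change Spec.map _ ≫ Spec.map _ = Spec.map _ ≫ 𝟙 _
            rw [← Spec.map_comp, Category.comp_id]
            congr 1
            refine CommRingCat.hom_ext (RingHom.ext fun c => ?_)
            change chartMap k (leOfHom f) (.single 0 c) = .single 0 c
            rw [chartMap_single]
            rfl } }

/-- `U_σ` as an open subset of the toric variety. -/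
noncomputable def chartOpen (σ : Δ.cones) : (Δ.toricVariety k).Opens := Δ.chartι k σ ''ᵁ ⊤

/-- Elements of `k[σ^∨ ∩ M]` as functions on `U_σ`. -/
noncomputable def chartSection (σ : Δ.cones) :
    ChartRing k σ.1 →+* Γ(Δ.toricVariety k, Δ.chartOpen k σ) :=
  ((Scheme.ΓSpecIso (.of (ChartRing k σ.1))).inv ≫ ((Δ.chartι k σ).appIso ⊤).inv).hom

lemma mem_chartOpen {σ : Δ.cones} {x : Δ.toricVariety k} :
    x ∈ Δ.chartOpen k σ ↔ x ∈ Set.range (Δ.chartι k σ) := by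
  simp [chartOpen]

lemma chartOpen_mono {σ τ : Δ.cones} (h : σ ≤ τ) : Δ.chartOpen k σ ≤ Δ.chartOpen k τ := by
  intro x hx
  obtain ⟨y, rfl⟩ := (Δ.mem_chartOpen k).mp hx
  refine (Δ.mem_chartOpen k).mpr ⟨(Δ.chart k).map (homOfLE h) y, ?_⟩
  rw [← Scheme.Hom.comp_apply, Δ.chartι_comp k]

lemma top_le_preimage_chartOpen (σ : Δ.cones) : ⊤ ≤ Δ.chartι k σ ⁻¹ᵁ Δ.chartOpen k σ :=
  ((Δ.chartι k σ).preimage_image_eq ⊤).ge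

lemma appLE_chartSection (σ : Δ.cones) (a : ChartRing k σ.1) :
    (Δ.chartι k σ).appLE (Δ.chartOpen k σ) ⊤ (Δ.top_le_preimage_chartOpen k σ)
      (Δ.chartSection k σ a) = (Scheme.ΓSpecIso (.of (ChartRing k σ.1))).inv a := by
  have h := (Δ.chartι k σ).appIso_hom' ⊤
  change _ = (Δ.chartι k σ).appLE (Δ.chartOpen k σ) ⊤ _ at h
  exact (congrArg (fun f => f.hom (Δ.chartSection k σ a)) h.symm).trans
    (Iso.inv_hom_id_apply ((Δ.chartι k σ).appIso ⊤) _)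

lemma appLE_chartι_injective (σ : Δ.cones) : Function.Injective
    ((Δ.chartι k σ).appLE (Δ.chartOpen k σ) ⊤ (Δ.top_le_preimage_chartOpen k σ)) := by
  have h := (Δ.chartι k σ).appIso_hom' ⊤
  change _ = (Δ.chartι k σ).appLE (Δ.chartOpen k σ) ⊤ _ at h
  rw [← h]
  exact (ConcreteCategory.bijective_of_isIso ((Δ.chartι k σ).appIso ⊤).hom).1

lemma chartSection_res {σ τ : Δ.cones} (h : σ ≤ τ) (a : ChartRing k τ.1) :
    (Δ.toricVariety k).presheaf.map (homOfLE (Δ.chartOpen_mono k h)).op (Δ.chartSection k τ a) =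
      Δ.chartSection k σ (chartMap k h a) := by
  apply Δ.appLE_chartι_injective k σ
  rw [appLE_chartSection, ← ConcreteCategory.comp_apply, Scheme.Hom.map_appLE]
  have e : ∀ (f : (Δ.chart k).obj σ ⟶ Δ.toricVariety k) (hf : f = Δ.chartι k σ) (h1) (h2),
      (Δ.chartι k σ).appLE (Δ.chartOpen k τ) ⊤ h1 = f.appLE (Δ.chartOpen k τ) ⊤ h2 := by
    rintro f rfl _ _
    rfl
  rw [e _ (Δ.chartι_comp k (homOfLE h)) _ (by
      rw [Δ.chartι_comp k]
      exact (Δ.top_le_preimage_chartOpen k σ).trans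
        ((Δ.chartι k σ).preimage_mono (Δ.chartOpen_mono k h))),
    ← Scheme.Hom.appLE_comp_appLE _ _ _ ⊤ ⊤ (Δ.top_le_preimage_chartOpen k τ) le_top,
    ConcreteCategory.comp_apply, appLE_chartSection]
  have h1 : ((Δ.chart k).map (homOfLE h)).appLE ⊤ ⊤ le_top =
      (Spec.map (CommRingCat.ofHom (chartMap k h))).appTop := by
    rw [Scheme.Hom.appTop, Scheme.Hom.app_eq_appLE]
    rfl
  rw [h1]
  exact (ConcreteCategory.congr_hom
    (Scheme.ΓSpecIso_inv_naturality (CommRingCat.ofHom (chartMap k h))) a).symm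

lemma iSup_chartOpen (x : Δ.toricVariety k) : ∃ σ, x ∈ Δ.chartOpen k σ := by
  obtain ⟨σ, y, rfl⟩ := Scheme.IsLocallyDirected.ι_jointly_surjective (Δ.chart k) x
  exact ⟨σ, (Δ.mem_chartOpen k).mpr ⟨y, rfl⟩⟩

lemma mem_chartOpen_inter {σ τ : Δ.cones} {x : Δ.toricVariety k} (hσ : x ∈ Δ.chartOpen k σ)
    (hτ : x ∈ Δ.chartOpen k τ) : ∃ κ, κ ≤ σ ∧ κ ≤ τ ∧ x ∈ Δ.chartOpen k κ := by
  obtain ⟨y, rfl⟩ := (Δ.mem_chartOpen k).mp hσ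
  obtain ⟨z, hz⟩ := (Δ.mem_chartOpen k).mp hτ
  obtain ⟨κ, f, g, w, rfl, rfl⟩ := (Scheme.IsLocallyDirected.ι_eq_ι_iff (Δ.chart k)).mp hz
  refine ⟨κ, leOfHom g, leOfHom f, (Δ.mem_chartOpen k).mpr ⟨w, ?_⟩⟩
  rw [← Scheme.Hom.comp_apply, Δ.chartι_comp k]

variable [Module.Free ℤ N]

instance (σ : Δ.cones) : IsIntegral ((Δ.chart k).obj σ) :=
  inferInstanceAs (IsIntegral (Spec (.of (ChartRing k σ.1))))

/-- The zero cone, whose chart is the torus. -/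
abbrev zeroCone : Δ.cones := ⟨∅, Δ.empty_mem⟩

instance : IsReduced (Δ.toricVariety k) :=
  haveI : ∀ σ, IsReduced ((Scheme.IsLocallyDirected.openCover (Δ.chart k)).X σ) :=
    fun (σ : Δ.cones) => isReduced_of_isIntegral (X := (Δ.chart k).obj σ)
  IsReduced.of_openCover (Limits.colimit (Δ.chart k))
    (Scheme.IsLocallyDirected.openCover (Δ.chart k))

instance : IrreducibleSpace (Δ.toricVariety k) where
  isPreirreducible_univ := by
    have key : ∀ U : Set (Δ.toricVariety k), IsOpen U → (Set.univ ∩ U).Nonempty →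
        (Set.univ ∩ Δ.chartι k Δ.zeroCone ⁻¹' U).Nonempty := by
      rintro U hU ⟨x, -, hx⟩
      obtain ⟨σ, y, rfl⟩ := Scheme.IsLocallyDirected.ι_jointly_surjective (Δ.chart k) x
      let f : Δ.zeroCone ⟶ σ := homOfLE (Set.empty_subset _)
      obtain ⟨z, -, hz, w, rfl⟩ := PreirreducibleSpace.isPreirreducible_univ
        (X := (Δ.chart k).obj σ) (Δ.chartι k σ ⁻¹' U) (Set.range ((Δ.chart k).map f))
        (hU.preimage (Δ.chartι k σ).continuous) ((Δ.chart k).map f).isOpenEmbedding.isOpen_range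
        ⟨y, trivial, hx⟩ ⟨_, trivial, genericPoint _, rfl⟩
      refine ⟨w, trivial, ?_⟩
      rw [← Δ.chartι_comp k f]
      exact hz
    intro U V hU hV hU' hV'
    obtain ⟨w, -, hw⟩ := PreirreducibleSpace.isPreirreducible_univ
      (X := (Δ.chart k).obj Δ.zeroCone) _ _ (hU.preimage (Δ.chartι k Δ.zeroCone).continuous)
      (hV.preimage (Δ.chartι k Δ.zeroCone).continuous) (key U hU hU') (key V hV hV')
    exact ⟨_, trivial, hw⟩
  toNonempty := ⟨Δ.chartι k Δ.zeroCone (genericPoint _)⟩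

instance : IsIntegral (Δ.toricVariety k) := isIntegral_of_irreducibleSpace_of_isReduced _

instance (σ : Δ.cones) : Nonempty (Δ.chartOpen k σ) :=
  ⟨⟨Δ.chartι k σ (genericPoint _), (Δ.mem_chartOpen k).mpr ⟨_, rfl⟩⟩⟩

/-- The inclusion of `k[M]` in the function field. -/
noncomputable def charToFunctionField :
    AddMonoidAlgebra k (Module.Dual ℤ N) →+* (Δ.toricVariety k).functionField :=
  ((Δ.toricVariety k).germToFunctionField (Δ.chartOpen k Δ.zeroCone)).hom.comp
    ((Δ.chartSection k Δ.zeroCone).comp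
      (AddMonoidAlgebra.mapDomainRingHom k
        ({ toFun := fun m => ⟨m, fun _ h => h.elim⟩
           map_zero' := rfl
           map_add' := fun _ _ => rfl } : Module.Dual ℤ N →+ dualMonoid (∅ : Set N))))

end SmoothFan

end Toric

section Coherence

variable {X : Scheme.{u}}

/-- Coherent sheaves on a (locally noetherian) scheme: every point has an affine neighbourhood `U` such
that `M(U)` is finitely generated and `M(D(f)) = M(U)_f` for every function `f` on `U`. -/
def IsCoherent (M : X.Modules) : Prop :=
  ∀ x : X, ∃ U : X.Opens, IsAffineOpen U ∧ x ∈ U ∧ Module.Finite Γ(X, U) Γ(M, U) ∧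
    ∀ f : Γ(X, U),
      (∀ t : Γ(M, X.basicOpen f), ∃ (n : ℕ) (s : Γ(M, U)),
        (X.presheaf.map (homOfLE (X.basicOpen_le f)).op f) ^ n • t =
          M.presheaf.map (homOfLE (X.basicOpen_le f)).op s) ∧
      ∀ s : Γ(M, U), M.presheaf.map (homOfLE (X.basicOpen_le f)).op s = 0 →
        ∃ n : ℕ, f ^ n • s = 0

end Coherence

section Evaluation

variable {X : Scheme.{u}}

/-- The value of a section over `U` of `Hom(M, P)` on sections of `M` over `V ⊆ U`. -/
noncomputable def internalHom.apply {M P : X.Modules} {U V : X.Opens} (φ : Γ(internalHom M P, U))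
    (hV : V ≤ U) : Γ(M, V) →+ Γ(P, V) :=
  (show (internalHomData M P).sec U from φ).1 ⟨V, hV⟩

/-- The value of a derivation over `U` on functions over `V ⊆ U`. -/
noncomputable def tangentSheaf.apply {k : CommRingCat.{u}} {p : X ⟶ Spec k} {U V : X.Opens}
    (δ : Γ(tangentSheaf p, U)) (hV : V ≤ U) : Γ(X, V) →+ Γ(X, V) :=
  (show (tangentData p).sec U from δ).1 ⟨V, hV⟩

end Evaluation

section Cox

namespace SmoothFan

variable {N : Type u} [AddCommGroup N] (Δ : SmoothFan N)

/-- The support of the fan is all of `N_ℝ`. -/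
def IsComplete : Prop := ∀ y : ℝ ⊗[ℤ] N, ∃ σ ∈ Δ.cones, y ∈ realCone σ

/-- The rays of the fan, given by their primitive generators. -/
abbrev Ray : Type u := {v : N // {v} ∈ Δ.cones}

instance : Finite Δ.Ray :=
  have := Δ.finite.to_subtype
  Finite.of_injective (fun ρ : Δ.Ray => (⟨{ρ.1}, ρ.2⟩ : Δ.cones)) fun _ _ h =>
    Subtype.ext (Set.singleton_injective (congrArg Subtype.val h))

open Classical in
/-- A linear form with value `1` at the generator of `ρ` and `0` at all other generators of `σ`. -/
noncomputable def rayForm (ρ : Δ.Ray) (σ : Δ.cones) : Module.Dual ℤ N :=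
  (Δ.exists_dual σ.2 fun v => if v = ρ.1 then 1 else 0).choose

open Classical in
lemma rayForm_spec (ρ : Δ.Ray) (σ : Δ.cones) :
    ∀ v ∈ σ.1, Δ.rayForm ρ σ v = if v = ρ.1 then 1 else 0 :=
  (Δ.exists_dual σ.2 fun v => if v = ρ.1 then 1 else 0).choose_spec

/-- `m ↦ (⟨m, ρ⟩)_ρ`. -/
def rayValues : Module.Dual ℤ N →+ (Δ.Ray → ℤ) where
  toFun m ρ := m ρ.1
  map_zero' := rfl
  map_add' _ _ := rfl

lemma rayValues_injective (hΔ : Δ.IsComplete) : Function.Injective Δ.rayValues := by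
  refine (injective_iff_map_eq_zero _).mpr fun m hm => LinearMap.ext fun v => ?_
  let L : ℝ ⊗[ℤ] N →ₗ[ℝ] ℝ := Module.Dual.baseChange ℝ m
  have hL : ∀ w : N, L ((1 : ℝ) ⊗ₜ[ℤ] w) = m w := fun w => by simp [L]
  obtain ⟨σ, hσ, hy⟩ := hΔ ((1 : ℝ) ⊗ₜ[ℤ] v)
  have h0 : L ((1 : ℝ) ⊗ₜ[ℤ] v) = 0 := by
    refine Submodule.span_induction (p := fun y _ => L y = 0) ?_ (map_zero L) ?_ ?_ hy
    · rintro _ ⟨w, hw, rfl⟩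
      have := congrFun hm ⟨w, Δ.face_mem σ hσ _ (Set.singleton_subset_iff.mpr hw)⟩
      rw [hL]
      exact_mod_cast this
    · intro x y _ _ hx hy
      rw [map_add, hx, hy, add_zero]
    · intro a x _ hx
      change L ((a : ℝ) • x) = 0
      rw [map_smul, hx, smul_zero]
  rw [hL] at h0
  exact_mod_cast h0

variable (k : Type u) [Field k]

lemma chartSection_bijective (σ : Δ.cones) : Function.Bijective (Δ.chartSection k σ) :=
  (ConcreteCategory.bijective_of_isIso ((Δ.chartι k σ).appIso ⊤).inv).comp
    (ConcreteCategory.bijective_of_isIso (Scheme.ΓSpecIso (.of (ChartRing k σ.1))).inv)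

variable [Module.Free ℤ N]

lemma germ_chartSection_single (σ : Δ.cones) (m : dualMonoid σ.1) :
    (Δ.toricVariety k).germToFunctionField (Δ.chartOpen k σ) (Δ.chartSection k σ (.single m 1)) =
      Δ.charToFunctionField k (.single m.1 1) := by
  have h : Δ.zeroCone ≤ σ := Set.empty_subset σ.1
  have h1 := congrArg ((Δ.toricVariety k).germToFunctionField (Δ.chartOpen k Δ.zeroCone))
    (Δ.chartSection_res k h (.single m 1))
  rw [chartMap_single] at h1
  refine Eq.trans ?_ (h1.trans ?_)
  · exact (TopCat.Presheaf.germ_res_apply _ _ _ _ _).symm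
  · change _ = (Δ.toricVariety k).germToFunctionField (Δ.chartOpen k Δ.zeroCone)
      (Δ.chartSection k Δ.zeroCone (AddMonoidAlgebra.mapDomain _ (.single m.1 1)))
    rw [AddMonoidAlgebra.mapDomain_single]
    rfl

/-- The character `χ^m` as a rational function. -/
noncomputable def charUnit (m : Module.Dual ℤ N) : ((Δ.toricVariety k).functionField)ˣ where
  val := Δ.charToFunctionField k (.single m 1)
  inv := Δ.charToFunctionField k (.single (-m) 1)
  val_inv := by
    rw [← map_mul, AddMonoidAlgebra.single_mul_single, add_neg_cancel, one_mul,
      ← AddMonoidAlgebra.one_def, map_one]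
  inv_val := by
    rw [← map_mul, AddMonoidAlgebra.single_mul_single, neg_add_cancel, one_mul,
      ← AddMonoidAlgebra.one_def, map_one]

lemma charUnit_add (m m' : Module.Dual ℤ N) :
    Δ.charUnit k (m + m') = Δ.charUnit k m * Δ.charUnit k m' := by
  ext
  change Δ.charToFunctionField k (.single (m + m') 1) =
    Δ.charToFunctionField k (.single m 1) * Δ.charToFunctionField k (.single m' 1)
  rw [← map_mul, AddMonoidAlgebra.single_mul_single, one_mul]

lemma charUnit_mem_stalkUnits {σ : Δ.cones} {x : Δ.toricVariety k} (hx : x ∈ Δ.chartOpen k σ)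
    (m : Module.Dual ℤ N) (hm : ∀ v ∈ σ.1, m v = 0) :
    Δ.charUnit k m ∈ stalkUnits (Δ.toricVariety k) x := by
  let a : dualMonoid σ.1 := ⟨m, fun v hv => (hm v hv).ge⟩
  let b : dualMonoid σ.1 := ⟨-m, fun v hv => by rw [LinearMap.neg_apply, hm v hv, neg_zero]⟩
  let f : ChartRing k σ.1 →+* (Δ.toricVariety k).presheaf.stalk x :=
    ((Δ.toricVariety k).presheaf.germ (Δ.chartOpen k σ) x hx).hom.comp (Δ.chartSection k σ)
  have hab : (.single a 1 * .single b 1 : ChartRing k σ.1) = 1 := by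
    rw [AddMonoidAlgebra.single_mul_single, one_mul, AddMonoidAlgebra.one_def]
    congr 1
    exact Subtype.ext (add_neg_cancel m)
  refine ⟨⟨f (.single a 1), f (.single b 1), ?_, ?_⟩, ?_⟩
  · rw [← map_mul, hab, map_one]
  · rw [← map_mul, mul_comm, hab, map_one]
  · ext
    refine Eq.trans ?_ (Δ.germ_chartSection_single k σ a)
    exact Scheme.algebraMap_germ_eq_germToFunctionField _ _ _

lemma charUnit_mk_eq {σ τ : Δ.cones} {x : Δ.toricVariety k} (hσ : x ∈ Δ.chartOpen k σ)
    (hτ : x ∈ Δ.chartOpen k τ) (c : N → ℤ) (m m' : Module.Dual ℤ N) (hm : ∀ v ∈ σ.1, m v = c v)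
    (hm' : ∀ v ∈ τ.1, m' v = c v) :
    (QuotientGroup.mk (Δ.charUnit k m) : _ ⧸ stalkUnits (Δ.toricVariety k) x) =
      QuotientGroup.mk (Δ.charUnit k m') := by
  obtain ⟨κ, h1, h2, hκ⟩ := Δ.mem_chartOpen_inter k hσ hτ
  have h := Δ.charUnit_mem_stalkUnits k hκ (m' - m) fun v hv => by
    rw [LinearMap.sub_apply, hm v (h1 hv), hm' v (h2 hv), sub_self]
  have e : Δ.charUnit k m' = Δ.charUnit k m * Δ.charUnit k (m' - m) := by
    rw [← charUnit_add, add_sub_cancel]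
  rw [QuotientGroup.eq, e, inv_mul_cancel_left]
  exact h

/-- Some cone whose chart contains `x`. -/
noncomputable def chartAt (x : Δ.toricVariety k) : Δ.cones := (Δ.iSup_chartOpen k x).choose

/-- The torus-invariant prime divisor `D_ρ`, with local equation `χ^m` on `U_σ`, where `m` has value `1`
at the generator of `ρ` if it is one of `σ`, and value `0` at all other generators of `σ`. The choices do
not matter, see `rayDivisor_isLocalEquation`. -/
noncomputable def rayDivisor (ρ : Δ.Ray) : CartierDivisor (Δ.toricVariety k) :=
  Additive.ofMul
    ⟨fun x => QuotientGroup.mk (Δ.charUnit k (Δ.rayForm ρ (Δ.chartAt k x))), fun x =>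
      ⟨Δ.chartOpen k (Δ.chartAt k x), Δ.charUnit k (Δ.rayForm ρ (Δ.chartAt k x)),
        (Δ.iSup_chartOpen k x).choose_spec, fun y hy =>
          Δ.charUnit_mk_eq k (Δ.iSup_chartOpen k y).choose_spec hy _ _ _
            (Δ.rayForm_spec ρ _) (Δ.rayForm_spec ρ _)⟩⟩

open Classical in
lemma rayDivisor_isLocalEquation (ρ : Δ.Ray) {σ : Δ.cones} {x : Δ.toricVariety k}
    (hx : x ∈ Δ.chartOpen k σ) (m : Module.Dual ℤ N)
    (hm : ∀ v ∈ σ.1, m v = if v = ρ.1 then 1 else 0) :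
    (Δ.rayDivisor k ρ).IsLocalEquation x (Δ.charUnit k m) :=
  Δ.charUnit_mk_eq k (Δ.iSup_chartOpen k x).choose_spec hx _ _ _ (Δ.rayForm_spec ρ _) hm

/-- `β_ρ`, the class of `D_ρ` in the Picard group. -/
noncomputable abbrev rayClass (ρ : Δ.Ray) : Pic (Δ.toricVariety k) :=
  QuotientAddGroup.mk (Δ.rayDivisor k ρ)

/-- The Cox ring `k[x_ρ]`, with one variable for every ray. -/
abbrev CoxRing : Type u := MvPolynomial Δ.Ray k

/-- The Laurent polynomials in the variables `x_ρ` of the Cox ring. -/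
abbrev LaurentCoxRing : Type u := AddMonoidAlgebra k (Δ.Ray → ℤ)

/-- The field of rational functions in the variables `x_ρ`. -/
abbrev CoxField : Type u := FractionRing (Δ.LaurentCoxRing k)

open Classical in
/-- The inclusion of the Cox ring in the Laurent polynomials. -/
noncomputable def coxToLaurent : Δ.CoxRing k →ₐ[k] Δ.LaurentCoxRing k :=
  MvPolynomial.aeval fun ρ => .single (Pi.single ρ 1) 1

/-- The homomorphism `χ^m ↦ ∏ x_ρ^⟨m, ρ⟩`. -/
noncomputable def charToLaurent : AddMonoidAlgebra k (Module.Dual ℤ N) →+* Δ.LaurentCoxRing k :=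
  AddMonoidAlgebra.mapDomainRingHom k Δ.rayValues

lemma charToLaurent_injective (hΔ : Δ.IsComplete) : Function.Injective (Δ.charToLaurent k) :=
  AddMonoidAlgebra.mapDomain_injective (Δ.rayValues_injective hΔ)

instance : IsDomain (Δ.LaurentCoxRing k) := inferInstance

/-- The ring of regular functions on the torus, inside the Laurent Cox ring. -/
noncomputable def torusToCox : Γ(Δ.toricVariety k, Δ.chartOpen k Δ.zeroCone) →+* Δ.CoxField k :=
  (algebraMap (Δ.LaurentCoxRing k) (Δ.CoxField k)).comp
    ((Δ.charToLaurent k).comp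
      ((AddMonoidAlgebra.mapDomainRingHom k (dualMonoid (∅ : Set N)).subtype).comp
        (RingEquiv.ofBijective _ (Δ.chartSection_bijective k Δ.zeroCone)).symm.toRingHom))

lemma torusToCox_injective (hΔ : Δ.IsComplete) : Function.Injective (Δ.torusToCox k) :=
  (IsFractionRing.injective (Δ.LaurentCoxRing k) (Δ.CoxField k)).comp
    ((Δ.charToLaurent_injective k hΔ).comp
      ((AddMonoidAlgebra.mapDomain_injective Subtype.val_injective).comp
        (RingEquiv.ofBijective _ (Δ.chartSection_bijective k Δ.zeroCone)).symm.injective))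

lemma isFractionRing_torus : IsFractionRing Γ(Δ.toricVariety k, Δ.chartOpen k Δ.zeroCone)
    (Δ.toricVariety k).functionField :=
  have h : IsAffineOpen (⊤ : ((Δ.chart k).obj Δ.zeroCone).Opens) :=
    isAffineOpen_top (Spec (.of (ChartRing k (Δ.zeroCone).1)))
  functionField_isFractionRing_of_isAffineOpen _ (Δ.chartOpen k Δ.zeroCone)
    (h.image_of_isOpenImmersion (Δ.chartι k Δ.zeroCone))

/-- The embedding of the function field `K(X)` in the field of rational functions in the `x_ρ` with
`χ^m ↦ ∏ x_ρ^⟨m, ρ⟩`; its image consists of the homogeneous fractions of degree `0`. -/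
noncomputable def coxEmbedding (hΔ : Δ.IsComplete) :
    (Δ.toricVariety k).functionField →+* Δ.CoxField k :=
  haveI := Δ.isFractionRing_torus k
  IsFractionRing.lift (Δ.torusToCox_injective k hΔ)

lemma coxEmbedding_charUnit (hΔ : Δ.IsComplete) (m : Module.Dual ℤ N) :
    Δ.coxEmbedding k hΔ (Δ.charUnit k m) =
      algebraMap (Δ.LaurentCoxRing k) (Δ.CoxField k) (.single (Δ.rayValues m) 1) := by
  have := Δ.isFractionRing_torus k
  let a : dualMonoid (∅ : Set N) := ⟨m, fun _ h => h.elim⟩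
  have h := Δ.germ_chartSection_single k Δ.zeroCone a
  have h1 : Δ.coxEmbedding k hΔ (Δ.charUnit k m) =
      Δ.torusToCox k (Δ.chartSection k Δ.zeroCone (.single a 1)) := by
    refine (congrArg (Δ.coxEmbedding k hΔ) h.symm).trans ?_
    exact IsFractionRing.lift_algebraMap (Δ.torusToCox_injective k hΔ) _
  rw [h1]
  change algebraMap _ _ (Δ.charToLaurent k (AddMonoidAlgebra.mapDomain _
    ((RingEquiv.ofBijective _ (Δ.chartSection_bijective k Δ.zeroCone)).symm
      (RingEquiv.ofBijective _ (Δ.chartSection_bijective k Δ.zeroCone) (.single a 1))))) = _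
  rw [RingEquiv.symm_apply_apply, AddMonoidAlgebra.mapDomain_single]
  exact congrArg _ AddMonoidAlgebra.mapDomain_single

variable {k}

/-- An element of the Cox ring in the field of rational functions in the `x_ρ`. -/
noncomputable def coxElement (F : Δ.CoxRing k) : Δ.CoxField k :=
  algebraMap (Δ.LaurentCoxRing k) (Δ.CoxField k) (Δ.coxToLaurent k F)

/-- `D` is the zero locus of the homogeneous polynomial `F`: on `U_σ`, where the variables `x_ρ` with `ρ`
not in `σ` are invertible, `D` is given by `x^{-b} F`, for a monomial `x^b` in these variables that
makes the quotient a rational function on `X`. -/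
def IsZeroDivisor (F : Δ.CoxRing k) (D : CartierDivisor (Δ.toricVariety k)) : Prop :=
  ∀ σ : Δ.cones, ∃ (b : Δ.Ray → ℤ) (f : AddMonoidAlgebra k (Module.Dual ℤ N))
    (hf : Δ.charToFunctionField k f ≠ 0),
    (∀ ρ : Δ.Ray, ρ.1 ∈ σ.1 → b ρ = 0) ∧
    Δ.coxToLaurent k F = .single b 1 * Δ.charToLaurent k f ∧
    ∀ x ∈ Δ.chartOpen k σ, D.IsLocalEquation x (Units.mk0 _ hf)

end SmoothFan

end Cox

section Maps

open Limits

instance (X : Scheme.{u}) : HasFiniteBiproducts X.Modules := Abelian.hasFiniteBiproducts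

namespace SmoothFan

variable {N : Type u} [AddCommGroup N] [Module.Free ℤ N] (Δ : SmoothFan N)
  (k : Type u) [Field k]

/-- The group `N_1(X) = Hom(Pic X, ℤ)`. -/
abbrev N1 : Type u := Pic (Δ.toricVariety k) →+ ℤ

/-- `N_1(X) ⊗_ℤ O_X`. -/
noncomputable abbrev curveModule : (Δ.toricVariety k).Modules :=
  constantTensor (Δ.N1 k) (Δ.toricVariety k)

/-- The direct sum of the `O_X(D_ρ)`. -/
noncomputable abbrev rayModule : (Δ.toricVariety k).Modules :=
  ⨁ fun ρ : Δ.Ray => lineBundle (Δ.rayDivisor k ρ)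

/-- The tangent sheaf `T_X`. -/
noncomputable abbrev tangentModule : (Δ.toricVariety k).Modules :=
  tangentSheaf (Δ.structureMorphism k)

variable {Δ k}

/-- A section of `O_X(D_ρ)` as a section of the direct sum. -/
noncomputable def raySection {U : (Δ.toricVariety k).Opens} (ρ : Δ.Ray)
    (s : Γ(lineBundle (Δ.rayDivisor k ρ), U)) : Γ(Δ.rayModule k, U) :=
  Scheme.Modules.Hom.app (biproduct.ι (fun ρ : Δ.Ray => lineBundle (Δ.rayDivisor k ρ)) ρ) U s

/-- The component in `O_X(D_ρ)` of a section of the direct sum. -/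
noncomputable def rayComponent {U : (Δ.toricVariety k).Opens} (ρ : Δ.Ray)
    (s : Γ(Δ.rayModule k, U)) : Γ(lineBundle (Δ.rayDivisor k ρ), U) :=
  Scheme.Modules.Hom.app (biproduct.π (fun ρ : Δ.Ray => lineBundle (Δ.rayDivisor k ρ)) ρ) U s

/-- The homogeneous fraction `s · G` that corresponds to the section `s` of `O_X(D)`, where `D` is the
zero locus of the homogeneous polynomial `G`. In this way the sections of `O_X(D)` over `U` are the
fractions of degree `deg G` in the Cox ring that are regular over `U`. -/
noncomputable def homogenize (hΔ : Δ.IsComplete) {D : CartierDivisor (Δ.toricVariety k)}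
    (G : Δ.CoxRing k) {U : (Δ.toricVariety k).Opens} (s : Γ(lineBundle D, U)) (x : U) :
    Δ.CoxField k :=
  Δ.coxEmbedding k hΔ (lineBundle.value s x) * Δ.coxElement G

/-- `a` is the map with components `φ ⊗ g ↦ φ(β_ρ) g x_ρ`. -/
def IsEulerLeft (hΔ : Δ.IsComplete) (a : Δ.curveModule k ⟶ Δ.rayModule k) : Prop :=
  ∀ (U : (Δ.toricVariety k).Opens) (g : Γ(Δ.toricVariety k, U)) (φ : Δ.N1 k) (ρ : Δ.Ray) (x : U),
    homogenize hΔ (MvPolynomial.X ρ) (rayComponent ρ (a.app U (constantTensor.tmul g φ))) x =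
      φ (Δ.rayClass k ρ) •
        (Δ.coxEmbedding k hΔ (rationalFunction x g) * Δ.coxElement (MvPolynomial.X ρ))

/-- `b` sends the local section `s` of `O_X(D_ρ)` to the derivation `χ^u ↦ ⟨u, ρ⟩ s χ^u`. -/
def IsEulerRight (b : Δ.rayModule k ⟶ Δ.tangentModule k) : Prop :=
  ∀ (U V : (Δ.toricVariety k).Opens) (hV : V ≤ U) (ρ : Δ.Ray)
    (s : Γ(lineBundle (Δ.rayDivisor k ρ), U)) (u : Module.Dual ℤ N)
    (f : Γ(Δ.toricVariety k, V)), (∀ x : V, rationalFunction x f = Δ.charUnit k u) →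
    ∀ x : V, rationalFunction x (tangentSheaf.apply (b.app U (raySection ρ s)) hV f) =
      u ρ.1 • (lineBundle.value s ⟨x.1, hV x.2⟩ * Δ.charUnit k u)

/-- `c` is multiplication by `F`, from `O_X` to `O_X(D)`. -/
def IsMulBy (hΔ : Δ.IsComplete) (F : Δ.CoxRing k) {D : CartierDivisor (Δ.toricVariety k)}
    (c : structureModule (Δ.toricVariety k) ⟶ lineBundle D) : Prop :=
  ∀ (U : (Δ.toricVariety k).Opens) (g : Γ(Δ.toricVariety k, U)) (x : U),
    homogenize hΔ F (c.app U g) x =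
      Δ.coxEmbedding k hΔ (rationalFunction x g) * Δ.coxElement F

/-- `v` is the evaluation at `β`, `φ ⊗ g ↦ φ(β) g`. -/
def IsDegreeMap (β : Pic (Δ.toricVariety k))
    (v : Δ.curveModule k ⟶ structureModule (Δ.toricVariety k)) : Prop :=
  ∀ (U : (Δ.toricVariety k).Opens) (g : Γ(Δ.toricVariety k, U)) (φ : Δ.N1 k),
    v.app U (constantTensor.tmul g φ) = (φ β • g : Γ(Δ.toricVariety k, U))

/-- `v` is multiplication by `∂F/∂x_ρ` on `O_X(D_ρ)`. -/
def IsJacobianMap (hΔ : Δ.IsComplete) (F : Δ.CoxRing k) {D : CartierDivisor (Δ.toricVariety k)}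
    (v : Δ.rayModule k ⟶ lineBundle D) : Prop :=
  ∀ (U : (Δ.toricVariety k).Opens) (ρ : Δ.Ray) (s : Γ(lineBundle (Δ.rayDivisor k ρ), U)) (x : U),
    homogenize hΔ F (v.app U (raySection ρ s)) x =
      homogenize hΔ (MvPolynomial.X ρ) s x * Δ.coxElement (MvPolynomial.pderiv ρ F)

end SmoothFan

section Normal

variable {X : Scheme.{u}} [IsIntegral X]

/-- `e` is the natural map `O_X(D) → Hom(O_X(-D), O_D)`: it sends `t` to `s ↦ t s|_D`. -/
def IsNormalRestriction (D : CartierDivisor X) (e : lineBundle D ⟶ normalSheaf D) : Prop :=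
  ∀ (U V : X.Opens) (hV : V ≤ U) (t : Γ(lineBundle D, U)) (s : Γ(lineBundle (-D), V))
    (f : Γ(X, V)),
    (∀ x : V, lineBundle.value t ⟨x.1, hV x.2⟩ * lineBundle.value s x = rationalFunction x f) →
    internalHom.apply (e.app U t) hV s = restrictToDivisor D f

/-- `d` sends the derivation `δ` to `s ↦ δ(s)|_D`, where `s ∈ O_X(-D) ⊆ O_X`. -/
def IsNormalDerivative {k : CommRingCat.{u}} (p : X ⟶ Spec k) (D : CartierDivisor X)
    (d : tangentSheaf p ⟶ normalSheaf D) : Prop :=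
  ∀ (U V : X.Opens) (hV : V ≤ U) (δ : Γ(tangentSheaf p, U)) (s : Γ(lineBundle (-D), V))
    (f : Γ(X, V)), (∀ x : V, lineBundle.value s x = rationalFunction x f) →
    internalHom.apply (d.app U δ) hV s = restrictToDivisor D (tangentSheaf.apply δ hV f)

end Normal

end Maps

/-!
All sheaves in the diagram except the normal sheaf are described inside the function field `K` of the
integral scheme `X`: a section of `O_X(D)` over `U` is a rational function whose product with the local
equations of `D` is regular, and a vector field acts on `K` by a *logarithmic derivation*
`χ^m ↦ c(m) χ^m` for an additive map `c : M → K` (`SmoothFan.exists_isLogarithmic`). Exactness of a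
sequence of sheaves is tested on sections (`shortExact_of_sections`), and coherence by exhibiting frames
over affine open sets (`coherentOn_of_frame`).

*Bottom row.* Where `D` has a local equation `f`, a homomorphism `O_X(-D) → O_D` is determined by its
value at `f`, so that `t ↦ (s ↦ π(ts))` is surjective over small affine open sets, with kernel `O_X`
(`shortExact_normal`).

*The Picard group.* The coordinate rings of the charts are localizations of polynomial rings, hence
factorial, and Cartier divisors are principal on the charts. As the units on the torus are the multiples
of characters, every divisor is equivalent to some `∑ a_ρ D_ρ`, and such a divisor is principal
only if `a_ρ = ⟨m, ρ⟩` for some `m`. So `N_1(X)` is the group of relations between the generators of the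
rays. A complete fan has a cone `σ` of full dimension, whose generators are a basis of `N`; therefore a
relation is determined by arbitrary coefficients outside of `σ`, which gives the basis
`SmoothFan.dualCurve` of `N_1(X)`.

*Top row.* The image of `(s_ρ)` in `T_X` is the logarithmic derivation `m ↦ ∑ ⟨m, ρ⟩ s_ρ`. If it is
zero, then the `s_ρ` form a relation with coefficients in `K`; they have no poles by
`SmoothFan.regular_of_relation`, so they come from `N_1(X) ⊗ O_X`. Local surjectivity is
seen in the coordinates of a chart (`SmoothFan.exists_eulerRight_locally`).

*Squares.* Let `h_ρ = x_ρ (∂F/∂x_ρ) / F`, a rational function on `X` (`SmoothFan.logPartial`); the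
middle vertical map is `(s_ρ) ↦ ∑ s_ρ h_ρ`. The left square is Euler's identity
`∑ φ(β_ρ) h_ρ = φ(β)` for a homogeneous polynomial of degree `β`. In the right square the difference of the
two ways around sends a section `f a` of `O_X(-D)`, with `f` a local equation of `D`, to a multiple
of `f` by the product rule, in every characteristic (`SmoothFan.regularAt_neg_logDer_sub`).
-/

/-! ### Sheaves of modules: morphisms, exactness and coherence -/

section Modules

variable {X : Scheme.{u}} {A B C M : X.Modules}

/-- A morphism of sheaves of modules from its maps on sections. -/
noncomputable def modulesHomMk (f : ∀ U : X.Opens, Γ(A, U) →+ Γ(B, U))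
    (hsmul : ∀ (U : X.Opens) (r : Γ(X, U)) (s : Γ(A, U)), f U (r • s) = r • f U s)
    (hres : ∀ (U V : X.Opens) (h : V ≤ U) (s : Γ(A, U)),
      f V (A.presheaf.map (homOfLE h).op s) = B.presheaf.map (homOfLE h).op (f U s)) : A ⟶ B :=
  ⟨PresheafOfModules.homMk
    { app := fun U => AddCommGrpCat.ofHom (f U.unop)
      naturality := fun U V i => by
        ext s
        exact hres U.unop V.unop i.unop.le s }
    fun U r s => hsmul U.unop r s⟩

lemma modulesHom_ext {f g : A ⟶ B} (h : ∀ (U : X.Opens) (s : Γ(A, U)), f.app U s = g.app U s) :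
    f = g :=
  Scheme.Modules.hom_ext _ _ fun U => by
    ext s
    exact h U s

lemma modulesHom_app_res (f : A ⟶ B) {U V : X.Opens} (h : V ≤ U) (s : Γ(A, U)) :
    f.app V (A.presheaf.map (homOfLE h).op s) = B.presheaf.map (homOfLE h).op (f.app U s) :=
  ConcreteCategory.congr_hom (f.mapPresheaf.naturality (homOfLE h).op) s

lemma modulesHom_sum_app {ι : Type*} (s : Finset ι) (g : ι → (A ⟶ B)) (U : X.Opens)
    (t : Γ(A, U)) : (∑ i ∈ s, g i).app U t = ∑ i ∈ s, (g i).app U t :=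
  map_sum (AddMonoidHom.mk' (fun f : A ⟶ B => f.app U t) fun _ _ => rfl) g s

lemma modules_res_self {U : X.Opens} (s : Γ(M, U)) :
    M.presheaf.map (homOfLE le_rfl).op s = s := by
  have : (homOfLE (le_refl U)).op = 𝟙 (op U) := rfl
  rw [this, M.presheaf.map_id]
  rfl

lemma modules_eq_of_locally_eq {U : X.Opens} (s t : Γ(M, U))
    (h : ∀ x ∈ U, ∃ (V : X.Opens) (hV : V ≤ U), x ∈ V ∧
      M.presheaf.map (homOfLE hV).op s = M.presheaf.map (homOfLE hV).op t) : s = t := by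
  let MS : TopCat.Sheaf Ab.{u} X := ⟨M.presheaf, M.isSheaf⟩
  choose V hV hx hst using h
  exact MS.eq_of_locally_eq' (fun x : U => V x.1 x.2) U (fun x => homOfLE (hV x.1 x.2))
    (fun x hxU => Opens.mem_iSup.mpr ⟨⟨x, hxU⟩, hx x hxU⟩) s t fun x => hst x.1 x.2

/-- A sequence of sheaves of modules is short exact if it is left exact on sections over every open
set and the second map is locally surjective. -/
theorem shortExact_of_sections (a : A ⟶ B) (b : B ⟶ C)
    (hinj : ∀ (U : X.Opens) (s : Γ(A, U)), a.app U s = 0 → s = 0)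
    (hzero : ∀ (U : X.Opens) (s : Γ(A, U)), b.app U (a.app U s) = 0)
    (hex : ∀ (U : X.Opens) (s : Γ(B, U)), b.app U s = 0 → ∃ t, a.app U t = s)
    (hsurj : ∀ (U : X.Opens) (t : Γ(C, U)), ∀ x ∈ U, ∃ (V : X.Opens) (hV : V ≤ U), x ∈ V ∧
      ∃ s : Γ(B, V), b.app V s = C.presheaf.map (homOfLE hV).op t) :
    ∃ w : a ≫ b = 0, (ShortComplex.mk a b w).ShortExact := by
  have w : a ≫ b = 0 := modulesHom_ext fun U s => hzero U s
  have hinj' : ∀ U, Function.Injective (a.app U) := fun U =>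
    (injective_iff_map_eq_zero _).mpr (hinj U)
  have hmono : Mono a := ⟨fun f g h => modulesHom_ext fun U s => hinj' U
    (ConcreteCategory.congr_hom (congrArg (fun k => Scheme.Modules.Hom.app k U) h) s)⟩
  have hepi : Epi b := ⟨fun f g h => modulesHom_ext fun U t =>
    modules_eq_of_locally_eq _ _ fun x hx => by
      obtain ⟨V, hV, hxV, s, hs⟩ := hsurj U t x hx
      refine ⟨V, hV, hxV, ?_⟩
      rw [← modulesHom_app_res, ← modulesHom_app_res, ← hs]
      exact ConcreteCategory.congr_hom (congrArg (fun k => Scheme.Modules.Hom.app k V) h) s⟩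
  refine ⟨w, ?_⟩
  have hker : Limits.IsLimit (Limits.KernelFork.ofι a w) := by
    refine Limits.KernelFork.IsLimit.ofι' a w fun {Z} k hk => ?_
    have hk' : ∀ (U : X.Opens) (z : Γ(Z, U)), ∃ t, a.app U t = k.app U z := fun U z =>
      hex U _ (ConcreteCategory.congr_hom (congrArg (fun k => Scheme.Modules.Hom.app k U) hk) z)
    choose l hl using hk'
    refine ⟨modulesHomMk (fun U => AddMonoidHom.mk' (l U) fun z z' => hinj' U ?_)
      (fun U r z => hinj' U ?_) (fun U V h z => hinj' V ?_), modulesHom_ext fun U z => hl U z⟩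
    · rw [map_add, hl, hl, hl, map_add]
    · change a.app U (l U (r • z)) = a.app U (r • l U z)
      rw [hl, Scheme.Modules.Hom.app_smul, Scheme.Modules.Hom.app_smul, hl]
    · change a.app V (l V _) = a.app V (A.presheaf.map (homOfLE h).op (l U z))
      rw [hl, modulesHom_app_res, modulesHom_app_res, hl]
  exact
    { exact := ShortComplex.exact_of_f_is_kernel _ hker
      mono_f := hmono
      epi_g := hepi }

/-- The condition of `IsCoherent` for one fixed affine open set. -/
def CoherentOn (M : X.Modules) (U : X.Opens) : Prop :=
  Module.Finite Γ(X, U) Γ(M, U) ∧ ∀ f : Γ(X, U),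
    (∀ t : Γ(M, X.basicOpen f), ∃ (n : ℕ) (s : Γ(M, U)),
      (X.presheaf.map (homOfLE (X.basicOpen_le f)).op f) ^ n • t =
        M.presheaf.map (homOfLE (X.basicOpen_le f)).op s) ∧
    ∀ s : Γ(M, U), M.presheaf.map (homOfLE (X.basicOpen_le f)).op s = 0 → ∃ n : ℕ, f ^ n • s = 0

lemma isCoherent_of_coherentOn
    (h : ∀ x : X, ∃ U : X.Opens, IsAffineOpen U ∧ x ∈ U ∧ CoherentOn M U) : IsCoherent M :=
  fun x => by
    obtain ⟨U, hU, hx, h1, h2⟩ := h x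
    exact ⟨U, hU, hx, h1, h2⟩

lemma exists_pow_mul_eq_res {U : X.Opens} (hU : IsAffineOpen U) (f : Γ(X, U))
    (t : Γ(X, X.basicOpen f)) : ∃ (n : ℕ) (s : Γ(X, U)),
      (X.presheaf.map (homOfLE (X.basicOpen_le f)).op f) ^ n * t =
        X.presheaf.map (homOfLE (X.basicOpen_le f)).op s := by
  have := hU.isLocalization_basicOpen f
  obtain ⟨n, s, hs⟩ := IsLocalization.Away.surj f t
  exact ⟨n, s, (mul_comm _ _).trans hs⟩

lemma exists_pow_mul_eq_zero {U : X.Opens} (hU : IsAffineOpen U) (f s : Γ(X, U))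
    (hs : X.presheaf.map (homOfLE (X.basicOpen_le f)).op s = 0) : ∃ n : ℕ, f ^ n * s = 0 := by
  have := hU.isLocalization_basicOpen f
  obtain ⟨⟨_, n, rfl⟩, hc⟩ := (IsLocalization.map_eq_zero_iff (.powers f)
    Γ(X, X.basicOpen f) s).mp hs
  exact ⟨n, hc⟩

/-- A sheaf that is free on the affine open set `U`, with a finite basis, satisfies the condition of
coherence there. -/
lemma coherentOn_of_frame {U : X.Opens} (hU : IsAffineOpen U) {ι : Type*} [Fintype ι]
    (e : ι → Γ(M, U))
    (h : ∀ (V : X.Opens) (hV : V ≤ U) (s : Γ(M, V)), ∃ c : ι → Γ(X, V),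
      s = ∑ i, c i • M.presheaf.map (homOfLE hV).op (e i))
    (h0 : ∀ (V : X.Opens) (hV : V ≤ U) (c : ι → Γ(X, V)),
      ∑ i, c i • M.presheaf.map (homOfLE hV).op (e i) = 0 → ∀ i, c i = 0) :
    CoherentOn M U := by
  have hself : ∀ s : Γ(M, U), ∃ c : ι → Γ(X, U), s = ∑ i, c i • e i := fun s => by
    obtain ⟨c, hc⟩ := h U le_rfl s
    exact ⟨c, by simpa only [modules_res_self] using hc⟩
  refine ⟨⟨Submodule.fg_def.mpr ⟨Set.range e, Set.finite_range e, ?_⟩⟩, fun f => ⟨fun t => ?_, fun s hs => ?_⟩⟩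
  · refine eq_top_iff.mpr fun s _ => ?_
    obtain ⟨c, rfl⟩ := hself s
    exact sum_mem fun i _ => Submodule.smul_mem _ _ (Submodule.subset_span ⟨i, rfl⟩)
  · obtain ⟨c, rfl⟩ := h _ (X.basicOpen_le f) t
    choose n a ha using fun i => exists_pow_mul_eq_res hU f (c i)
    let N := ∑ i, n i
    refine ⟨N, ∑ i, (f ^ (N - n i) * a i) • e i, ?_⟩
    rw [map_sum, Finset.smul_sum]
    refine Finset.sum_congr rfl fun i _ => ?_
    have hN : n i ≤ N := Finset.single_le_sum (f := n) (fun _ _ => Nat.zero_le _)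
      (Finset.mem_univ i)
    rw [Scheme.Modules.map_smul, map_mul, map_pow, ← ha i, ← mul_assoc, ← pow_add,
      Nat.sub_add_cancel hN, smul_smul]
  · obtain ⟨c, rfl⟩ := hself s
    have hc : ∀ i, X.presheaf.map (homOfLE (X.basicOpen_le f)).op (c i) = 0 := by
      refine h0 _ (X.basicOpen_le f) _ ?_
      simpa only [map_sum, Scheme.Modules.map_smul] using hs
    choose n hn using fun i => exists_pow_mul_eq_zero hU f (c i) (hc i)
    refine ⟨∑ i, n i, ?_⟩
    rw [Finset.smul_sum]
    refine Finset.sum_eq_zero fun i _ => ?_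
    have hN : n i ≤ ∑ i, n i := Finset.single_le_sum (f := n) (fun _ _ => Nat.zero_le _)
      (Finset.mem_univ i)
    rw [smul_smul, ← Nat.sub_add_cancel hN, pow_add, mul_assoc, hn i, mul_zero, zero_smul]

/-- The cokernel of a map of coherent sheaves is coherent, if it can be computed on sections over the
affine open subsets of `U`. -/
lemma coherentOn_of_quotient {U : X.Opens} (hU : IsAffineOpen U) (c : A ⟶ B) (e : B ⟶ C)
    (hA : CoherentOn A U) (hB : CoherentOn B U)
    (hsurj : ∀ V : X.Opens, V ≤ U → IsAffineOpen V → Function.Surjective (e.app V))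
    (hex : ∀ (V : X.Opens) (s : Γ(B, V)), e.app V s = 0 → ∃ t, c.app V t = s)
    (hzero : ∀ (V : X.Opens) (s : Γ(A, V)), e.app V (c.app V s) = 0) :
    CoherentOn C U := by
  refine ⟨?_, fun f => ⟨fun t => ?_, fun s hs => ?_⟩⟩
  · let l : Γ(B, U) →ₗ[Γ(X, U)] Γ(C, U) :=
      { toFun := e.app U
        map_add' := map_add _
        map_smul' := Scheme.Modules.Hom.app_smul e }
    have := hB.1
    exact Module.Finite.of_surjective l (hsurj U le_rfl hU)
  · obtain ⟨b, rfl⟩ := hsurj _ (X.basicOpen_le f) (hU.basicOpen f) t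
    obtain ⟨n, s, hs⟩ := (hB.2 f).1 b
    exact ⟨n, e.app U s, by rw [← Scheme.Modules.Hom.app_smul, hs, modulesHom_app_res]⟩
  · obtain ⟨b, rfl⟩ := hsurj U le_rfl hU s
    rw [← modulesHom_app_res] at hs
    obtain ⟨a, ha⟩ := hex _ _ hs
    obtain ⟨n, a', ha'⟩ := (hA.2 f).1 a
    obtain ⟨m, hm⟩ := (hB.2 f).2 (f ^ n • b - c.app U a') (by
      rw [map_sub, Scheme.Modules.map_smul, map_pow, ← modulesHom_app_res, ← ha',
        Scheme.Modules.Hom.app_smul, ha, sub_self])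
    refine ⟨m + n, ?_⟩
    have h := congrArg (e.app U) hm
    rw [Scheme.Modules.Hom.app_smul, map_sub, hzero, sub_zero, Scheme.Modules.Hom.app_smul,
      smul_smul, ← pow_add, map_zero] at h
    exact h

end Modules

/-! ### Rational functions and regular functions -/

section RationalFunctions

variable {X : Scheme.{u}} [IsIntegral X]

section
variable {U V : X.Opens} (x : U)

lemma rationalFunction_zero : rationalFunction x (0 : Γ(X, U)) = 0 := by simp [rationalFunction]

lemma rationalFunction_add (f g : Γ(X, U)) :
    rationalFunction x (f + g) = rationalFunction x f + rationalFunction x g := by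
  simp [rationalFunction]

lemma rationalFunction_mul (f g : Γ(X, U)) :
    rationalFunction x (f * g) = rationalFunction x f * rationalFunction x g := by
  simp [rationalFunction]

lemma rationalFunction_pow (f : Γ(X, U)) (n : ℕ) :
    rationalFunction x (f ^ n) = rationalFunction x f ^ n := by
  simp [rationalFunction]

lemma rationalFunction_zsmul (n : ℤ) (f : Γ(X, U)) :
    rationalFunction x (n • f) = n • rationalFunction x f := by
  simp [rationalFunction]

lemma rationalFunction_sum {ι : Type*} (s : Finset ι) (f : ι → Γ(X, U)) :
    rationalFunction x (∑ i ∈ s, f i) = ∑ i ∈ s, rationalFunction x (f i) := by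
  simp [rationalFunction]

lemma rationalFunction_mem (f : Γ(X, U)) :
    rationalFunction x f ∈ (algebraMap (X.presheaf.stalk x.1) X.functionField).range := ⟨_, rfl⟩

lemma rationalFunction_res (h : V ≤ U) (y : V) (f : Γ(X, U)) :
    rationalFunction y (X.presheaf.map (homOfLE h).op f) = rationalFunction ⟨y.1, h y.2⟩ f := by
  rw [rationalFunction, rationalFunction, TopCat.Presheaf.germ_res_apply]

end

lemma algebraMap_stalk_injective (x : X) :
    Function.Injective (algebraMap (X.presheaf.stalk x) X.functionField) :=
  IsFractionRing.injective _ _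

lemma section_ext_rationalFunction {U : X.Opens} {f g : Γ(X, U)}
    (h : ∀ x : U, rationalFunction x f = rationalFunction x g) : f = g :=
  TopCat.Presheaf.section_ext X.sheaf U f g fun x hx =>
    algebraMap_stalk_injective x (h ⟨x, hx⟩)

/-- A rational function that is regular at every point of `U` is a section of `O_X` over `U`. -/
lemma exists_section_of_regular {U : X.Opens} (h : U → X.functionField) (hc : ∀ x y, h x = h y)
    (hr : ∀ x : U, h x ∈ (algebraMap (X.presheaf.stalk x.1) X.functionField).range) :
    ∃ f : Γ(X, U), ∀ x : U, rationalFunction x f = h x := by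
  choose a ha using hr
  choose V hxV s hs using fun x : U => X.presheaf.exists_germ_eq (a x)
  have hval : ∀ (x : U) (y : V x), rationalFunction y (s x) = h x := fun x y => by
    rw [rationalFunction_eq y ⟨x.1, hxV x⟩, rationalFunction, hs, ha]
  obtain ⟨f, hf, -⟩ := X.sheaf.existsUnique_gluing' (fun x : U => V x ⊓ U) U
    (fun x => homOfLE inf_le_right) (fun x hx => Opens.mem_iSup.mpr ⟨⟨x, hx⟩, hxV _, hx⟩)
    (fun x => X.presheaf.map (homOfLE (inf_le_left : V x ⊓ U ≤ V x)).op (s x)) (fun x y => by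
      refine section_ext_rationalFunction fun z => ?_
      refine (rationalFunction_res _ z _).trans
        (Eq.trans ?_ (rationalFunction_res _ z _).symm)
      rw [rationalFunction_res, rationalFunction_res, hval, hval]
      exact hc x y)
  refine ⟨f, fun x => ?_⟩
  have h1 := congrArg (rationalFunction (⟨x.1, hxV x, x.2⟩ : (V x ⊓ U : X.Opens))) (hf x)
  rw [rationalFunction_res, hval] at h1
  exact (rationalFunction_res inf_le_right (⟨x.1, hxV x, x.2⟩ : (V x ⊓ U : X.Opens)) f).symm.trans h1

/-- The section of `O_X` given by a rational function that is regular on `U`. -/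
noncomputable def sectionOfRegular {U : X.Opens} (h : U → X.functionField)
    (hc : ∀ x y, h x = h y)
    (hr : ∀ x : U, h x ∈ (algebraMap (X.presheaf.stalk x.1) X.functionField).range) : Γ(X, U) :=
  (exists_section_of_regular h hc hr).choose

lemma rationalFunction_sectionOfRegular {U : X.Opens} (h : U → X.functionField)
    (hc : ∀ x y, h x = h y)
    (hr : ∀ x : U, h x ∈ (algebraMap (X.presheaf.stalk x.1) X.functionField).range) (x : U) :
    rationalFunction x (sectionOfRegular h hc hr) = h x :=
  (exists_section_of_regular h hc hr).choose_spec x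

lemma genericPoint_mem_of_mem {U : X.Opens} {x : X} (hx : x ∈ U) : genericPoint X ∈ U :=
  (genericPoint_spec X).mem_open_set_iff U.2 |>.mpr ⟨x, trivial, hx⟩

lemma mem_basicOpen_of_rationalFunction_ne_zero {U : X.Opens} {f : Γ(X, U)} (x : U)
    (h : rationalFunction x f ≠ 0) : genericPoint X ∈ X.basicOpen f := by
  have hη := genericPoint_mem_of_mem x.2
  refine (X.mem_basicOpen f _ hη).mpr ?_
  refine isUnit_iff_ne_zero.mpr fun h0 => h ?_
  rw [rationalFunction_eq x ⟨_, hη⟩, rationalFunction, h0, map_zero]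

end RationalFunctions

/-! ### Cartier divisors and their line bundles -/

section LineBundle

variable {X : Scheme.{u}} [IsIntegral X]

namespace CartierDivisor

/-- The rational function `r` is a section of `O_X(D)` near `x`. -/
def RegularAt (D : CartierDivisor X) (x : X) (r : X.functionField) : Prop :=
  ∀ f : (X.functionField)ˣ, D.IsLocalEquation x f →
    r * f ∈ (algebraMap (X.presheaf.stalk x) X.functionField).range

variable {D E : CartierDivisor X} {x : X} {f g : (X.functionField)ˣ} {r : X.functionField}

lemma isLocalEquation_iff (hf : D.IsLocalEquation x f) :
    D.IsLocalEquation x g ↔ f⁻¹ * g ∈ stalkUnits X x := by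
  rw [← QuotientGroup.eq]
  exact ⟨fun h => hf.symm.trans h, fun h => Eq.trans hf h⟩

lemma IsLocalEquation.regularAt_iff (hf : D.IsLocalEquation x f) :
    D.RegularAt x r ↔ r * f ∈ (algebraMap (X.presheaf.stalk x) X.functionField).range := by
  refine ⟨fun h => h f hf, fun h g hg => ?_⟩
  obtain ⟨a, ha⟩ := (isLocalEquation_iff hf).mp hg
  have : r * g = r * f * algebraMap (X.presheaf.stalk x) X.functionField a := by
    have h1 : algebraMap (X.presheaf.stalk x) X.functionField a = (f⁻¹ * g : (X.functionField)ˣ) :=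
      congrArg Units.val ha
    rw [h1, Units.val_mul, mul_assoc, Units.mul_inv_cancel_left]
  rw [this]
  exact mul_mem h ⟨_, rfl⟩

lemma IsLocalEquation.neg (hf : D.IsLocalEquation x f) : (-D).IsLocalEquation x f⁻¹ :=
  congrArg (fun z : (X.functionField)ˣ ⧸ stalkUnits X x => z⁻¹) (show _ = _ from hf)

lemma IsLocalEquation.add (hf : D.IsLocalEquation x f) (hg : E.IsLocalEquation x g) :
    (D + E).IsLocalEquation x (f * g) :=
  congrArg₂ (fun y z : (X.functionField)ˣ ⧸ stalkUnits X x => y * z) (show _ = _ from hf)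
    (show _ = _ from hg)

lemma isLocalEquation_zero : (0 : CartierDivisor X).IsLocalEquation x 1 := rfl

lemma isLocalEquation_principal (f : (X.functionField)ˣ) :
    (principalDivisor X (Additive.ofMul f)).IsLocalEquation x f := rfl

lemma ext_of_isLocalEquation
    (h : ∀ x : X, ∃ f, D.IsLocalEquation x f ∧ E.IsLocalEquation x f) : D = E := by
  refine Additive.toMul.injective (Subtype.ext (funext fun x => ?_))
  obtain ⟨f, h1, h2⟩ := h x
  exact Eq.trans h1 h2.symm

variable (D x) in
lemma exists_isLocalEquation : ∃ (U : X.Opens) (f : (X.functionField)ˣ), x ∈ U ∧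
    ∀ y ∈ U, D.IsLocalEquation y f :=
  (show Additive (cartierDivisors X) from D).toMul.2 x

lemma RegularAt.mul {s : X.functionField} (h : D.RegularAt x r)
    (hs : s ∈ (algebraMap (X.presheaf.stalk x) X.functionField).range) : D.RegularAt x (s * r) :=
  fun f hf => by
    rw [mul_assoc]
    exact mul_mem hs (h f hf)

lemma RegularAt.add {s : X.functionField} (h : D.RegularAt x r) (hs : D.RegularAt x s) :
    D.RegularAt x (r + s) := fun f hf => by
  rw [add_mul]
  exact add_mem (h f hf) (hs f hf)

variable (D x) in
lemma regularAt_zero : D.RegularAt x 0 := fun f _ => by simp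

lemma RegularAt.mul_neg {s : X.functionField} (h : D.RegularAt x r) (hs : (-D).RegularAt x s) :
    r * s ∈ (algebraMap (X.presheaf.stalk x) X.functionField).range := by
  obtain ⟨U, f, hx, hf⟩ := D.exists_isLocalEquation x
  have h1 := mul_mem (h f (hf x hx)) (hs f⁻¹ (hf x hx).neg)
  rwa [mul_mul_mul_comm, Units.mul_inv, mul_one] at h1

variable (D) in
/-- `D` is an effective divisor. -/
def IsEffective : Prop := ∀ x : X, D.RegularAt x 1

lemma IsEffective.regularAt (hD : D.IsEffective)
    (hr : r ∈ (algebraMap (X.presheaf.stalk x) X.functionField).range) : D.RegularAt x r := by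
  simpa only [mul_one] using (hD x).mul hr

lemma IsEffective.mem_of_regularAt_neg (hD : D.IsEffective) (hr : (-D).RegularAt x r) :
    r ∈ (algebraMap (X.presheaf.stalk x) X.functionField).range := by
  simpa only [one_mul] using (hD x).mul_neg hr

end CartierDivisor

namespace lineBundle

variable {D : CartierDivisor X} {U V : X.Opens}

/-- The section of `O_X(D)` over `U` given by a rational function, as a constant function on `U`. -/
noncomputable def mk (h : U → X.functionField) (hc : ∀ x y, h x = h y)
    (hr : ∀ x : U, D.RegularAt x.1 (h x)) : Γ(lineBundle D, U) :=
  (⟨h, (IsLocallyConstant.iff_exists_open _).mpr fun x =>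
    ⟨Set.univ, isOpen_univ, trivial, fun y _ => hc y x⟩, hr⟩ : (lineBundleData D).sec U)

lemma value_mk (h : U → X.functionField) (hc : ∀ x y, h x = h y)
    (hr : ∀ x : U, D.RegularAt x.1 (h x)) (x : U) : value (mk h hc hr) x = h x := rfl

lemma value_ext {s t : Γ(lineBundle D, U)} (h : ∀ x, value s x = value t x) : s = t :=
  Subtype.ext (funext h)

lemma regularAt_value (s : Γ(lineBundle D, U)) (x : U) : D.RegularAt x.1 (value s x) :=
  (show (lineBundleData D).sec U from s).2.2 x

lemma value_eq (s : Γ(lineBundle D, U)) (x y : U) : value s x = value s y := by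
  have : PreconnectedSpace U := Subtype.preconnectedSpace
    (PreirreducibleSpace.isPreirreducible_univ.open_subset U.2
      (Set.subset_univ _)).isPreconnected
  exact @IsLocallyConstant.apply_eq_of_preconnectedSpace U _ _ this _
    (show (lineBundleData D).sec U from s).2.1 x y

lemma value_add (s t : Γ(lineBundle D, U)) (x : U) : value (s + t) x = value s x + value t x := rfl

lemma value_zero (x : U) : value (0 : Γ(lineBundle D, U)) x = 0 := rfl

lemma value_smul (r : Γ(X, U)) (s : Γ(lineBundle D, U)) (x : U) :
    value (r • s) x = rationalFunction x r * value s x := rfl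

lemma value_res (h : V ≤ U) (s : Γ(lineBundle D, U)) (x : V) :
    value ((lineBundle D).presheaf.map (homOfLE h).op s) x = value s ⟨x.1, h x.2⟩ := rfl

lemma value_sum {ι : Type*} (t : Finset ι) (s : ι → Γ(lineBundle D, U)) (x : U) :
    value (∑ i ∈ t, s i) x = ∑ i ∈ t, value (s i) x := by
  classical
  induction t using Finset.induction_on with
  | empty => simp only [Finset.sum_empty, value_zero]
  | insert a t ha ih => rw [Finset.sum_insert ha, Finset.sum_insert ha, value_add, ih]

end lineBundle

variable {D E : CartierDivisor X}

/-- Multiplication by the rational function `r`, as a map `O_X(D) → O_X(E)`. -/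
noncomputable def lineBundleMul (D E : CartierDivisor X) (r : X.functionField)
    (hr : ∀ (x : X) (s : X.functionField), D.RegularAt x s → E.RegularAt x (s * r)) :
    lineBundle D ⟶ lineBundle E :=
  modulesHomMk
    (fun U => AddMonoidHom.mk' (fun s => lineBundle.mk (fun x => lineBundle.value s x * r)
      (fun x y => by rw [lineBundle.value_eq s x y])
      (fun x => hr x.1 _ (lineBundle.regularAt_value s x)))
      fun s t => lineBundle.value_ext fun x =>
        add_mul (lineBundle.value s x) (lineBundle.value t x) r)
    (fun _ a s => lineBundle.value_ext fun x =>
      mul_assoc (rationalFunction x a) (lineBundle.value s x) r)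
    (fun _ _ _ _ => lineBundle.value_ext fun _ => rfl)

lemma value_lineBundleMul (r : X.functionField)
    (hr : ∀ (x : X) (s : X.functionField), D.RegularAt x s → E.RegularAt x (s * r))
    {U : X.Opens} (s : Γ(lineBundle D, U)) (x : U) :
    lineBundle.value ((lineBundleMul D E r hr).app U s) x = lineBundle.value s x * r := rfl

/-- The inclusion `O_X ⊆ O_X(D)` for an effective divisor `D`. -/
noncomputable def effectiveInclusion (hD : D.IsEffective) : structureModule X ⟶ lineBundle D :=
  modulesHomMk (A := structureModule X)
    (fun U => AddMonoidHom.mk' (fun s : Γ(X, U) => lineBundle.mk (fun x => rationalFunction x s)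
      (fun x y => rationalFunction_eq x y s)
      (fun x => hD.regularAt (rationalFunction_mem x s)))
      fun s t => lineBundle.value_ext fun x => rationalFunction_add x s t)
    (fun _ a s => lineBundle.value_ext fun x => rationalFunction_mul x a s)
    (fun _ _ h s => lineBundle.value_ext fun x => rationalFunction_res h x s)

lemma value_effectiveInclusion (hD : D.IsEffective) {U : X.Opens} (s : Γ(X, U)) (x : U) :
    lineBundle.value ((effectiveInclusion hD).app U s) x = rationalFunction x s := rfl

/-- A line bundle is trivial where the divisor has one equation. -/
lemma coherentOn_lineBundle {U : X.Opens} (hU : IsAffineOpen U) (f : (X.functionField)ˣ)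
    (hf : ∀ x ∈ U, D.IsLocalEquation x f) : CoherentOn (lineBundle D) U := by
  let e : Γ(lineBundle D, U) := lineBundle.mk (fun _ => (f⁻¹ : (X.functionField)ˣ)) (fun _ _ => rfl)
    fun x => (hf x.1 x.2).regularAt_iff.mpr ⟨1, by simp⟩
  refine coherentOn_of_frame (ι := Unit) hU (fun _ => e) (fun V hV s => ?_) fun V hV c hc => ?_
  · refine ⟨fun _ => sectionOfRegular (fun x => lineBundle.value s x * f)
      (fun x y => by rw [lineBundle.value_eq s x y])
      fun x => lineBundle.regularAt_value s x f (hf x.1 (hV x.2)), ?_⟩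
    refine lineBundle.value_ext fun x => ?_
    rw [lineBundle.value_sum, Fintype.sum_unique, lineBundle.value_smul,
      rationalFunction_sectionOfRegular, lineBundle.value_res, lineBundle.value_mk, mul_assoc,
      Units.mul_inv, mul_one]
  · intro i
    refine section_ext_rationalFunction fun x => ?_
    have h := congrArg (fun s => lineBundle.value s x) hc
    simp only [Fintype.sum_unique, lineBundle.value_smul, lineBundle.value_res,
      lineBundle.value_zero] at h
    rw [rationalFunction_zero]
    exact (mul_eq_zero.mp h).resolve_right (f⁻¹).ne_zero

lemma CartierDivisor.exists_affine_isLocalEquation (D : CartierDivisor X) {U : X.Opens} {x : X}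
    (hx : x ∈ U) : ∃ (W : X.Opens) (f : (X.functionField)ˣ), IsAffineOpen W ∧ W ≤ U ∧ x ∈ W ∧
      ∀ y ∈ W, D.IsLocalEquation y f := by
  obtain ⟨V, f, hxV, hf⟩ := D.exists_isLocalEquation x
  obtain ⟨_, ⟨W, hW, rfl⟩, hxW, hWV⟩ := X.isBasis_affineOpens.exists_subset_of_mem_open
    (show x ∈ V ⊓ U from ⟨hxV, hx⟩) (V ⊓ U).2
  exact ⟨W, f, hW, fun y hy => (hWV hy).2, hxW, fun y hy => hf y (hWV hy).1⟩

lemma isCoherent_lineBundle : IsCoherent (lineBundle D) :=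
  isCoherent_of_coherentOn fun x => by
    obtain ⟨W, f, hW, -, hx, hf⟩ := D.exists_affine_isLocalEquation (U := ⊤) (x := x) trivial
    exact ⟨W, hW, hx, coherentOn_lineBundle hW f hf⟩

lemma coherentOn_structureModule {Y : Scheme.{u}} {U : Y.Opens} (hU : IsAffineOpen U) :
    CoherentOn (structureModule Y) U := by
  refine ⟨inferInstanceAs (Module.Finite Γ(Y, U) Γ(Y, U)), fun f => ⟨fun t => ?_, fun s hs => ?_⟩⟩
  · exact exists_pow_mul_eq_res hU f t
  · exact exists_pow_mul_eq_zero hU f s hs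

lemma isCoherent_structureModule (Y : Scheme.{u}) : IsCoherent (structureModule Y) :=
  isCoherent_of_coherentOn fun x => by
    obtain ⟨_, ⟨W, hW, rfl⟩, hx, -⟩ := Y.isBasis_affineOpens.exists_subset_of_mem_open
      (Set.mem_univ x) isOpen_univ
    exact ⟨W, hW, hx, coherentOn_structureModule hW⟩

/-- Denominators of sections of `O_X(D)` over a basic open subset of an affine open set can be
cleared. -/
lemma CartierDivisor.exists_pow_mul_regularAt (D : CartierDivisor X) {U : X.Opens}
    (hU : IsAffineOpen U) (h : Γ(X, U)) (r : X.functionField)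
    (hr : ∀ x ∈ X.basicOpen h, D.RegularAt x r) :
    ∃ n : ℕ, ∀ x : U, D.RegularAt x.1 (rationalFunction x h ^ n * r) := by
  by_cases hη : genericPoint X ∈ X.basicOpen h
  · have loc : ∀ x : U, ∃ (W : X.Opens), x.1 ∈ W ∧ ∃ n : ℕ, ∀ y : U, y.1 ∈ W →
        D.RegularAt y.1 (rationalFunction y h ^ n * r) := by
      intro x
      obtain ⟨W, f, hW, hWU, hx, hf⟩ := D.exists_affine_isLocalEquation x.2
      let hW' : Γ(X, W) := X.presheaf.map (homOfLE hWU).op h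
      have hle : X.basicOpen hW' ≤ X.basicOpen h := by
        rw [Scheme.basicOpen_res]
        exact inf_le_right
      have hηW : genericPoint X ∈ X.basicOpen hW' := by
        rw [Scheme.basicOpen_res]
        exact ⟨genericPoint_mem_of_mem hx, hη⟩
      let t : Γ(X, X.basicOpen hW') := sectionOfRegular (fun _ => r * f) (fun _ _ => rfl)
        fun y => hr y.1 (hle y.2) f (hf y.1 (X.basicOpen_le hW' y.2))
      obtain ⟨n, s, hs⟩ := exists_pow_mul_eq_res hW hW' t
      refine ⟨W, hx, n, fun y hy => (hf y.1 hy).regularAt_iff.mpr ?_⟩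
      have h1 := congrArg (rationalFunction (⟨_, hηW⟩ : X.basicOpen hW')) hs
      rw [rationalFunction_mul, rationalFunction_pow, rationalFunction_res, rationalFunction_res,
        rationalFunction_res, rationalFunction_sectionOfRegular] at h1
      rw [mul_assoc, rationalFunction_eq y (⟨_, genericPoint_mem_of_mem y.2⟩ : U), h1,
        rationalFunction_eq _ (⟨y.1, hy⟩ : W)]
      exact rationalFunction_mem (⟨y.1, hy⟩ : W) s
    choose W hx n hn using loc
    obtain ⟨t, ht⟩ := hU.isCompact.elim_finite_subcover (fun x : U => (W x : Set X))
      (fun x => (W x).2) fun x hxU => Set.mem_iUnion.mpr ⟨⟨x, hxU⟩, hx ⟨x, hxU⟩⟩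
    refine ⟨∑ x ∈ t, n x, fun y => ?_⟩
    obtain ⟨x, hxt, hyx⟩ := Set.mem_iUnion₂.mp (ht y.2)
    have hle : n x ≤ ∑ x ∈ t, n x :=
      Finset.single_le_sum (f := n) (fun _ _ => Nat.zero_le _) hxt
    rw [← Nat.sub_add_cancel hle, pow_add, mul_assoc]
    exact (hn x y hyx).mul (pow_mem (rationalFunction_mem y h) _)
  · refine ⟨1, fun x => ?_⟩
    have h0 : rationalFunction x h = 0 := by
      by_contra h0
      exact hη (mem_basicOpen_of_rationalFunction_ne_zero x h0)
    rw [h0, pow_one, zero_mul]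
    exact D.regularAt_zero _

end LineBundle

/-! ### Sections of the sheaves of homomorphisms and of derivations -/

section Operators

variable {X : Scheme.{u}} {M P : X.Modules}

/-- A section of `Hom(M, P)` from compatible linear maps. -/
noncomputable def internalHomMk {U : X.Opens} (φ : ∀ V : X.Opens, V ≤ U → (Γ(M, V) →+ Γ(P, V)))
    (hlin : ∀ (V : X.Opens) (hV : V ≤ U) (r : Γ(X, V)) (s : Γ(M, V)),
      φ V hV (r • s) = r • φ V hV s)
    (hres : ∀ (V W : X.Opens) (hV : V ≤ U) (h : W ≤ V) (s : Γ(M, V)),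
      φ W (h.trans hV) (M.presheaf.map (homOfLE h).op s) =
        P.presheaf.map (homOfLE h).op (φ V hV s)) : Γ(internalHom M P, U) :=
  (⟨fun V => φ V.1 V.2, fun V r s => hlin V.1 V.2 r s, fun V W h s => hres V.1 W.1 V.2 h s⟩ :
    (internalHomData M P).sec U)

namespace internalHom

variable {U V W : X.Opens}

lemma ext_apply {φ ψ : Γ(internalHom M P, U)}
    (h : ∀ (V : X.Opens) (hV : V ≤ U) (s : Γ(M, V)), apply φ hV s = apply ψ hV s) : φ = ψ :=
  Subtype.ext (funext fun V => AddMonoidHom.ext fun s => h V.1 V.2 s)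

lemma apply_linear (φ : Γ(internalHom M P, U)) (hV : V ≤ U) (r : Γ(X, V)) (s : Γ(M, V)) :
    apply φ hV (r • s) = r • apply φ hV s :=
  (show (internalHomData M P).sec U from φ).2.1 ⟨V, hV⟩ r s

lemma apply_res (φ : Γ(internalHom M P, U)) (hV : V ≤ U) (h : W ≤ V) (s : Γ(M, V)) :
    apply φ (h.trans hV) (M.presheaf.map (homOfLE h).op s) =
      P.presheaf.map (homOfLE h).op (apply φ hV s) :=
  (show (internalHomData M P).sec U from φ).2.2 ⟨V, hV⟩ ⟨W, h.trans hV⟩ h s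

end internalHom

variable {k : CommRingCat.{u}} {p : X ⟶ Spec k}

/-- A section of the tangent sheaf from compatible derivations. -/
noncomputable def tangentSheafMk {U : X.Opens}
    (φ : ∀ V : X.Opens, V ≤ U → (Γ(X, V) →+ Γ(X, V)))
    (hconst : ∀ (V : X.Opens) (hV : V ≤ U) (c : k), φ V hV (constantSection p V c) = 0)
    (hmul : ∀ (V : X.Opens) (hV : V ≤ U) (f g : Γ(X, V)),
      φ V hV (f * g) = f * φ V hV g + g * φ V hV f)
    (hres : ∀ (V W : X.Opens) (hV : V ≤ U) (h : W ≤ V) (s : Γ(X, V)),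
      φ W (h.trans hV) (X.presheaf.map (homOfLE h).op s) =
        X.presheaf.map (homOfLE h).op (φ V hV s)) : Γ(tangentSheaf p, U) :=
  (⟨fun V => φ V.1 V.2, fun V => ⟨hconst V.1 V.2, hmul V.1 V.2⟩,
    fun V W h s => hres V.1 W.1 V.2 h s⟩ : (tangentData p).sec U)

namespace tangentSheaf

variable {U V W : X.Opens}

lemma ext_apply {δ ε : Γ(tangentSheaf p, U)}
    (h : ∀ (V : X.Opens) (hV : V ≤ U) (s : Γ(X, V)), apply δ hV s = apply ε hV s) : δ = ε :=
  Subtype.ext (funext fun V => AddMonoidHom.ext fun s => h V.1 V.2 s)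

lemma apply_add (δ ε : Γ(tangentSheaf p, U)) (hV : V ≤ U) (s : Γ(X, V)) :
    apply (δ + ε) hV s = apply δ hV s + apply ε hV s := rfl

lemma apply_zero (hV : V ≤ U) (s : Γ(X, V)) : apply (0 : Γ(tangentSheaf p, U)) hV s = 0 := rfl

lemma apply_smul (r : Γ(X, U)) (δ : Γ(tangentSheaf p, U)) (hV : V ≤ U) (s : Γ(X, V)) :
    apply (r • δ) hV s = X.presheaf.map (homOfLE hV).op r * apply δ hV s := rfl

lemma apply_const (δ : Γ(tangentSheaf p, U)) (hV : V ≤ U) (c : k) :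
    apply δ hV (constantSection p V c) = 0 :=
  ((show (tangentData p).sec U from δ).2.1 ⟨V, hV⟩).1 c

lemma apply_mul (δ : Γ(tangentSheaf p, U)) (hV : V ≤ U) (f g : Γ(X, V)) :
    apply δ hV (f * g) = f * apply δ hV g + g * apply δ hV f :=
  ((show (tangentData p).sec U from δ).2.1 ⟨V, hV⟩).2 f g

lemma apply_res (δ : Γ(tangentSheaf p, U)) (hV : V ≤ U) (h : W ≤ V) (s : Γ(X, V)) :
    apply δ (h.trans hV) (X.presheaf.map (homOfLE h).op s) =
      X.presheaf.map (homOfLE h).op (apply δ hV s) :=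
  (show (tangentData p).sec U from δ).2.2 ⟨V, hV⟩ ⟨W, h.trans hV⟩ h s

end tangentSheaf

end Operators

/-! ### The normal sheaf of an effective divisor -/

section ClosedSubscheme

variable {X : Scheme.{u}} [IsIntegral X] {D : CartierDivisor X}

lemma CartierDivisor.regularAt_neg_iff_exists {x : X} {r : X.functionField} :
    (-D).RegularAt x r ↔ ∀ f : (X.functionField)ˣ, D.IsLocalEquation x f →
      ∃ a : X.presheaf.stalk x, r = f * algebraMap _ X.functionField a := by
  refine ⟨fun h f hf => ?_, fun h => ?_⟩
  · obtain ⟨a, ha⟩ := h f⁻¹ hf.neg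
    exact ⟨a, by rw [ha, mul_comm r, Units.mul_inv_cancel_left]⟩
  · obtain ⟨U, f, hx, hf⟩ := D.exists_isLocalEquation x
    obtain ⟨a, ha⟩ := h f (hf x hx)
    refine (hf x hx).neg.regularAt_iff.mpr ⟨a, ?_⟩
    rw [ha, mul_comm, Units.inv_mul_cancel_left]

/-- The functions that are multiples of the local equations of `D` form an ideal sheaf, since
denominators can be cleared. -/
lemma CartierDivisor.mem_idealSheaf_iff (U : X.affineOpens) (g : Γ(X, U.1)) :
    g ∈ D.idealSheaf.ideal U ↔ ∀ x : U.1, (-D).RegularAt x.1 (rationalFunction x g) := by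
  let I : ∀ U : X.affineOpens, Ideal Γ(X, U) := fun U =>
    { carrier := {g | ∀ (x : U.1) (f : (X.functionField)ˣ), D.IsLocalEquation x f →
        ∃ a : X.presheaf.stalk x.1, rationalFunction x g = f * algebraMap _ X.functionField a}
      zero_mem' := fun _ f _ => ⟨0, by simp [rationalFunction]⟩
      add_mem' := fun {g h} hg hh x f hf => by
        obtain ⟨a, ha⟩ := hg x f hf
        obtain ⟨b, hb⟩ := hh x f hf
        refine ⟨a + b, ?_⟩
        rw [map_add, mul_add, ← ha, ← hb, rationalFunction, map_add, map_add]
        rfl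
      smul_mem' := fun c g hg x f hf => by
        obtain ⟨a, ha⟩ := hg x f hf
        refine ⟨X.presheaf.germ U.1 x.1 x.2 c * a, ?_⟩
        rw [map_mul, mul_left_comm, ← ha, rationalFunction, smul_eq_mul, map_mul, map_mul]
        rfl }
  have hI : ∀ (U : X.affineOpens) (g : Γ(X, U)), g ∈ I U ↔
      ∀ x : U.1, (-D).RegularAt x.1 (rationalFunction x g) := fun U g =>
    forall_congr' fun x => regularAt_neg_iff_exists.symm
  -- `idealSheaf` is the largest ideal sheaf contained in the family `I`, which is itself one.
  let J : X.IdealSheafData := ⟨I, ?_, _, rfl⟩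
  · have h1 : D.idealSheaf = J := Scheme.IdealSheafData.ofIdeals_ideal J
    rw [h1]
    exact hI U g
  intro U f
  apply le_antisymm
  · refine Ideal.map_le_iff_le_comap.mpr fun g hg => ?_
    refine (hI (X.affineBasicOpen f) _).mpr fun x => ?_
    have h2 := (hI U g).mp hg ⟨x.1, X.basicOpen_le f x.2⟩
    rwa [← rationalFunction_res (X.basicOpen_le f) x g] at h2
  · intro g hg
    have hg' : ∀ x : X.basicOpen f, (-D).RegularAt x.1 (rationalFunction x g) :=
      (hI (X.affineBasicOpen f) g).mp hg
    have hloc := U.2.isLocalization_basicOpen f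
    obtain ⟨h, ⟨_, n, rfl⟩, hh⟩ := IsLocalization.exists_mk'_eq (.powers f) g
    have hgh : g * X.presheaf.map (homOfLE (X.basicOpen_le f)).op (f ^ n) =
        X.presheaf.map (homOfLE (X.basicOpen_le f)).op h := by
      rw [← hh]
      exact IsLocalization.mk'_spec Γ(X, X.basicOpen f) h (⟨f ^ n, n, rfl⟩ : Submonoid.powers f)
    rw [← hh]
    refine (IsLocalization.mk'_mem_map_algebraMap_iff (.powers f) Γ(X, X.basicOpen f) _ _ _).mpr ?_
    by_cases hU : Nonempty U.1
    · obtain ⟨y⟩ := hU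
      have hr : ∀ x ∈ X.basicOpen f, (-D).RegularAt x (rationalFunction y h) := by
        intro x hx
        have h3 := congrArg (rationalFunction (⟨x, hx⟩ : X.basicOpen f)) hgh
        rw [rationalFunction_mul, rationalFunction_res, rationalFunction_res] at h3
        rw [rationalFunction_eq y (⟨x, X.basicOpen_le f hx⟩ : U.1), ← h3, mul_comm]
        exact (hg' ⟨x, hx⟩).mul
          (rationalFunction_mem (⟨x, X.basicOpen_le f hx⟩ : U.1) (f ^ n))
      obtain ⟨m, hm⟩ := (-D).exists_pow_mul_regularAt U.2 f _ hr
      refine ⟨f ^ m, ⟨m, rfl⟩, (hI U _).mpr fun x => ?_⟩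
      rw [rationalFunction_mul, rationalFunction_pow, rationalFunction_eq x y h]
      exact hm x
    · refine ⟨1, one_mem _, (hI U _).mpr fun x => (hU ⟨x⟩).elim⟩

lemma restrictToDivisor_add {U : X.Opens} (f g : Γ(X, U)) :
    restrictToDivisor D (f + g) = restrictToDivisor D f + restrictToDivisor D g :=
  map_add (D.ι.app U).hom f g

lemma restrictToDivisor_smul {U : X.Opens} (f g : Γ(X, U)) :
    restrictToDivisor D (f * g) = f • restrictToDivisor D g :=
  map_mul (D.ι.app U).hom f g

lemma restrictToDivisor_res {U V : X.Opens} (h : V ≤ U) (f : Γ(X, U)) :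
    restrictToDivisor D (X.presheaf.map (homOfLE h).op f) =
      (divisorStructureSheaf D).presheaf.map (homOfLE h).op (restrictToDivisor D f) :=
  ConcreteCategory.congr_hom (D.ι.naturality (homOfLE h).op) f

lemma restrictToDivisor_surjective {U : X.Opens} (hU : IsAffineOpen U) :
    Function.Surjective (restrictToDivisor D : Γ(X, U) → Γ(divisorStructureSheaf D, U)) :=
  D.idealSheaf.subschemeι_app_surjective ⟨U, hU⟩

/-- The kernel of `O_X → O_D` is `O_X(-D)`. -/
lemma restrictToDivisor_eq_zero_iff {U : X.Opens} (g : Γ(X, U)) :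
    restrictToDivisor D g = 0 ↔ ∀ x : U, (-D).RegularAt x.1 (rationalFunction x g) := by
  have haff : ∀ {V : X.Opens} (_ : IsAffineOpen V) (g : Γ(X, V)), restrictToDivisor D g = 0 ↔
      ∀ x : V, (-D).RegularAt x.1 (rationalFunction x g) := fun {V} hV g => by
    rw [← CartierDivisor.mem_idealSheaf_iff ⟨V, hV⟩ g, ← D.idealSheaf.ker_subschemeι_app]
    exact Iff.rfl
  refine ⟨fun h x => ?_, fun h => ?_⟩
  · obtain ⟨V, -, hV, hVU, hx, -⟩ := D.exists_affine_isLocalEquation x.2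
    have h1 := (haff hV (X.presheaf.map (homOfLE hVU).op g)).mp
      (by rw [restrictToDivisor_res, h, map_zero]) ⟨x.1, hx⟩
    rwa [rationalFunction_res] at h1
  · refine modules_eq_of_locally_eq _ _ fun x hx => ?_
    obtain ⟨V, -, hV, hVU, hxV, -⟩ := D.exists_affine_isLocalEquation hx
    refine ⟨V, hVU, hxV, ?_⟩
    rw [map_zero, ← restrictToDivisor_res]
    refine (haff hV _).mpr fun y => ?_
    rw [rationalFunction_res]
    exact h ⟨y.1, hVU y.2⟩

lemma restrictToDivisor_eq_iff {U : X.Opens} (f g : Γ(X, U)) :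
    restrictToDivisor D f = restrictToDivisor D g ↔
      ∀ x : U, (-D).RegularAt x.1 (rationalFunction x f - rationalFunction x g) := by
  have h1 : restrictToDivisor D f = restrictToDivisor D (f - g) + restrictToDivisor D g := by
    rw [← restrictToDivisor_add, sub_add_cancel]
  rw [h1, add_eq_right, restrictToDivisor_eq_zero_iff]
  refine forall_congr' fun x => ?_
  have h2 : rationalFunction x (f - g) = rationalFunction x f - rationalFunction x g := by
    simp [rationalFunction]
  rw [h2]

/-- The product of sections of `O_X(D)` and `O_X(-D)`. -/
noncomputable def lineBundlePairing {U V : X.Opens} (hV : V ≤ U) (t : Γ(lineBundle D, U))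
    (s : Γ(lineBundle (-D), V)) : Γ(X, V) :=
  sectionOfRegular (fun x => lineBundle.value t ⟨x.1, hV x.2⟩ * lineBundle.value s x)
    (fun x y => by
      rw [lineBundle.value_eq s x y, lineBundle.value_eq t ⟨x.1, hV x.2⟩ ⟨y.1, hV y.2⟩])
    fun x => (lineBundle.regularAt_value t ⟨x.1, hV x.2⟩).mul_neg (lineBundle.regularAt_value s x)

lemma rationalFunction_lineBundlePairing {U V : X.Opens} (hV : V ≤ U) (t : Γ(lineBundle D, U))
    (s : Γ(lineBundle (-D), V)) (x : V) : rationalFunction x (lineBundlePairing hV t s) =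
      lineBundle.value t ⟨x.1, hV x.2⟩ * lineBundle.value s x :=
  rationalFunction_sectionOfRegular _ _ _ x

variable (D) in
/-- The map `O_X(D) → N_{D/X}`, `t ↦ (s ↦ t s|_D)`. -/
noncomputable def normalRestriction : lineBundle D ⟶ normalSheaf D :=
  modulesHomMk
    (fun U => AddMonoidHom.mk'
      (fun t => internalHomMk
        (fun V hV => AddMonoidHom.mk' (fun s => restrictToDivisor D (lineBundlePairing hV t s))
          fun s s' => by
            rw [← restrictToDivisor_add]
            refine congrArg _ (section_ext_rationalFunction fun x => ?_)
            simp only [rationalFunction_add, rationalFunction_lineBundlePairing,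
              lineBundle.value_add, mul_add])
        (fun V hV r s => by
          refine Eq.trans (congrArg (restrictToDivisor D) ?_) (restrictToDivisor_smul _ _)
          refine section_ext_rationalFunction fun x => ?_
          simp only [rationalFunction_mul, rationalFunction_lineBundlePairing,
            lineBundle.value_smul]
          ring)
        (fun V W hV h s => by
          refine Eq.trans (congrArg (restrictToDivisor D) ?_) (restrictToDivisor_res _ _)
          refine section_ext_rationalFunction fun x => ?_
          simp only [rationalFunction_res, rationalFunction_lineBundlePairing,
            lineBundle.value_res]))
      fun t t' => internalHom.ext_apply fun V hV s => by
        refine Eq.trans (congrArg (restrictToDivisor D) ?_) (restrictToDivisor_add _ _)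
        refine section_ext_rationalFunction fun x => ?_
        simp only [rationalFunction_add, rationalFunction_lineBundlePairing,
          lineBundle.value_add, add_mul])
    (fun U r t => internalHom.ext_apply fun V hV s => by
      refine Eq.trans (congrArg (restrictToDivisor D) ?_) (restrictToDivisor_smul _ _)
      refine section_ext_rationalFunction fun x => ?_
      simp only [rationalFunction_mul, rationalFunction_lineBundlePairing,
        lineBundle.value_smul, rationalFunction_res]
      ring)
    (fun U V h t => internalHom.ext_apply fun W hW s => rfl)

lemma apply_normalRestriction {U V : X.Opens} (hV : V ≤ U) (t : Γ(lineBundle D, U))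
    (s : Γ(lineBundle (-D), V)) :
    internalHom.apply ((normalRestriction D).app U t) hV s =
      restrictToDivisor D (lineBundlePairing hV t s) := rfl

lemma isNormalRestriction_normalRestriction : IsNormalRestriction D (normalRestriction D) :=
  fun U V hV t s f hf => by
    rw [apply_normalRestriction]
    exact congrArg _ (section_ext_rationalFunction fun x => by
      rw [rationalFunction_lineBundlePairing, hf])

/-- An equation of `D` on `U`, as a section of `O_X(-D)`. -/
noncomputable def equationSection {U : X.Opens} (f : (X.functionField)ˣ)
    (hf : ∀ x ∈ U, D.IsLocalEquation x f) : Γ(lineBundle (-D), U) :=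
  lineBundle.mk (fun _ => f) (fun _ _ => rfl)
    fun x => (hf x.1 x.2).neg.regularAt_iff.mpr ⟨1, by simp⟩

/-- If `D` has one equation `f` on the affine open set `U`, then `O_X(D)(U) → N_{D/X}(U)` is
surjective: a homomorphism `O_X(-D) → O_D` over `U` is determined by the image of `f`, which lifts to a
function on `U`. -/
lemma normalRestriction_surjective {U : X.Opens} (hU : IsAffineOpen U) (f : (X.functionField)ˣ)
    (hf : ∀ x ∈ U, D.IsLocalEquation x f) :
    Function.Surjective ((normalRestriction D).app U) := by
  intro φ
  obtain ⟨g, hg⟩ := restrictToDivisor_surjective hU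
    (internalHom.apply φ le_rfl (equationSection f hf))
  -- `φ` sends the equation `f` to the class of `g`, so it is the multiplication by `g / f`.
  let t : Γ(lineBundle D, U) :=
    lineBundle.mk (fun x => rationalFunction x g * (f⁻¹ : (X.functionField)ˣ))
      (fun x y => by rw [rationalFunction_eq x y])
      fun x => (hf x.1 x.2).regularAt_iff.mpr ⟨X.presheaf.germ U x.1 x.2 g, by
        rw [mul_assoc, Units.inv_mul, mul_one]; rfl⟩
  refine ⟨t, internalHom.ext_apply fun V hV s => ?_⟩
  let a : Γ(X, V) := sectionOfRegular
    (fun x => lineBundle.value s x * (f⁻¹ : (X.functionField)ˣ))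
    (fun x y => by rw [lineBundle.value_eq s x y])
    fun x => (hf x.1 (hV x.2)).neg.regularAt_iff.mp (lineBundle.regularAt_value s x)
  have hs : s = a • (lineBundle (-D)).presheaf.map (homOfLE hV).op (equationSection f hf) := by
    refine lineBundle.value_ext fun x => ?_
    rw [lineBundle.value_smul, rationalFunction_sectionOfRegular]
    exact (Units.inv_mul_cancel_right _ _).symm
  have h1 : internalHom.apply φ hV s =
      restrictToDivisor D (a * X.presheaf.map (homOfLE hV).op g) := by
    rw [hs]
    refine (internalHom.apply_linear φ hV _ _).trans ?_
    rw [restrictToDivisor_smul, restrictToDivisor_res, hg]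
    exact congrArg (a • ·) (internalHom.apply_res φ le_rfl hV (equationSection f hf))
  rw [h1, apply_normalRestriction]
  refine congrArg _ (section_ext_rationalFunction fun x => ?_)
  rw [rationalFunction_lineBundlePairing, rationalFunction_mul, rationalFunction_res,
    rationalFunction_sectionOfRegular, lineBundle.value_mk]
  ring

lemma normalRestriction_effectiveInclusion (hD : D.IsEffective) {U : X.Opens} (s : Γ(X, U)) :
    (normalRestriction D).app U ((effectiveInclusion hD).app U s) = 0 := by
  refine internalHom.ext_apply fun V hV t => ?_
  rw [apply_normalRestriction]
  refine (restrictToDivisor_eq_zero_iff _).mpr fun x => ?_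
  rw [rationalFunction_lineBundlePairing, value_effectiveInclusion]
  exact (lineBundle.regularAt_value t x).mul (rationalFunction_mem (⟨x.1, hV x.2⟩ : U) s)

lemma exists_of_normalRestriction_eq_zero (hD : D.IsEffective) {U : X.Opens}
    (t : Γ(lineBundle D, U)) (ht : (normalRestriction D).app U t = 0) :
    ∃ s : Γ(X, U), (effectiveInclusion hD).app U s = t := by
  refine ⟨sectionOfRegular (lineBundle.value t) (lineBundle.value_eq t) fun x => ?_,
    lineBundle.value_ext fun x => rationalFunction_sectionOfRegular _ _ _ x⟩
  obtain ⟨V, f, hV, hVU, hx, hf⟩ := D.exists_affine_isLocalEquation x.2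
  have h1 := congrArg (fun φ => internalHom.apply φ hVU (equationSection f hf)) ht
  have h2 := (restrictToDivisor_eq_zero_iff _).mp h1 ⟨x.1, hx⟩
  rw [rationalFunction_lineBundlePairing] at h2
  have h3 := (hf x.1 hx).neg.regularAt_iff.mp h2
  rwa [show lineBundle.value (equationSection f hf) ⟨x.1, hx⟩ = f from rfl, mul_assoc,
    Units.mul_inv, mul_one] at h3

/-- The sequence `0 → O_X → O_X(D) → N_{D/X} → 0`. -/
theorem shortExact_normal (hD : D.IsEffective) :
    ∃ w : effectiveInclusion hD ≫ normalRestriction D = 0,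
      (ShortComplex.mk (effectiveInclusion hD) (normalRestriction D) w).ShortExact := by
  refine shortExact_of_sections _ _ (fun U s hs => ?_)
    (fun U s => normalRestriction_effectiveInclusion hD s)
    (fun U t ht => exists_of_normalRestriction_eq_zero hD t ht) fun U φ x hx => ?_
  · refine section_ext_rationalFunction (X := X) fun x => ?_
    refine Eq.trans ?_ (rationalFunction_zero x).symm
    exact congrArg (fun t => lineBundle.value t x) hs
  · obtain ⟨V, f, hV, hVU, hxV, hf⟩ := D.exists_affine_isLocalEquation hx
    obtain ⟨s, hs⟩ := normalRestriction_surjective hV f hf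
      ((normalSheaf D).presheaf.map (homOfLE hVU).op φ)
    exact ⟨V, hVU, hxV, s, hs⟩

lemma isCoherent_normalSheaf (hD : D.IsEffective) : IsCoherent (normalSheaf D) :=
  isCoherent_of_coherentOn fun x => by
    obtain ⟨W, f, hW, -, hx, hf⟩ := D.exists_affine_isLocalEquation (U := ⊤) (x := x) trivial
    exact ⟨W, hW, hx, coherentOn_of_quotient hW (effectiveInclusion hD) (normalRestriction D)
      (coherentOn_structureModule hW) (coherentOn_lineBundle hW f hf)
      (fun V hVW hV => normalRestriction_surjective hV f fun y hy => hf y (hVW hy))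
      (fun V s hs => exists_of_normalRestriction_eq_zero hD s hs)
      (fun V s => normalRestriction_effectiveInclusion hD s)⟩

/-- A section of the ideal sheaf `O_X(-D)` as a function. -/
noncomputable def idealSection (hD : D.IsEffective) {V : X.Opens} (s : Γ(lineBundle (-D), V)) :
    Γ(X, V) :=
  sectionOfRegular (lineBundle.value s) (lineBundle.value_eq s) fun x =>
    hD.mem_of_regularAt_neg (lineBundle.regularAt_value s x)

lemma rationalFunction_idealSection (hD : D.IsEffective) {V : X.Opens}
    (s : Γ(lineBundle (-D), V)) (x : V) :
    rationalFunction x (idealSection hD s) = lineBundle.value s x :=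
  rationalFunction_sectionOfRegular _ _ _ x

variable {k : CommRingCat.{u}}

/-- The map `T_X → N_{D/X}`, `δ ↦ (s ↦ δ(s)|_D)`. It is linear since `s δ(r)` vanishes on `D`. -/
noncomputable def normalDerivative (p : X ⟶ Spec k) (hD : D.IsEffective) :
    tangentSheaf p ⟶ normalSheaf D :=
  modulesHomMk
    (fun U => AddMonoidHom.mk'
      (fun δ => internalHomMk
        (fun V hV => AddMonoidHom.mk'
          (fun s => restrictToDivisor D (tangentSheaf.apply δ hV (idealSection hD s)))
          fun s s' => by
            rw [← restrictToDivisor_add, ← map_add]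
            refine congrArg _ (congrArg _ (section_ext_rationalFunction fun x => ?_))
            simp only [rationalFunction_add, rationalFunction_idealSection, lineBundle.value_add])
        (fun V hV r s => by
          have h1 : idealSection hD (r • s) = r * idealSection hD s :=
            section_ext_rationalFunction fun x => by
              rw [rationalFunction_mul, rationalFunction_idealSection,
                rationalFunction_idealSection, lineBundle.value_smul]
          refine Eq.trans ?_ (restrictToDivisor_smul _ _)
          change restrictToDivisor D _ = _
          rw [h1, tangentSheaf.apply_mul, restrictToDivisor_add, add_eq_left,
            restrictToDivisor_eq_zero_iff]
          intro x
          rw [mul_comm, rationalFunction_mul, rationalFunction_idealSection]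
          exact (lineBundle.regularAt_value s x).mul (rationalFunction_mem _ _))
        (fun V W hV h s => by
          refine Eq.trans (congrArg (restrictToDivisor D) ?_) (restrictToDivisor_res _ _)
          rw [← tangentSheaf.apply_res]
          refine congrArg _ (section_ext_rationalFunction fun x => ?_)
          rw [rationalFunction_res, rationalFunction_idealSection, rationalFunction_idealSection,
            lineBundle.value_res]))
      fun δ ε => internalHom.ext_apply fun V hV s => restrictToDivisor_add _ _)
    (fun U r δ => internalHom.ext_apply fun V hV s => restrictToDivisor_smul _ _)
    (fun U V h δ => internalHom.ext_apply fun W hW s => rfl)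

lemma apply_normalDerivative (p : X ⟶ Spec k) (hD : D.IsEffective) {U V : X.Opens} (hV : V ≤ U)
    (δ : Γ(tangentSheaf p, U)) (s : Γ(lineBundle (-D), V)) :
    internalHom.apply ((normalDerivative p hD).app U δ) hV s =
      restrictToDivisor D (tangentSheaf.apply δ hV (idealSection hD s)) := rfl

lemma isNormalDerivative_normalDerivative (p : X ⟶ Spec k) (hD : D.IsEffective) :
    IsNormalDerivative p D (normalDerivative p hD) :=
  fun U V hV δ s f hf => by
    rw [apply_normalDerivative]
    refine congrArg _ (congrArg _ (section_ext_rationalFunction fun x => ?_))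
    rw [rationalFunction_idealSection, hf]

end ClosedSubscheme

/-! ### The sheaves `A ⊗ O_X` -/

section ConstantTensor

variable {X : Scheme.{u}} {A : Type u} [AddCommGroup A]

namespace constantTensor

/-- The value of a section of `A ⊗ O_X` in `O_{X,x} ⊗ A`. -/
noncomputable def germ {U : X.Opens} (s : Γ(constantTensor A X, U)) (x : U) :
    TensorProduct ℤ (X.presheaf.stalk x.1) A :=
  (show (constantTensorData A X).sec U from s).1 x

variable {U V : X.Opens}

lemma germ_ext {s t : Γ(constantTensor A X, U)} (h : ∀ x, germ s x = germ t x) : s = t :=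
  Subtype.ext (funext h)

lemma germ_add (s t : Γ(constantTensor A X, U)) (x : U) :
    germ (s + t) x = germ s x + germ t x := rfl

lemma germ_zero (x : U) : germ (0 : Γ(constantTensor A X, U)) x = 0 := rfl

lemma germ_sum {ι : Type*} (t : Finset ι) (s : ι → Γ(constantTensor A X, U)) (x : U) :
    germ (∑ i ∈ t, s i) x = ∑ i ∈ t, germ (s i) x := by
  classical
  induction t using Finset.induction_on with
  | empty => simp only [Finset.sum_empty, germ_zero]
  | insert a t ha ih => rw [Finset.sum_insert ha, Finset.sum_insert ha, germ_add, ih]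

lemma germ_tmul (g : Γ(X, U)) (a : A) (x : U) :
    germ (tmul g a) x = X.presheaf.germ U x.1 x.2 g ⊗ₜ[ℤ] a := rfl

lemma smul_tmul (r g : Γ(X, U)) (a : A) : r • tmul g a = tmul (r * g) a := by
  refine germ_ext fun x => ?_
  rw [germ_tmul, map_mul]
  rfl

lemma tmul_zero_left (a : A) : tmul (0 : Γ(X, U)) a = 0 := germ_ext fun x => by
  rw [germ_tmul, map_zero, TensorProduct.zero_tmul, germ_zero]

lemma res_tmul (h : V ≤ U) (g : Γ(X, U)) (a : A) :
    (constantTensor A X).presheaf.map (homOfLE h).op (tmul g a) =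
      tmul (X.presheaf.map (homOfLE h).op g) a := by
  refine germ_ext fun x => ?_
  rw [germ_tmul, TopCat.Presheaf.germ_res_apply]
  rfl

lemma exists_germ (s : Γ(constantTensor A X, U)) (x : U) : ∃ (V : X.Opens) (hV : V ≤ U),
    x.1 ∈ V ∧ ∃ t : TensorProduct ℤ Γ(X, V) A,
      ∀ y : V, germ s ⟨y.1, hV y.2⟩ = germTensor A V y t :=
  (show (constantTensorData A X).sec U from s).2 x

/-- `O_{X,x} ⊗ A → O_{X,x}` for a homomorphism `A → ℤ`. -/
noncomputable def evalAux (R : Type u) [CommRing R] (ψ : A →+ ℤ) :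
    TensorProduct ℤ R A →ₗ[ℤ] R :=
  (TensorProduct.rid ℤ R).toLinearMap.comp (ψ.toIntLinearMap.lTensor R)

lemma evalAux_tmul (R : Type u) [CommRing R] (ψ : A →+ ℤ) (r : R) (a : A) :
    evalAux R ψ (r ⊗ₜ[ℤ] a) = ψ a • r :=
  TensorProduct.rid_tmul (R := ℤ) r (ψ a)

lemma evalAux_smul (R : Type u) [CommRing R] (ψ : A →+ ℤ) (r : R) (t : TensorProduct ℤ R A) :
    evalAux R ψ (r • t) = r * evalAux R ψ t := by
  induction t with
  | zero => simp
  | add a b ha hb => rw [smul_add, map_add, ha, hb, map_add, mul_add]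
  | tmul f a =>
    rw [TensorProduct.smul_tmul', evalAux_tmul, evalAux_tmul, smul_eq_mul, mul_smul_comm]

lemma evalAux_germTensor (ψ : A →+ ℤ) (t : TensorProduct ℤ Γ(X, U) A) (x : U) :
    evalAux (X.presheaf.stalk x.1) ψ (germTensor A U x t) =
      X.presheaf.germ U x.1 x.2 (evalAux Γ(X, U) ψ t) := by
  induction t with
  | zero => simp
  | add a b ha hb => simp only [map_add, ha, hb]
  | tmul f a =>
    rw [evalAux_tmul, map_zsmul]
    exact evalAux_tmul _ ψ _ a

variable [IsIntegral X]

/-- The value of `s ∈ A ⊗ O_X` under `A → ℤ`, as a rational function. -/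
noncomputable def evalValue (ψ : A →+ ℤ) (s : Γ(constantTensor A X, U)) (x : U) :
    X.functionField :=
  algebraMap (X.presheaf.stalk x.1) X.functionField (evalAux _ ψ (germ s x))

lemma evalValue_eq (ψ : A →+ ℤ) (s : Γ(constantTensor A X, U)) (x y : U) :
    evalValue ψ s x = evalValue ψ s y := by
  have key : ∀ x : U, ∃ V : X.Opens, x.1 ∈ V ∧ ∃ r, ∀ y : U, y.1 ∈ V → evalValue ψ s y = r := by
    intro x
    obtain ⟨V, hV, hx, t, ht⟩ := exists_germ s x
    refine ⟨V, hx, rationalFunction ⟨x.1, hx⟩ (evalAux Γ(X, V) ψ t), fun y hy => ?_⟩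
    rw [evalValue, ht ⟨y.1, hy⟩]
    exact (congrArg _ (evalAux_germTensor ψ t ⟨y.1, hy⟩)).trans
      (rationalFunction_eq ⟨y.1, hy⟩ ⟨x.1, hx⟩ _)
  let η : U := ⟨genericPoint X, genericPoint_mem_of_mem x.2⟩
  have hη : ∀ x : U, evalValue ψ s x = evalValue ψ s η := fun x => by
    obtain ⟨V, hx, r, hr⟩ := key x
    rw [hr x hx, hr η (genericPoint_mem_of_mem hx)]
  rw [hη x, hη y]

/-- The function on `U` with values `evalValue ψ s`. -/
noncomputable def evalSection (ψ : A →+ ℤ) (s : Γ(constantTensor A X, U)) : Γ(X, U) :=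
  sectionOfRegular (evalValue ψ s) (evalValue_eq ψ s) fun x => ⟨evalAux _ ψ (germ s x), rfl⟩

lemma rationalFunction_evalSection (ψ : A →+ ℤ) (s : Γ(constantTensor A X, U)) (x : U) :
    rationalFunction x (evalSection ψ s) = evalValue ψ s x :=
  rationalFunction_sectionOfRegular _ _ _ x

lemma evalSection_add (ψ : A →+ ℤ) (s t : Γ(constantTensor A X, U)) :
    evalSection ψ (s + t) = evalSection ψ s + evalSection ψ t := by
  refine section_ext_rationalFunction fun x => ?_
  simp only [rationalFunction_add, rationalFunction_evalSection, evalValue, germ_add, map_add]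

lemma evalSection_smul (ψ : A →+ ℤ) (r : Γ(X, U)) (s : Γ(constantTensor A X, U)) :
    evalSection ψ (r • s) = r * evalSection ψ s := by
  refine section_ext_rationalFunction fun x => ?_
  rw [rationalFunction_mul, rationalFunction_evalSection, rationalFunction_evalSection]
  exact (congrArg _ (evalAux_smul _ ψ _ (germ s x))).trans (map_mul _ _ _)

lemma evalSection_res (ψ : A →+ ℤ) (h : V ≤ U) (s : Γ(constantTensor A X, U)) :
    evalSection ψ ((constantTensor A X).presheaf.map (homOfLE h).op s) =
      X.presheaf.map (homOfLE h).op (evalSection ψ s) := by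
  refine section_ext_rationalFunction fun x => ?_
  rw [rationalFunction_res, rationalFunction_evalSection, rationalFunction_evalSection]
  rfl

lemma evalSection_tmul (ψ : A →+ ℤ) (g : Γ(X, U)) (a : A) :
    evalSection ψ (tmul g a) = ψ a • g := by
  refine section_ext_rationalFunction fun x => ?_
  rw [rationalFunction_evalSection, evalValue, germ_tmul, evalAux_tmul, map_zsmul,
    rationalFunction_zsmul]
  rfl

/-- The map `A ⊗ O_X → O_X` given by a homomorphism `A → ℤ`. -/
noncomputable def eval (ψ : A →+ ℤ) : constantTensor A X ⟶ structureModule X :=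
  modulesHomMk (B := structureModule X)
    (fun _ => AddMonoidHom.mk' (evalSection ψ) (evalSection_add ψ))
    (fun _ => evalSection_smul ψ) (fun _ _ h => evalSection_res ψ h)

end constantTensor

end ConstantTensor

namespace SmoothFan

/-! ### Derivations of the function field of a toric variety -/

section FunctionField

variable {N : Type u} [AddCommGroup N] (Δ : SmoothFan N) (k : Type u) [Field k]

/-- The inclusion `k[σ^∨ ∩ M] ⊆ k[M]`. -/
noncomputable def chartInclusion (σ : Set N) :
    ChartRing k σ →+* AddMonoidAlgebra k (Module.Dual ℤ N) :=
  AddMonoidAlgebra.mapDomainRingHom k (dualMonoid σ).subtype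

lemma chartInclusion_single (σ : Set N) (m : dualMonoid σ) (c : k) :
    chartInclusion k σ (.single m c) = .single m.1 c :=
  AddMonoidAlgebra.mapDomain_single

variable {Δ k} in
lemma isAffineOpen_chartOpen (σ : Δ.cones) : IsAffineOpen (Δ.chartOpen k σ) :=
  have h : IsAffineOpen (⊤ : ((Δ.chart k).obj σ).Opens) :=
    isAffineOpen_top (Spec (.of (ChartRing k σ.1)))
  h.image_of_isOpenImmersion (Δ.chartι k σ)

variable [Module.Free ℤ N]

lemma germToFunctionField_chartSection (σ : Δ.cones) (a : ChartRing k σ.1) :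
    (Δ.toricVariety k).germToFunctionField (Δ.chartOpen k σ) (Δ.chartSection k σ a) =
      Δ.charToFunctionField k (chartInclusion k σ.1 a) := by
  have h : Δ.zeroCone ≤ σ := Set.empty_subset σ.1
  have h1 := congrArg ((Δ.toricVariety k).germToFunctionField (Δ.chartOpen k Δ.zeroCone))
    (Δ.chartSection_res k h a)
  refine Eq.trans ?_ (h1.trans ?_)
  · exact (TopCat.Presheaf.germ_res_apply _ _ _ _ _).symm
  · change _ = (Δ.toricVariety k).germToFunctionField (Δ.chartOpen k Δ.zeroCone)
      (Δ.chartSection k Δ.zeroCone (AddMonoidAlgebra.mapDomain _ (AddMonoidAlgebra.mapDomain _ a)))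
    refine congrArg _ (congrArg _ ?_)
    clear h1
    induction a using AddMonoidAlgebra.induction_linear with
    | zero => simp
    | add x y hx hy => rw [map_add, hx, hy, AddMonoidAlgebra.mapDomain_add,
        AddMonoidAlgebra.mapDomain_add]
    | single m c =>
      rw [chartMap_single, AddMonoidAlgebra.mapDomain_single, AddMonoidAlgebra.mapDomain_single]
      rfl

lemma rationalFunction_chartSection {σ : Δ.cones} (a : ChartRing k σ.1) (x : Δ.chartOpen k σ) :
    rationalFunction x (Δ.chartSection k σ a) =
      Δ.charToFunctionField k (chartInclusion k σ.1 a) := by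
  rw [← germToFunctionField_chartSection]
  exact Scheme.algebraMap_germ_eq_germToFunctionField _ _ _

lemma charToFunctionField_injective : Function.Injective (Δ.charToFunctionField k) :=
  ((Δ.toricVariety k).germToFunctionField_injective (Δ.chartOpen k Δ.zeroCone)).comp
    ((Δ.chartSection_bijective k Δ.zeroCone).1.comp
      (AddMonoidAlgebra.mapDomain_injective fun _ _ h => congrArg Subtype.val h))

lemma exists_eq_div (z : (Δ.toricVariety k).functionField) :
    ∃ a b, Δ.charToFunctionField k b ≠ 0 ∧
      z = Δ.charToFunctionField k a / Δ.charToFunctionField k b := by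
  have := Δ.isFractionRing_torus k
  have key : ∀ f : Γ(Δ.toricVariety k, Δ.chartOpen k Δ.zeroCone), ∃ a,
      algebraMap _ (Δ.toricVariety k).functionField f = Δ.charToFunctionField k a := fun f => by
    obtain ⟨a, rfl⟩ := (Δ.chartSection_bijective k Δ.zeroCone).2 f
    exact ⟨_, Δ.germToFunctionField_chartSection k _ a⟩
  obtain ⟨f, g, hg, rfl⟩ := IsFractionRing.div_surjective
    (A := Γ(Δ.toricVariety k, Δ.chartOpen k Δ.zeroCone)) z
  obtain ⟨a, ha⟩ := key f
  obtain ⟨b, hb⟩ := key g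
  exact ⟨a, b, hb ▸ IsFractionRing.to_map_ne_zero_of_mem_nonZeroDivisors hg, by rw [ha, hb]⟩

/-- The constants in the function field. -/
noncomputable def constFunction : k →+* (Δ.toricVariety k).functionField :=
  (Δ.charToFunctionField k).comp AddMonoidAlgebra.singleZeroRingHom

lemma charToFunctionField_single (m : Module.Dual ℤ N) (c : k) :
    Δ.charToFunctionField k (.single m c) = Δ.constFunction k c * Δ.charUnit k m := by
  change _ = Δ.charToFunctionField k (.single 0 c) * Δ.charToFunctionField k (.single m 1)
  rw [← map_mul, AddMonoidAlgebra.single_mul_single, zero_add, mul_one]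

lemma charUnit_zero : Δ.charUnit k 0 = 1 :=
  Units.ext (map_one (Δ.charToFunctionField k))

lemma charUnit_neg (m : Module.Dual ℤ N) : Δ.charUnit k (-m) = (Δ.charUnit k m)⁻¹ := by
  rw [eq_inv_iff_mul_eq_one, ← charUnit_add, neg_add_cancel, charUnit_zero]

lemma charUnit_sub (m m' : Module.Dual ℤ N) :
    Δ.charUnit k (m - m') = Δ.charUnit k m * (Δ.charUnit k m')⁻¹ := by
  rw [sub_eq_add_neg, charUnit_add, charUnit_neg]

variable {k}

/-- Ring homomorphisms on the function field are determined on constants and characters. -/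
lemma functionField_hom_ext {R : Type*} [CommRing R] {f g : (Δ.toricVariety k).functionField →+* R}
    (h0 : ∀ c, f (Δ.constFunction k c) = g (Δ.constFunction k c))
    (h1 : ∀ m, f (Δ.charUnit k m) = g (Δ.charUnit k m)) : f = g := by
  have key : ∀ a, f (Δ.charToFunctionField k a) = g (Δ.charToFunctionField k a) := fun a => by
    induction a using AddMonoidAlgebra.induction_linear with
    | zero => simp
    | add x y hx hy => simp only [map_add, hx, hy]
    | single m c => rw [charToFunctionField_single, map_mul, map_mul, h0, h1]
  refine RingHom.ext fun z => ?_
  obtain ⟨a, b, hb, rfl⟩ := Δ.exists_eq_div k z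
  have hu : IsUnit (f (Δ.charToFunctionField k b)) := (isUnit_iff_ne_zero.mpr hb).map f
  refine hu.mul_right_cancel ?_
  rw [← map_mul, div_mul_cancel₀ _ hb, key, key, ← map_mul, div_mul_cancel₀ _ hb]

variable (k)

/-- Homomorphisms to a ring that extend from `k[M]` to the function field. -/
lemma exists_functionField_lift {R : Type*} [CommRing R]
    (f : AddMonoidAlgebra k (Module.Dual ℤ N) →+* R) (hf : ∀ a, a ≠ 0 → IsUnit (f a)) :
    ∃ g : (Δ.toricVariety k).functionField →+* R, ∀ a, g (Δ.charToFunctionField k a) = f a := by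
  let _ := (Δ.charToFunctionField k).toAlgebra
  have : FaithfulSMul (AddMonoidAlgebra k (Module.Dual ℤ N)) (Δ.toricVariety k).functionField :=
    (faithfulSMul_iff_algebraMap_injective _ _).mpr (Δ.charToFunctionField_injective k)
  have : IsFractionRing (AddMonoidAlgebra k (Module.Dual ℤ N)) (Δ.toricVariety k).functionField :=
    .of_field _ _ fun z => by
      obtain ⟨a, b, -, h⟩ := Δ.exists_eq_div k z
      exact ⟨a, b, h⟩
  refine ⟨IsLocalization.lift (M := nonZeroDivisors _) (g := f) fun a =>
    hf a.1 (nonZeroDivisors.ne_zero a.2), fun a => IsLocalization.lift_eq _ a⟩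

variable {k}

/-- The ring homomorphism `χ^m ↦ χ^m (1 + c(m) ε)`. -/
noncomputable def dualNumberHom (c : Module.Dual ℤ N →+ (Δ.toricVariety k).functionField) :
    AddMonoidAlgebra k (Module.Dual ℤ N) →+* DualNumber (Δ.toricVariety k).functionField :=
  AddMonoidAlgebra.liftNCRingHom ((TrivSqZeroExt.inlHom _ _).comp (Δ.constFunction k))
    { toFun := fun m => TrivSqZeroExt.inl (Δ.charUnit k m.toAdd : (Δ.toricVariety k).functionField) +
        TrivSqZeroExt.inr (c m.toAdd * Δ.charUnit k m.toAdd)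
      map_one' := by
        refine TrivSqZeroExt.ext ?_ ?_
        · simp [charUnit_zero]
        · simp
      map_mul' := fun m m' => by
        refine TrivSqZeroExt.ext ?_ ?_
        · simp [charUnit_add]
        · simp [charUnit_add]
          ring }
    fun _ _ => Commute.all _ _

lemma dualNumberHom_single (c : Module.Dual ℤ N →+ (Δ.toricVariety k).functionField)
    (m : Module.Dual ℤ N) (r : k) : Δ.dualNumberHom c (.single m r) =
      TrivSqZeroExt.inl (Δ.constFunction k r) *
        (TrivSqZeroExt.inl (Δ.charUnit k m : (Δ.toricVariety k).functionField) +
          TrivSqZeroExt.inr (c m * Δ.charUnit k m)) :=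
  AddMonoidAlgebra.liftNCRingHom_single _ _ _ _ _

lemma fst_dualNumberHom (c : Module.Dual ℤ N →+ (Δ.toricVariety k).functionField) (a) :
    (Δ.dualNumberHom c a).fst = Δ.charToFunctionField k a := by
  induction a using AddMonoidAlgebra.induction_linear with
  | zero => simp
  | add x y hx hy => rw [map_add, TrivSqZeroExt.fst_add, hx, hy, map_add]
  | single m r => rw [dualNumberHom_single, charToFunctionField_single]; simp

/-- A derivation of the function field with prescribed logarithmic derivatives of the characters
exists: it is the coefficient of `ε` in an extension of `χ^m ↦ χ^m (1 + c(m) ε)` to dual numbers. -/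
lemma exists_logDer (c : Module.Dual ℤ N →+ (Δ.toricVariety k).functionField) :
    ∃ δ : Derivation ℤ (Δ.toricVariety k).functionField (Δ.toricVariety k).functionField,
      (∀ r, δ (Δ.constFunction k r) = 0) ∧
      ∀ m, δ (Δ.charUnit k m) = c m * Δ.charUnit k m := by
  obtain ⟨g, hg⟩ := Δ.exists_functionField_lift k (Δ.dualNumberHom c) fun a ha => by
    rw [TrivSqZeroExt.isUnit_iff_isUnit_fst, fst_dualNumberHom, isUnit_iff_ne_zero]
    exact (map_ne_zero_iff _ (Δ.charToFunctionField_injective k)).mpr ha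
  have hfst : ∀ z, (g z).fst = z := fun z => by
    have h : (TrivSqZeroExt.fstHom ℤ (Δ.toricVariety k).functionField
        (Δ.toricVariety k).functionField).toRingHom.comp g = RingHom.id _ := by
      refine Δ.functionField_hom_ext (fun r => ?_) fun m => ?_
      · exact (congrArg _ (hg _)).trans (Δ.fst_dualNumberHom c _)
      · exact (congrArg _ (hg _)).trans (Δ.fst_dualNumberHom c _)
    exact congrArg (fun f => f z) h
  refine ⟨Derivation.mk' (AddMonoidHom.toIntLinearMap
    (AddMonoidHom.mk' (fun z => (g z).snd) fun z w => by rw [map_add]; rfl)) fun z w => ?_,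
    fun r => ?_, fun m => ?_⟩
  · change (g (z * w)).snd = z • (g w).snd + w • (g z).snd
    rw [map_mul, TrivSqZeroExt.snd_mul, hfst, hfst, op_smul_eq_smul]
  · refine (congrArg TrivSqZeroExt.snd (hg (.single 0 r))).trans ?_
    rw [dualNumberHom_single]
    simp
  · refine (congrArg TrivSqZeroExt.snd (hg (.single m 1))).trans ?_
    rw [dualNumberHom_single]
    simp

/-- The derivation of the function field with `χ^m ↦ c(m) χ^m` that vanishes on constants. -/
noncomputable def logDer (c : Module.Dual ℤ N →+ (Δ.toricVariety k).functionField) :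
    Derivation ℤ (Δ.toricVariety k).functionField (Δ.toricVariety k).functionField :=
  (Δ.exists_logDer c).choose

lemma logDer_const (c : Module.Dual ℤ N →+ (Δ.toricVariety k).functionField) (r : k) :
    Δ.logDer c (Δ.constFunction k r) = 0 := (Δ.exists_logDer c).choose_spec.1 r

lemma logDer_charUnit (c : Module.Dual ℤ N →+ (Δ.toricVariety k).functionField)
    (m : Module.Dual ℤ N) : Δ.logDer c (Δ.charUnit k m) = c m * Δ.charUnit k m :=
  (Δ.exists_logDer c).choose_spec.2 m

lemma logDer_char (c : Module.Dual ℤ N →+ (Δ.toricVariety k).functionField)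
    (m : Module.Dual ℤ N) (r : k) : Δ.logDer c (Δ.charToFunctionField k (.single m r)) =
      c m * Δ.charToFunctionField k (.single m r) := by
  rw [charToFunctionField_single, Derivation.leibniz, logDer_const, logDer_charUnit, smul_zero,
    add_zero, smul_eq_mul]
  ring

lemma derivation_ext
    {δ ε : Derivation ℤ (Δ.toricVariety k).functionField (Δ.toricVariety k).functionField}
    (h0 : ∀ r, δ (Δ.constFunction k r) = ε (Δ.constFunction k r))
    (h1 : ∀ m, δ (Δ.charUnit k m) = ε (Δ.charUnit k m)) : δ = ε := by
  have key : ∀ a, δ (Δ.charToFunctionField k a) = ε (Δ.charToFunctionField k a) := fun a => by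
    induction a using AddMonoidAlgebra.induction_linear with
    | zero => simp
    | add x y hx hy => simp only [map_add, hx, hy]
    | single m c => rw [charToFunctionField_single, Derivation.leibniz, Derivation.leibniz, h0, h1]
  refine Derivation.ext fun z => ?_
  obtain ⟨a, b, hb, rfl⟩ := Δ.exists_eq_div k z
  refine mul_left_cancel₀ hb ?_
  have h2 := fun δ : Derivation ℤ (Δ.toricVariety k).functionField
    (Δ.toricVariety k).functionField => δ.leibniz (Δ.charToFunctionField k b)
      (Δ.charToFunctionField k a / Δ.charToFunctionField k b)
  have h3 := h2 δ
  have h4 := h2 ε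
  rw [mul_div_cancel₀ _ hb, key] at h3
  rw [mul_div_cancel₀ _ hb] at h4
  rw [h3, key] at h4
  exact add_right_cancel h4

lemma logDer_add (c c' : Module.Dual ℤ N →+ (Δ.toricVariety k).functionField) :
    Δ.logDer (c + c') = Δ.logDer c + Δ.logDer c' := by
  refine Δ.derivation_ext (fun r => ?_) fun m => ?_
  · simp [logDer_const]
  · simp [logDer_charUnit, add_mul]

lemma logDer_zero : Δ.logDer (0 : Module.Dual ℤ N →+ (Δ.toricVariety k).functionField) = 0 := by
  refine Δ.derivation_ext (fun r => ?_) fun m => ?_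
  · simp [logDer_const]
  · simp [logDer_charUnit]

lemma logDer_mulLeft (z : (Δ.toricVariety k).functionField)
    (c : Module.Dual ℤ N →+ (Δ.toricVariety k).functionField) :
    Δ.logDer ((AddMonoidHom.mulLeft z).comp c) = z • Δ.logDer c := by
  refine Δ.derivation_ext (fun r => ?_) fun m => ?_
  · simp [logDer_const]
  · simp [logDer_charUnit, mul_assoc]

end FunctionField

/-! ### Regularity at the points of a toric variety -/

section Stalks

variable {N : Type u} [AddCommGroup N] [Module.Free ℤ N] {Δ : SmoothFan N} {k : Type u} [Field k]

lemma constFunction_mem (x : Δ.toricVariety k) (r : k) : Δ.constFunction k r ∈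
    (algebraMap ((Δ.toricVariety k).presheaf.stalk x) (Δ.toricVariety k).functionField).range := by
  obtain ⟨σ, hx⟩ := Δ.iSup_chartOpen k x
  have h := Δ.rationalFunction_chartSection k (.single 0 r) ⟨x, hx⟩
  rw [chartInclusion_single] at h
  exact ⟨_, h⟩

lemma charUnit_mem {σ : Δ.cones} {x : Δ.toricVariety k} (hx : x ∈ Δ.chartOpen k σ)
    {m : Module.Dual ℤ N} (hm : m ∈ dualMonoid σ.1) :
    (Δ.charUnit k m : (Δ.toricVariety k).functionField) ∈
    (algebraMap ((Δ.toricVariety k).presheaf.stalk x) (Δ.toricVariety k).functionField).range := by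
  have h := Δ.rationalFunction_chartSection k (.single ⟨m, hm⟩ 1) ⟨x, hx⟩
  rw [chartInclusion_single] at h
  exact ⟨_, h⟩

/-- Elements of the local ring of a point of `U_σ` are fractions of elements of `k[σ^∨ ∩ M]`. -/
lemma exists_mul_eq_of_mem_stalk {σ : Δ.cones} {x : Δ.toricVariety k} (hx : x ∈ Δ.chartOpen k σ)
    {z : (Δ.toricVariety k).functionField} (hz : z ∈
      (algebraMap ((Δ.toricVariety k).presheaf.stalk x) (Δ.toricVariety k).functionField).range) :
    ∃ a b : ChartRing k σ.1, z * Δ.charToFunctionField k (chartInclusion k σ.1 b) =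
      Δ.charToFunctionField k (chartInclusion k σ.1 a) ∧
      ∃ w ∈ (algebraMap ((Δ.toricVariety k).presheaf.stalk x)
        (Δ.toricVariety k).functionField).range,
        w * Δ.charToFunctionField k (chartInclusion k σ.1 b) = 1 := by
  obtain ⟨y, rfl⟩ := hz
  let _ := TopCat.Presheaf.algebra_section_stalk (Δ.toricVariety k).presheaf
    (⟨x, hx⟩ : Δ.chartOpen k σ)
  have hloc := (isAffineOpen_chartOpen (k := k) σ).isLocalization_stalk ⟨x, hx⟩
  obtain ⟨⟨f, g⟩, hfg⟩ := IsLocalization.surj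
    ((isAffineOpen_chartOpen (k := k) σ).primeIdealOf ⟨x, hx⟩).asIdeal.primeCompl y
  have hu := IsLocalization.map_units ((Δ.toricVariety k).presheaf.stalk x) g
  obtain ⟨g, hg⟩ := g
  obtain ⟨a, rfl⟩ := (Δ.chartSection_bijective k σ).2 f
  obtain ⟨b, rfl⟩ := (Δ.chartSection_bijective k σ).2 g
  obtain ⟨w, hw⟩ := hu.exists_left_inv
  have ha := Δ.rationalFunction_chartSection k a ⟨x, hx⟩
  have hb := Δ.rationalFunction_chartSection k b ⟨x, hx⟩
  refine ⟨a, b, ?_, _, ⟨w, rfl⟩, ?_⟩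
  · rw [← ha, ← hb]
    exact (map_mul _ _ _).symm.trans (congrArg _ hfg)
  · rw [← hb]
    exact (map_mul _ _ _).symm.trans ((congrArg _ hw).trans (map_one _))

/-- A logarithmic derivation preserves the local ring at a point of `U_σ` if it maps the characters
that are regular on `U_σ` into it. -/
lemma logDer_mem {σ : Δ.cones} {x : Δ.toricVariety k} (hx : x ∈ Δ.chartOpen k σ)
    (c : Module.Dual ℤ N →+ (Δ.toricVariety k).functionField)
    (hc : ∀ m ∈ dualMonoid σ.1, c m * Δ.charUnit k m ∈
      (algebraMap ((Δ.toricVariety k).presheaf.stalk x) (Δ.toricVariety k).functionField).range)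
    {z : (Δ.toricVariety k).functionField} (hz : z ∈
      (algebraMap ((Δ.toricVariety k).presheaf.stalk x) (Δ.toricVariety k).functionField).range) :
    Δ.logDer c z ∈
      (algebraMap ((Δ.toricVariety k).presheaf.stalk x) (Δ.toricVariety k).functionField).range := by
  have key : ∀ a : ChartRing k σ.1,
      Δ.logDer c (Δ.charToFunctionField k (chartInclusion k σ.1 a)) ∈
      (algebraMap ((Δ.toricVariety k).presheaf.stalk x)
        (Δ.toricVariety k).functionField).range := fun a => by
    induction a using AddMonoidAlgebra.induction_linear with
    | zero => simp
    | add a b ha hb => rw [map_add, map_add, map_add]; exact add_mem ha hb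
    | single m r =>
      rw [chartInclusion_single, logDer_char, charToFunctionField_single, mul_left_comm]
      exact mul_mem (constFunction_mem x r) (hc m.1 m.2)
  obtain ⟨a, b, hab, w, hw, hwb⟩ := exists_mul_eq_of_mem_stalk hx hz
  have h1 := (Δ.logDer c).leibniz z (Δ.charToFunctionField k (chartInclusion k σ.1 b))
  rw [hab, smul_eq_mul, smul_eq_mul] at h1
  have h2 : Δ.logDer c z = w * (Δ.logDer c (Δ.charToFunctionField k (chartInclusion k σ.1 a)) -
      z * Δ.logDer c (Δ.charToFunctionField k (chartInclusion k σ.1 b))) := by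
    rw [h1, add_sub_cancel_left, ← mul_assoc, hwb, one_mul]
  rw [h2]
  exact mul_mem hw (sub_mem (key a) (mul_mem hz (key b)))

lemma constantSection_torus (r : k) :
    constantSection (Δ.structureMorphism k) (Δ.chartOpen k Δ.zeroCone) r =
      Δ.chartSection k Δ.zeroCone (.single 0 r) := by
  apply Δ.appLE_chartι_injective k Δ.zeroCone
  rw [appLE_chartSection]
  change _ = (Scheme.ΓSpecIso (.of (ChartRing k Δ.zeroCone.1))).inv
    (algebraMap k (ChartRing k Δ.zeroCone.1) r)
  have h2 : Δ.chartι k Δ.zeroCone ≫ Δ.structureMorphism k =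
      Spec.map (CommRingCat.ofHom (algebraMap k (ChartRing k Δ.zeroCone.1))) :=
    Limits.colimit.ι_desc _ _
  have h3 := Scheme.ΓSpecIso_inv_naturality
    (CommRingCat.ofHom (algebraMap k (ChartRing k Δ.zeroCone.1)))
  refine Eq.trans ?_ (ConcreteCategory.congr_hom h3 r).symm
  change ((Scheme.ΓSpecIso _).inv ≫ ((Δ.structureMorphism k).appTop ≫
    (Δ.toricVariety k).presheaf.map (homOfLE le_top).op) ≫
    (Δ.chartι k Δ.zeroCone).appLE (Δ.chartOpen k Δ.zeroCone) ⊤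
      (Δ.top_le_preimage_chartOpen k Δ.zeroCone)) r = _
  refine ConcreteCategory.congr_hom (congrArg ((Scheme.ΓSpecIso (.of k)).inv ≫ ·) ?_) r
  rw [Category.assoc, Scheme.Hom.map_appLE]
  have h4 : ∀ (f : (Δ.chart k).obj Δ.zeroCone ⟶ Spec (.of k)) (hf :
      Δ.chartι k Δ.zeroCone ≫ Δ.structureMorphism k = f), (Δ.structureMorphism k).appTop ≫
      (Δ.chartι k Δ.zeroCone).appLE ⊤ ⊤ le_top = f.appTop := by
    rintro _ rfl
    rw [Scheme.Hom.comp_appTop]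
    congr 1
  exact h4 _ h2

lemma rationalFunction_constantSection {V : (Δ.toricVariety k).Opens} (x : V) (r : k) :
    rationalFunction x (constantSection (Δ.structureMorphism k) V r) = Δ.constFunction k r := by
  have hne : Nonempty (Δ.chartOpen k Δ.zeroCone) := inferInstance
  obtain ⟨t⟩ := hne
  let η : (V ⊓ Δ.chartOpen k Δ.zeroCone : (Δ.toricVariety k).Opens) :=
    ⟨genericPoint _, genericPoint_mem_of_mem x.2,
      genericPoint_mem_of_mem t.2⟩
  have h1 := rationalFunction_res (inf_le_left : V ⊓ Δ.chartOpen k Δ.zeroCone ≤ V) η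
    (constantSection (Δ.structureMorphism k) V r)
  have h2 := rationalFunction_res
    (inf_le_right : V ⊓ Δ.chartOpen k Δ.zeroCone ≤ Δ.chartOpen k Δ.zeroCone) η
    (constantSection (Δ.structureMorphism k) (Δ.chartOpen k Δ.zeroCone) r)
  rw [constantSection_res] at h1 h2
  rw [rationalFunction_eq x ⟨η.1, η.2.1⟩, ← h1, h2, constantSection_torus,
    rationalFunction_chartSection, chartInclusion_single]
  rfl

end Stalks

end SmoothFan

section Scalar

variable {X : Scheme.{u}} [IsIntegral X] {D : CartierDivisor X} {U : X.Opens}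

open Classical in
/-- The rational function that underlies a section of `O_X(D)`; zero over the empty set. -/
noncomputable def lineBundle.scalar (s : Γ(lineBundle D, U)) : X.functionField :=
  if h : Nonempty U then lineBundle.value s h.some else 0

lemma lineBundle.value_eq_scalar (s : Γ(lineBundle D, U)) (x : U) :
    lineBundle.value s x = lineBundle.scalar s := by
  rw [scalar, dif_pos ⟨x⟩]
  exact value_eq _ _ _

end Scalar

namespace SmoothFan

/-! ### The torus-invariant prime divisors -/

section RayDivisors

variable {N : Type u} [AddCommGroup N] [Module.Free ℤ N] {Δ : SmoothFan N} {k : Type u} [Field k]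

lemma rayForm_mem (ρ : Δ.Ray) (σ : Δ.cones) : Δ.rayForm ρ σ ∈ dualMonoid σ.1 := fun v hv => by
  rw [Δ.rayForm_spec ρ σ v hv]
  split_ifs <;> simp

lemma isLocalEquation_rayForm (ρ : Δ.Ray) {σ : Δ.cones} {x : Δ.toricVariety k}
    (hx : x ∈ Δ.chartOpen k σ) :
    (Δ.rayDivisor k ρ).IsLocalEquation x (Δ.charUnit k (Δ.rayForm ρ σ)) :=
  Δ.rayDivisor_isLocalEquation k ρ hx _ (Δ.rayForm_spec ρ σ)

lemma isEffective_rayDivisor (ρ : Δ.Ray) : (Δ.rayDivisor k ρ).IsEffective := fun x => by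
  obtain ⟨σ, hx⟩ := Δ.iSup_chartOpen k x
  refine (isLocalEquation_rayForm ρ hx).regularAt_iff.mpr ?_
  rw [one_mul]
  exact charUnit_mem hx (rayForm_mem ρ σ)

/-- Outside of `D_ρ` the sections of `O_X(D_ρ)` are regular. -/
lemma mem_of_regularAt_rayDivisor {ρ : Δ.Ray} {σ : Δ.cones} (hρ : ρ.1 ∉ σ.1)
    {x : Δ.toricVariety k} (hx : x ∈ Δ.chartOpen k σ) {z : (Δ.toricVariety k).functionField}
    (hz : (Δ.rayDivisor k ρ).RegularAt x z) : z ∈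
      (algebraMap ((Δ.toricVariety k).presheaf.stalk x) (Δ.toricVariety k).functionField).range := by
  have h := Δ.rayDivisor_isLocalEquation k ρ hx 0 fun v hv => by
    rw [if_neg (fun h : v = ρ.1 => hρ (h ▸ hv)), LinearMap.zero_apply]
  simpa [charUnit_zero] using hz _ h

/-- If `z` is a section of `O_X(D_ρ)`, then `χ^m ↦ ⟨m, ρ⟩ z χ^m` preserves regular functions. -/
lemma ray_mul_mem {ρ : Δ.Ray} {σ : Δ.cones} {x : Δ.toricVariety k} (hx : x ∈ Δ.chartOpen k σ)
    {z : (Δ.toricVariety k).functionField} (hz : (Δ.rayDivisor k ρ).RegularAt x z)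
    {m : Module.Dual ℤ N} (hm : m ∈ dualMonoid σ.1) :
    z * (m ρ.1 : (Δ.toricVariety k).functionField) * Δ.charUnit k m ∈
      (algebraMap ((Δ.toricVariety k).presheaf.stalk x) (Δ.toricVariety k).functionField).range := by
  by_cases h0 : m ρ.1 = 0
  · simp [h0]
  by_cases hρ : ρ.1 ∈ σ.1
  · have hm' : m - Δ.rayForm ρ σ ∈ dualMonoid σ.1 := fun v hv => by
      have h1 := hm v hv
      rw [LinearMap.sub_apply, Δ.rayForm_spec ρ σ v hv]
      split_ifs with h
      · subst h
        have : m ρ.1 ≠ 0 := h0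
        omega
      · simpa using h1
    have h2 : (Δ.charUnit k m : (Δ.toricVariety k).functionField) =
        Δ.charUnit k (Δ.rayForm ρ σ) * Δ.charUnit k (m - Δ.rayForm ρ σ) := by
      rw [← Units.val_mul, ← charUnit_add, add_sub_cancel]
    have h3 := mul_mem (intCast_mem _ (m ρ.1))
      (mul_mem (hz _ (isLocalEquation_rayForm ρ hx)) (charUnit_mem hx hm'))
    convert h3 using 1
    rw [h2]
    ring
  · exact mul_mem (mul_mem (mem_of_regularAt_rayDivisor hρ hx hz) (intCast_mem _ _))
      (charUnit_mem hx hm)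

end RayDivisors

/-! ### Vector fields on a toric variety -/

section Tangent

variable {N : Type u} [AddCommGroup N] [Module.Free ℤ N] {Δ : SmoothFan N} {k : Type u} [Field k]
  {U : (Δ.toricVariety k).Opens}

/-- The logarithmic derivation `c` of the function field preserves the functions that are regular
at the points of `U`. -/
def IsLogRegular (U : (Δ.toricVariety k).Opens)
    (c : Module.Dual ℤ N →+ (Δ.toricVariety k).functionField) : Prop :=
  ∀ x ∈ U, ∃ σ, x ∈ Δ.chartOpen k σ ∧ ∀ m ∈ dualMonoid σ.1, c m * Δ.charUnit k m ∈
    (algebraMap ((Δ.toricVariety k).presheaf.stalk x) (Δ.toricVariety k).functionField).range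

/-- The logarithmic derivation `c` applied to a regular function. -/
noncomputable def logSection {c : Module.Dual ℤ N →+ (Δ.toricVariety k).functionField}
    (hc : IsLogRegular U c) {V : (Δ.toricVariety k).Opens} (hV : V ≤ U)
    (f : Γ(Δ.toricVariety k, V)) : Γ(Δ.toricVariety k, V) :=
  sectionOfRegular (fun x => Δ.logDer c (rationalFunction x f))
    (fun x y => by rw [rationalFunction_eq x y f])
    fun x => by
      obtain ⟨σ, hx, h⟩ := hc x.1 (hV x.2)
      exact logDer_mem hx c h (rationalFunction_mem x f)

lemma rationalFunction_logSection {c : Module.Dual ℤ N →+ (Δ.toricVariety k).functionField}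
    (hc : IsLogRegular U c) {V : (Δ.toricVariety k).Opens} (hV : V ≤ U)
    (f : Γ(Δ.toricVariety k, V)) (x : V) :
    rationalFunction x (logSection hc hV f) = Δ.logDer c (rationalFunction x f) :=
  rationalFunction_sectionOfRegular _ _ _ x

/-- The section of the tangent sheaf over `U` given by a logarithmic derivation of the function
field. -/
noncomputable def tangentOfLog {c : Module.Dual ℤ N →+ (Δ.toricVariety k).functionField}
    (hc : IsLogRegular U c) : Γ(Δ.tangentModule k, U) :=
  tangentSheafMk
    (fun V hV => AddMonoidHom.mk' (logSection hc hV)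
      fun f g => section_ext_rationalFunction fun x => by
        simp only [rationalFunction_add, rationalFunction_logSection, map_add])
    (fun V hV r => section_ext_rationalFunction fun x => by
      refine (rationalFunction_logSection hc hV _ x).trans ?_
      rw [rationalFunction_constantSection, logDer_const, rationalFunction_zero])
    (fun V hV f g => section_ext_rationalFunction fun x => by
      refine (rationalFunction_logSection hc hV _ x).trans ?_
      rw [rationalFunction_add, rationalFunction_mul, rationalFunction_mul, rationalFunction_mul,
        Derivation.leibniz, smul_eq_mul, smul_eq_mul]
      refine congrArg₂ _ (congrArg _ ?_) (congrArg _ ?_)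
      · exact (rationalFunction_logSection hc hV _ x).symm
      · exact (rationalFunction_logSection hc hV _ x).symm)
    (fun V W hV h f => section_ext_rationalFunction fun x => by
      refine (rationalFunction_logSection hc (h.trans hV) _ x).trans ?_
      rw [rationalFunction_res, rationalFunction_res]
      exact (rationalFunction_logSection hc hV _ _).symm)

/-- The vector field `δ` acts on functions by the logarithmic derivation `c`. -/
def IsLogarithmic (δ : Γ(Δ.tangentModule k, U))
    (c : Module.Dual ℤ N →+ (Δ.toricVariety k).functionField) : Prop :=
  ∀ (V : (Δ.toricVariety k).Opens) (hV : V ≤ U) (f : Γ(Δ.toricVariety k, V)) (x : V),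
    rationalFunction x (tangentSheaf.apply δ hV f) = Δ.logDer c (rationalFunction x f)

lemma isLogarithmic_tangentOfLog {c : Module.Dual ℤ N →+ (Δ.toricVariety k).functionField}
    (hc : IsLogRegular U c) : IsLogarithmic (tangentOfLog hc) c :=
  fun _ hV f x => rationalFunction_logSection hc hV f x

namespace IsLogarithmic

variable {δ ε : Γ(Δ.tangentModule k, U)}
  {c c' : Module.Dual ℤ N →+ (Δ.toricVariety k).functionField}

lemma ext (hδ : IsLogarithmic δ c) (hε : IsLogarithmic ε c) : δ = ε :=
  tangentSheaf.ext_apply fun V hV f => section_ext_rationalFunction fun x => by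
    rw [hδ V hV f x, hε V hV f x]

lemma add (hδ : IsLogarithmic δ c) (hε : IsLogarithmic ε c') : IsLogarithmic (δ + ε) (c + c') :=
  fun V hV f x => by
    rw [tangentSheaf.apply_add, rationalFunction_add, hδ V hV f x, hε V hV f x, logDer_add]
    rfl

lemma zero : IsLogarithmic (0 : Γ(Δ.tangentModule k, U)) 0 := fun V hV f x => by
  rw [tangentSheaf.apply_zero, rationalFunction_zero, logDer_zero]
  rfl

lemma sum {ι : Type*} (t : Finset ι) {δ : ι → Γ(Δ.tangentModule k, U)}
    {c : ι → Module.Dual ℤ N →+ (Δ.toricVariety k).functionField}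
    (h : ∀ i ∈ t, IsLogarithmic (δ i) (c i)) : IsLogarithmic (∑ i ∈ t, δ i) (∑ i ∈ t, c i) := by
  classical
  induction t using Finset.induction_on with
  | empty => simpa only [Finset.sum_empty] using zero
  | insert a t ha ih =>
    rw [Finset.sum_insert ha, Finset.sum_insert ha]
    exact (h a (Finset.mem_insert_self _ _)).add
      (ih fun i hi => h i (Finset.mem_insert_of_mem hi))

lemma smul (hδ : IsLogarithmic δ c) (r : Γ(Δ.toricVariety k, U))
    {z : (Δ.toricVariety k).functionField} (hz : ∀ x, rationalFunction x r = z) :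
    IsLogarithmic (r • δ) ((AddMonoidHom.mulLeft z).comp c) := fun V hV f x => by
  rw [tangentSheaf.apply_smul, rationalFunction_mul, rationalFunction_res, hz, hδ V hV f x,
    logDer_mulLeft]
  rfl

lemma res {V : (Δ.toricVariety k).Opens} (hV : V ≤ U) (hδ : IsLogarithmic δ c) :
    IsLogarithmic ((Δ.tangentModule k).presheaf.map (homOfLE hV).op δ) c :=
  fun _ hW f x => hδ _ (hW.trans hV) f x

end IsLogarithmic

lemma genericPoint_mem_chartOpen (σ : Δ.cones) : genericPoint (Δ.toricVariety k) ∈ Δ.chartOpen k σ := by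
  have hne : Nonempty (Δ.chartOpen k σ) := inferInstance
  obtain ⟨t⟩ := hne
  exact genericPoint_mem_of_mem t.2

/-- Laurent polynomials as functions on an open subset of the torus. -/
noncomputable def torusSection {V : (Δ.toricVariety k).Opens} (hV : V ≤ Δ.chartOpen k Δ.zeroCone) :
    AddMonoidAlgebra k (Module.Dual ℤ N) →+* Γ(Δ.toricVariety k, V) :=
  ((Δ.toricVariety k).presheaf.map (homOfLE hV).op).hom.comp
    ((Δ.chartSection k Δ.zeroCone).comp
      (AddMonoidAlgebra.mapDomainRingHom k
        ({ toFun := fun m => ⟨m, fun _ h => h.elim⟩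
           map_zero' := rfl
           map_add' := fun _ _ => rfl } : Module.Dual ℤ N →+ dualMonoid (∅ : Set N))))

lemma rationalFunction_torusSection {V : (Δ.toricVariety k).Opens}
    (hV : V ≤ Δ.chartOpen k Δ.zeroCone) (a : AddMonoidAlgebra k (Module.Dual ℤ N)) (x : V) :
    rationalFunction x (torusSection hV a) = Δ.charToFunctionField k a := by
  refine (rationalFunction_res hV x _).trans ?_
  exact Scheme.algebraMap_germ_eq_germToFunctionField _ _ _

/-- Every vector field acts by a logarithmic derivation, since rational functions are quotients of
Laurent polynomials. -/
lemma exists_isLogarithmic (δ : Γ(Δ.tangentModule k, U)) :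
    ∃ c : Module.Dual ℤ N →+ (Δ.toricVariety k).functionField, IsLogarithmic δ c := by
  by_cases hU : genericPoint (Δ.toricVariety k) ∈ U
  swap
  · exact ⟨0, fun V hV f x => (hU (hV (genericPoint_mem_of_mem x.2))).elim⟩
  let W : (Δ.toricVariety k).Opens := U ⊓ Δ.chartOpen k Δ.zeroCone
  have hη : genericPoint (Δ.toricVariety k) ∈ W := ⟨hU, genericPoint_mem_chartOpen _⟩
  let d : Module.Dual ℤ N → (Δ.toricVariety k).functionField := fun m =>
    rationalFunction (⟨_, hη⟩ : W) (tangentSheaf.apply δ inf_le_left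
      (torusSection (inf_le_right : W ≤ _) (.single m 1)))
  have hd : ∀ m m', d (m + m') = Δ.charUnit k m * d m' + Δ.charUnit k m' * d m := fun m m' => by
    change rationalFunction _ _ = _
    have h1 : (AddMonoidAlgebra.single (m + m') 1 : AddMonoidAlgebra k (Module.Dual ℤ N)) =
      .single m 1 * .single m' 1 := by rw [AddMonoidAlgebra.single_mul_single, one_mul]
    rw [h1, map_mul, tangentSheaf.apply_mul, rationalFunction_add, rationalFunction_mul,
      rationalFunction_mul, rationalFunction_torusSection, rationalFunction_torusSection]
    rfl
  let c : Module.Dual ℤ N →+ (Δ.toricVariety k).functionField :=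
    AddMonoidHom.mk' (fun m => d m * ((Δ.charUnit k m)⁻¹ : ((Δ.toricVariety k).functionField)ˣ))
      fun m m' => by
        rw [hd, charUnit_add, mul_inv, Units.val_mul]
        have h1 := (Δ.charUnit k m).mul_inv
        have h2 := (Δ.charUnit k m').mul_inv
        linear_combination d m' * ((Δ.charUnit k m')⁻¹ : ((Δ.toricVariety k).functionField)ˣ) * h1 +
          d m * ((Δ.charUnit k m)⁻¹ : ((Δ.toricVariety k).functionField)ˣ) * h2
  have hc : ∀ m, c m * Δ.charUnit k m = d m := fun m => Units.inv_mul_cancel_right _ _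
  have key : ∀ (V : (Δ.toricVariety k).Opens) (hVU : V ≤ U) (hV : V ≤ Δ.chartOpen k Δ.zeroCone)
      (a : AddMonoidAlgebra k (Module.Dual ℤ N)) (x : V),
      rationalFunction x (tangentSheaf.apply δ hVU (torusSection hV a)) =
        Δ.logDer c (Δ.charToFunctionField k a) := fun V hVU hV a x => by
    induction a using AddMonoidAlgebra.induction_linear with
    | zero => simp only [map_zero, rationalFunction_zero]
    | add a b ha hb => simp only [map_add, rationalFunction_add, ha, hb]
    | single m r =>
      have h1 : torusSection hV (.single m r) =
          constantSection (Δ.structureMorphism k) V r * torusSection hV (.single m 1) :=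
        section_ext_rationalFunction fun x => by
          rw [rationalFunction_mul, rationalFunction_torusSection, rationalFunction_torusSection,
            rationalFunction_constantSection, charToFunctionField_single]
          rfl
      have h2 : torusSection hV (.single m 1) =
          (Δ.toricVariety k).presheaf.map (homOfLE (le_inf hVU hV)).op
            (torusSection (inf_le_right : W ≤ _) (.single m 1)) :=
        section_ext_rationalFunction fun x => by
          rw [rationalFunction_torusSection, rationalFunction_res, rationalFunction_torusSection]
      have h3 : rationalFunction x (tangentSheaf.apply δ hVU (torusSection hV (.single m 1))) =
          d m := by
        rw [h2]
        have := tangentSheaf.apply_res δ (inf_le_left : W ≤ U) (le_inf hVU hV)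
          (torusSection (inf_le_right : W ≤ _) (.single m 1))
        refine (congrArg _ this).trans ?_
        rw [rationalFunction_res]
        exact rationalFunction_eq _ _ _
      have h4 := tangentSheaf.apply_const δ hVU r
      rw [h1, tangentSheaf.apply_mul, rationalFunction_add, rationalFunction_mul,
        rationalFunction_constantSection, h3]
      refine (congrArg (fun z => _ + z) (congrArg _ (congrArg _ h4))).trans ?_
      rw [mul_zero, rationalFunction_zero, add_zero, logDer_char, charToFunctionField_single,
        mul_left_comm, hc]
  refine ⟨c, fun V hV f x => ?_⟩
  let V' : (Δ.toricVariety k).Opens := V ⊓ Δ.chartOpen k Δ.zeroCone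
  have hη' : genericPoint (Δ.toricVariety k) ∈ V' :=
    ⟨genericPoint_mem_of_mem x.2, genericPoint_mem_chartOpen _⟩
  let η : V' := ⟨_, hη'⟩
  let f' : Γ(Δ.toricVariety k, V') :=
    (Δ.toricVariety k).presheaf.map (homOfLE (inf_le_left : V' ≤ V)).op f
  have hf' : ∀ y : V', rationalFunction y f' = rationalFunction x f := fun y => by
    rw [rationalFunction_res]
    exact rationalFunction_eq _ _ _
  have h1 : rationalFunction x (tangentSheaf.apply δ hV f) =
      rationalFunction η (tangentSheaf.apply δ (inf_le_left.trans hV) f') := by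
    have := tangentSheaf.apply_res δ hV (inf_le_left : V' ≤ V) f
    rw [this, rationalFunction_res]
    exact rationalFunction_eq _ _ _
  rw [h1]
  obtain ⟨a, b, hb, hz⟩ := Δ.exists_eq_div k (rationalFunction x f)
  have h2 : torusSection (inf_le_right : V' ≤ _) b * f' =
      torusSection (inf_le_right : V' ≤ _) a := section_ext_rationalFunction fun y => by
    rw [rationalFunction_mul, rationalFunction_torusSection, rationalFunction_torusSection, hf',
      hz, mul_div_cancel₀ _ hb]
  have h3 := tangentSheaf.apply_mul δ (inf_le_left.trans hV) (torusSection inf_le_right b) f'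
  rw [h2] at h3
  have h4 := congrArg (rationalFunction η) h3
  rw [key, rationalFunction_add, rationalFunction_mul, rationalFunction_mul, key, hf',
    rationalFunction_torusSection] at h4
  have h5 := (Δ.logDer c).leibniz (Δ.charToFunctionField k b) (rationalFunction x f)
  rw [hz, mul_div_cancel₀ _ hb, ← hz, h4, smul_eq_mul, smul_eq_mul] at h5
  exact mul_left_cancel₀ hb (add_right_cancel h5)

lemma IsLogarithmic.mem {δ : Γ(Δ.tangentModule k, U)}
    {c : Module.Dual ℤ N →+ (Δ.toricVariety k).functionField} (hδ : IsLogarithmic δ c)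
    {x : Δ.toricVariety k} (hx : x ∈ U) {z : (Δ.toricVariety k).functionField} (hz : z ∈
      (algebraMap ((Δ.toricVariety k).presheaf.stalk x) (Δ.toricVariety k).functionField).range) :
    Δ.logDer c z ∈
      (algebraMap ((Δ.toricVariety k).presheaf.stalk x) (Δ.toricVariety k).functionField).range := by
  obtain ⟨y, rfl⟩ := hz
  obtain ⟨V, hxV, f, rfl⟩ := (Δ.toricVariety k).presheaf.exists_germ_eq y
  have h := hδ (V ⊓ U) inf_le_right
    ((Δ.toricVariety k).presheaf.map (homOfLE (inf_le_left : V ⊓ U ≤ V)).op f) ⟨x, hxV, hx⟩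
  rw [rationalFunction_res] at h
  exact ⟨_, h⟩

lemma IsLogarithmic.unique {δ : Γ(Δ.tangentModule k, U)}
    {c c' : Module.Dual ℤ N →+ (Δ.toricVariety k).functionField} (hδ : IsLogarithmic δ c)
    (hδ' : IsLogarithmic δ c') {x : Δ.toricVariety k} (hx : x ∈ U) : c = c' := by
  refine AddMonoidHom.ext fun m => ?_
  let W : (Δ.toricVariety k).Opens := U ⊓ Δ.chartOpen k Δ.zeroCone
  let η : W := ⟨genericPoint _, genericPoint_mem_of_mem hx, genericPoint_mem_chartOpen _⟩
  have h := hδ W inf_le_left (torusSection inf_le_right (.single m 1)) η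
  rw [hδ' W inf_le_left (torusSection inf_le_right (.single m 1)) η,
    rationalFunction_torusSection] at h
  change Δ.logDer c' (Δ.charUnit k m) = Δ.logDer c (Δ.charUnit k m) at h
  rw [logDer_charUnit, logDer_charUnit] at h
  exact (mul_right_cancel₀ (Δ.charUnit k m).ne_zero h).symm

/-- The homomorphism `m ↦ ⟨m, v⟩ z`. -/
noncomputable def pairingLog (v : N) (z : (Δ.toricVariety k).functionField) :
    Module.Dual ℤ N →+ (Δ.toricVariety k).functionField :=
  AddMonoidHom.mk' (fun m => z * (m v : (Δ.toricVariety k).functionField)) fun m m' => by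
    rw [LinearMap.add_apply, Int.cast_add, mul_add]

lemma pairingLog_apply (v : N) (z : (Δ.toricVariety k).functionField) (m : Module.Dual ℤ N) :
    pairingLog v z m = z * (m v : (Δ.toricVariety k).functionField) := rfl

lemma logDer_pairingLog (v : N) (z w : (Δ.toricVariety k).functionField) :
    Δ.logDer (pairingLog v z) w = z * Δ.logDer (pairingLog v 1) w := by
  have h : pairingLog v z = (AddMonoidHom.mulLeft z).comp (pairingLog (Δ := Δ) (k := k) v 1) :=
    AddMonoidHom.ext fun m => by
      simp only [pairingLog_apply, AddMonoidHom.comp_apply, AddMonoidHom.coe_mulLeft, one_mul]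
  rw [h, logDer_mulLeft]
  rfl

/-- On a chart `U_σ`, whose coordinates are the characters `x_i` dual to a basis that contains the
generators of `σ`, the tangent sheaf is free on the `∂/∂x_i`. -/
lemma coherentOn_tangentModule (σ : Δ.cones) : CoherentOn (Δ.tangentModule k) (Δ.chartOpen k σ) := by
  obtain ⟨b, hb⟩ := Δ.smooth σ.1 σ.2
  have hu : ∀ i, b.coord i ∈ dualMonoid σ.1 := fun i v hv => by
    obtain ⟨j, rfl⟩ := hb hv
    rw [Module.Basis.coord_apply, Module.Basis.repr_self, Finsupp.single_apply]
    split_ifs <;> simp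
  have hsum : ∀ m : Module.Dual ℤ N, m = ∑ i, m (b i) • b.coord i := fun m => b.ext fun j => by
    simp
  let x : Fin (Module.finrank ℤ N) → (Δ.toricVariety k).functionField := fun i =>
    Δ.charUnit k (b.coord i)
  let y : Fin (Module.finrank ℤ N) → (Δ.toricVariety k).functionField := fun i =>
    ((Δ.charUnit k (b.coord i))⁻¹ : ((Δ.toricVariety k).functionField)ˣ)
  have hxy : ∀ i, x i * y i = 1 := fun i => Units.mul_inv _
  have he : ∀ i, IsLogRegular (Δ.chartOpen k σ) (pairingLog (b i) (y i)) := by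
    refine fun i p hp => ⟨σ, hp, fun m hm => ?_⟩
    rw [pairingLog_apply]
    by_cases h0 : m (b i) = 0
    · simp [h0]
    · have hm' : m - b.coord i ∈ dualMonoid σ.1 := fun v hv => by
        have h1 := hm v hv
        obtain ⟨j, rfl⟩ := hb hv
        rw [LinearMap.sub_apply, Module.Basis.coord_apply, Module.Basis.repr_self,
          Finsupp.single_apply]
        split_ifs with h
        · subst h
          omega
        · simpa using h1
      have h2 := mul_mem (intCast_mem _ (m (b i))) (charUnit_mem (k := k) hp hm')
      rw [charUnit_sub, Units.val_mul] at h2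
      convert h2 using 1
      change y i * _ * _ = _ * (_ * y i)
      ring
  let e : Fin (Module.finrank ℤ N) → Γ(Δ.tangentModule k, Δ.chartOpen k σ) := fun i =>
    tangentOfLog (he i)
  refine coherentOn_of_frame (isAffineOpen_chartOpen σ) e (fun V hV δ => ?_) fun V hV c hc i => ?_
  · obtain ⟨c, hδ⟩ := exists_isLogarithmic δ
    have hg : ∀ (i) (p : V), c (b.coord i) * x i ∈
        (algebraMap ((Δ.toricVariety k).presheaf.stalk p.1)
          (Δ.toricVariety k).functionField).range := fun i p => by
      have h := hδ.mem p.2 (charUnit_mem (hV p.2) (hu i))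
      rwa [logDer_charUnit] at h
    refine ⟨fun i => sectionOfRegular (fun _ => c (b.coord i) * x i) (fun _ _ => rfl) (hg i), ?_⟩
    have h := IsLogarithmic.sum Finset.univ fun i _ =>
      ((isLogarithmic_tangentOfLog (he i)).res hV).smul
        (sectionOfRegular (fun _ => c (b.coord i) * x i) (fun _ _ => rfl) (hg i))
        (rationalFunction_sectionOfRegular _ _ _)
    refine hδ.ext ?_
    convert h using 1
    refine AddMonoidHom.ext fun m => ?_
    rw [AddMonoidHom.finsetSum_apply]
    conv_lhs => rw [hsum m]
    rw [map_sum]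
    refine Finset.sum_congr rfl fun i _ => ?_
    rw [map_zsmul, AddMonoidHom.comp_apply, AddMonoidHom.coe_mulLeft, pairingLog_apply,
      zsmul_eq_mul]
    linear_combination -(c (b.coord i) * (m (b i) : (Δ.toricVariety k).functionField)) * hxy i
  · refine section_ext_rationalFunction fun p => ?_
    have h := IsLogarithmic.sum Finset.univ fun i _ =>
      ((isLogarithmic_tangentOfLog (he i)).res hV).smul (c i)
        (fun q => rationalFunction_eq q p (c i))
    have h1 : (∑ i, (AddMonoidHom.mulLeft (rationalFunction p (c i))).comp
        (pairingLog (b i) (y i))) = 0 :=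
      (show IsLogarithmic (0 : Γ(Δ.tangentModule k, V)) _ from hc ▸ h).unique
        IsLogarithmic.zero p.2
    have h2 := DFunLike.congr_fun h1 (b.coord i)
    rw [AddMonoidHom.finsetSum_apply, Finset.sum_eq_single i, AddMonoidHom.comp_apply,
      AddMonoidHom.coe_mulLeft, pairingLog_apply, Module.Basis.coord_apply,
      Module.Basis.repr_self, Finsupp.single_eq_same, Int.cast_one, mul_one] at h2
    · rw [rationalFunction_zero]
      exact (mul_eq_zero.mp h2).resolve_right (right_ne_zero_of_mul_eq_one (hxy i))
    · intro j _ hj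
      rw [AddMonoidHom.comp_apply, AddMonoidHom.coe_mulLeft, pairingLog_apply,
        Module.Basis.coord_apply, Module.Basis.repr_self, Finsupp.single_eq_of_ne' hj]
      simp
    · simp

lemma isLogRegular_pairingLog {ρ : Δ.Ray} {z : (Δ.toricVariety k).functionField}
    (hz : ∀ x ∈ U, (Δ.rayDivisor k ρ).RegularAt x z) : IsLogRegular U (pairingLog ρ.1 z) :=
  fun x hx => by
    obtain ⟨σ, hσ⟩ := Δ.iSup_chartOpen k x
    exact ⟨σ, hσ, fun m hm => ray_mul_mem hσ (hz x hx) hm⟩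

/-- Equality of vector fields can be tested at the points of `U`, so `U` may be assumed nonempty. -/
lemma tangent_ext_of_isLogarithmic {δ ε : Γ(Δ.tangentModule k, U)}
    (h : ∀ x ∈ U, ∃ c c', c = c' ∧ IsLogarithmic δ c ∧ IsLogarithmic ε c') : δ = ε := by
  by_cases hU : Nonempty U
  · obtain ⟨x⟩ := hU
    obtain ⟨c, c', rfl, h1, h2⟩ := h x.1 x.2
    exact h1.ext h2
  · exact tangentSheaf.ext_apply fun V hV f => section_ext_rationalFunction fun x =>
      (hU ⟨⟨x.1, hV x.2⟩⟩).elim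

lemma scalar_regularAt {D : CartierDivisor (Δ.toricVariety k)} (s : Γ(lineBundle D, U)) :
    ∀ x ∈ U, D.RegularAt x (lineBundle.scalar s) := fun x hx => by
  rw [← lineBundle.value_eq_scalar s ⟨x, hx⟩]
  exact lineBundle.regularAt_value s ⟨x, hx⟩

/-- The vector field `χ^u ↦ ⟨u, ρ⟩ s χ^u`. -/
noncomputable def rayVector (ρ : Δ.Ray) (s : Γ(lineBundle (Δ.rayDivisor k ρ), U)) :
    Γ(Δ.tangentModule k, U) :=
  tangentOfLog (isLogRegular_pairingLog (scalar_regularAt s))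

lemma isLogarithmic_rayVector (ρ : Δ.Ray) (s : Γ(lineBundle (Δ.rayDivisor k ρ), U)) (x : U) :
    IsLogarithmic (rayVector ρ s) (pairingLog ρ.1 (lineBundle.value s x)) := by
  rw [lineBundle.value_eq_scalar]
  exact isLogarithmic_tangentOfLog _

/-- The map `O_X(D_ρ) → T_X`, `s ↦ (χ^u ↦ ⟨u, ρ⟩ s χ^u)`. -/
noncomputable def rayField (ρ : Δ.Ray) : lineBundle (Δ.rayDivisor k ρ) ⟶ Δ.tangentModule k :=
  modulesHomMk
    (fun U => AddMonoidHom.mk' (rayVector ρ) fun s t =>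
      tangent_ext_of_isLogarithmic fun x hx => ⟨_, _, AddMonoidHom.ext fun m => by
        rw [AddMonoidHom.add_apply, pairingLog_apply, pairingLog_apply, pairingLog_apply,
          lineBundle.value_add, add_mul],
        isLogarithmic_rayVector ρ (s + t) ⟨x, hx⟩,
        (isLogarithmic_rayVector ρ s ⟨x, hx⟩).add (isLogarithmic_rayVector ρ t ⟨x, hx⟩)⟩)
    (fun U r s => tangent_ext_of_isLogarithmic fun x hx => ⟨_, _, AddMonoidHom.ext fun m => by
        rw [AddMonoidHom.comp_apply, AddMonoidHom.coe_mulLeft, pairingLog_apply, pairingLog_apply,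
          lineBundle.value_smul, mul_assoc],
        isLogarithmic_rayVector ρ (r • s) ⟨x, hx⟩,
        (isLogarithmic_rayVector ρ s ⟨x, hx⟩).smul r fun y => rationalFunction_eq y ⟨x, hx⟩ r⟩)
    fun U V h s => tangent_ext_of_isLogarithmic fun x hx => ⟨_, _, rfl,
        isLogarithmic_rayVector ρ ((lineBundle (Δ.rayDivisor k ρ)).presheaf.map (homOfLE h).op s)
          ⟨x, hx⟩,
        (isLogarithmic_rayVector ρ s ⟨x, h hx⟩).res h⟩

lemma isLogarithmic_rayField (ρ : Δ.Ray) (s : Γ(lineBundle (Δ.rayDivisor k ρ), U)) (x : U) :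
    IsLogarithmic ((rayField ρ).app U s) (pairingLog ρ.1 (lineBundle.value s x)) :=
  isLogarithmic_rayVector ρ s x

end Tangent

/-! ### The Euler sequence: the map to the tangent sheaf -/

noncomputable instance {N : Type u} [AddCommGroup N] {Δ : SmoothFan N} : Fintype Δ.Ray :=
  Fintype.ofFinite _

open Limits

variable {N : Type u} [AddCommGroup N] [Module.Free ℤ N] {Δ : SmoothFan N} {k : Type u} [Field k]
  {U V : (Δ.toricVariety k).Opens}

lemma sum_π_ι : ∑ ρ : Δ.Ray, biproduct.π (fun ρ : Δ.Ray => lineBundle (Δ.rayDivisor k ρ)) ρ ≫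
    biproduct.ι (fun ρ : Δ.Ray => lineBundle (Δ.rayDivisor k ρ)) ρ = 𝟙 (Δ.rayModule k) := by
  refine biproduct.hom_ext' _ _ fun ρ => ?_
  rw [Preadditive.comp_sum, Category.comp_id, Finset.sum_eq_single ρ,
    biproduct.ι_π_self_assoc]
  · intro ρ' _ h
    rw [biproduct.ι_π_ne_assoc _ h.symm, zero_comp]
  · exact fun h => (h (Finset.mem_univ _)).elim

lemma sum_raySection (t : Γ(Δ.rayModule k, U)) : ∑ ρ, raySection ρ (rayComponent ρ t) = t := by
  have h := congrArg (fun f : Δ.rayModule k ⟶ Δ.rayModule k => f.app U t) sum_π_ι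
  have h2 : (𝟙 (Δ.rayModule k) : Δ.rayModule k ⟶ Δ.rayModule k).app U t = t := rfl
  simp only [modulesHom_sum_app, h2] at h
  exact h

lemma rayComponent_raySection_self (ρ : Δ.Ray) (s : Γ(lineBundle (Δ.rayDivisor k ρ), U)) :
    rayComponent ρ (raySection ρ s) = s :=
  congrArg (fun f : lineBundle (Δ.rayDivisor k ρ) ⟶ lineBundle (Δ.rayDivisor k ρ) => f.app U s)
    (biproduct.ι_π_self (fun ρ : Δ.Ray => lineBundle (Δ.rayDivisor k ρ)) ρ)

lemma rayComponent_raySection_of_ne {ρ ρ' : Δ.Ray} (h : ρ ≠ ρ')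
    (s : Γ(lineBundle (Δ.rayDivisor k ρ), U)) : rayComponent ρ' (raySection ρ s) = 0 :=
  congrArg (fun f : lineBundle (Δ.rayDivisor k ρ) ⟶ lineBundle (Δ.rayDivisor k ρ') => f.app U s)
    (biproduct.ι_π_ne (fun ρ : Δ.Ray => lineBundle (Δ.rayDivisor k ρ)) h)

lemma rayComponent_zero (ρ : Δ.Ray) : rayComponent ρ (0 : Γ(Δ.rayModule k, U)) = 0 := map_zero _

lemma rayComponent_sum {ι : Type*} (ρ : Δ.Ray) (t : Finset ι) (s : ι → Γ(Δ.rayModule k, U)) :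
    rayComponent ρ (∑ i ∈ t, s i) = ∑ i ∈ t, rayComponent ρ (s i) := map_sum _ s t

lemma rayComponent_smul (ρ : Δ.Ray) (r : Γ(Δ.toricVariety k, U)) (s : Γ(Δ.rayModule k, U)) :
    rayComponent ρ (r • s) = r • rayComponent ρ s := Scheme.Modules.Hom.app_smul _ r s

lemma rayComponent_res (ρ : Δ.Ray) (h : V ≤ U) (s : Γ(Δ.rayModule k, U)) :
    rayComponent ρ ((Δ.rayModule k).presheaf.map (homOfLE h).op s) =
      (lineBundle (Δ.rayDivisor k ρ)).presheaf.map (homOfLE h).op (rayComponent ρ s) :=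
  modulesHom_app_res _ h s

lemma rayModule_ext {s t : Γ(Δ.rayModule k, U)}
    (h : ∀ ρ (x : U), lineBundle.value (rayComponent ρ s) x = lineBundle.value (rayComponent ρ t) x) :
    s = t := by
  rw [← sum_raySection s, ← sum_raySection t]
  exact Finset.sum_congr rfl fun ρ _ => congrArg _ (lineBundle.value_ext (h ρ))

variable {M : (Δ.toricVariety k).Modules}

lemma desc_app_raySection (f : ∀ ρ : Δ.Ray, lineBundle (Δ.rayDivisor k ρ) ⟶ M) (ρ : Δ.Ray)
    (s : Γ(lineBundle (Δ.rayDivisor k ρ), U)) :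
    Scheme.Modules.Hom.app (biproduct.desc f) U (raySection ρ s) = (f ρ).app U s :=
  congrArg (fun g : lineBundle (Δ.rayDivisor k ρ) ⟶ M => g.app U s) (biproduct.ι_desc f ρ)

lemma desc_app (f : ∀ ρ : Δ.Ray, lineBundle (Δ.rayDivisor k ρ) ⟶ M) (t : Γ(Δ.rayModule k, U)) :
    Scheme.Modules.Hom.app (biproduct.desc f) U t = ∑ ρ, (f ρ).app U (rayComponent ρ t) := by
  conv_lhs => rw [← sum_raySection t]
  rw [map_sum]
  exact Finset.sum_congr rfl fun ρ _ => desc_app_raySection f ρ _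

lemma rayComponent_lift_app (f : ∀ ρ : Δ.Ray, M ⟶ lineBundle (Δ.rayDivisor k ρ)) (ρ : Δ.Ray)
    (s : Γ(M, U)) :
    rayComponent ρ (Scheme.Modules.Hom.app (biproduct.lift f) U s) = (f ρ).app U s :=
  congrArg (fun g : M ⟶ lineBundle (Δ.rayDivisor k ρ) => g.app U s) (biproduct.lift_π f ρ)

lemma coherentOn_rayModule (σ : Δ.cones) : CoherentOn (Δ.rayModule k) (Δ.chartOpen k σ) := by
  classical
  let e : ∀ ρ : Δ.Ray, Γ(lineBundle (Δ.rayDivisor k ρ), Δ.chartOpen k σ) := fun ρ =>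
    lineBundle.mk (fun _ => ((Δ.charUnit k (Δ.rayForm ρ σ))⁻¹ : ((Δ.toricVariety k).functionField)ˣ))
      (fun _ _ => rfl)
      fun x => (isLocalEquation_rayForm ρ x.2).regularAt_iff.mpr ⟨1, by simp⟩
  have hval : ∀ (V : (Δ.toricVariety k).Opens) (hV : V ≤ Δ.chartOpen k σ)
      (c : Δ.Ray → Γ(Δ.toricVariety k, V)) (ρ : Δ.Ray) (x : V),
      lineBundle.value (rayComponent ρ (∑ ρ', c ρ' •
        (Δ.rayModule k).presheaf.map (homOfLE hV).op (raySection ρ' (e ρ')))) x =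
      rationalFunction x (c ρ) *
        ((Δ.charUnit k (Δ.rayForm ρ σ))⁻¹ : ((Δ.toricVariety k).functionField)ˣ) :=
      fun V hV c ρ x => by
    rw [rayComponent_sum, Finset.sum_eq_single ρ, rayComponent_smul, rayComponent_res,
      rayComponent_raySection_self]
    · rfl
    · intro ρ' _ h
      rw [rayComponent_smul, rayComponent_res, rayComponent_raySection_of_ne h, map_zero, smul_zero]
    · simp
  refine coherentOn_of_frame (isAffineOpen_chartOpen σ) (fun ρ => raySection ρ (e ρ))
    (fun V hV s => ?_) fun V hV c hc ρ => section_ext_rationalFunction fun x => ?_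
  · refine ⟨fun ρ => sectionOfRegular (fun x => lineBundle.value (rayComponent ρ s) x *
      Δ.charUnit k (Δ.rayForm ρ σ)) (fun x y => by rw [lineBundle.value_eq _ x y])
      (fun x => lineBundle.regularAt_value _ x _ (isLocalEquation_rayForm ρ (hV x.2))), ?_⟩
    refine rayModule_ext fun ρ x => ?_
    rw [hval, rationalFunction_sectionOfRegular, Units.mul_inv_cancel_right]
  · have h := hval V hV c ρ x
    rw [hc, rayComponent_zero, lineBundle.value_zero] at h
    rw [rationalFunction_zero]
    exact (mul_eq_zero.mp h.symm).resolve_right (Units.ne_zero _)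

/-- The map `⨁ O_X(D_ρ) → T_X` of the Euler sequence. -/
noncomputable def eulerRight : Δ.rayModule k ⟶ Δ.tangentModule k := biproduct.desc rayField

lemma isLogarithmic_eulerRight (t : Γ(Δ.rayModule k, U)) (x : U) :
    IsLogarithmic (eulerRight.app U t)
      (∑ ρ : Δ.Ray, pairingLog ρ.1 (lineBundle.value (rayComponent ρ t) x)) := by
  rw [eulerRight, desc_app]
  exact IsLogarithmic.sum _ fun ρ _ => isLogarithmic_rayField ρ _ x

lemma isEulerRight_eulerRight : IsEulerRight (eulerRight : Δ.rayModule k ⟶ _) :=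
  fun U V hV ρ s u f hf x => by
    rw [eulerRight, desc_app_raySection, isLogarithmic_rayField ρ s ⟨x.1, hV x.2⟩ V hV f x, hf,
      logDer_charUnit, pairingLog_apply, zsmul_eq_mul]
    ring

end SmoothFan

/-! ### Euler operators on group algebras -/

section EulerOperator

variable {k G : Type*} [Field k] [AddCommGroup G]

/-- The operator `x^g ↦ w(g) x^g` on the group algebra. If `w(g)` is the exponent of `x_ρ` in the
monomial `x^g`, it is `x_ρ ∂/∂x_ρ`. -/
noncomputable def eulerOp (w : G → ℤ) : AddMonoidAlgebra k G →+ AddMonoidAlgebra k G :=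
  AddMonoidAlgebra.liftNC (AddMonoidAlgebra.singleAddHom (0 : G))
    fun g => .single g.toAdd (w g.toAdd : k)

lemma eulerOp_single (w : G → ℤ) (g : G) (c : k) :
    eulerOp w (.single g c) = .single g ((w g : k) * c) := by
  rw [eulerOp, AddMonoidAlgebra.liftNC_single]
  change AddMonoidAlgebra.single 0 c * AddMonoidAlgebra.single g (w g : k) = _
  rw [AddMonoidAlgebra.single_mul_single, zero_add, mul_comm]

lemma eulerOp_single_mul (w : G →+ ℤ) (g : G) (a : AddMonoidAlgebra k G) :
    eulerOp w (.single g 1 * a) = .single g 1 * ((w g : k) • a + eulerOp w a) := by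
  induction a using AddMonoidAlgebra.induction_linear with
  | zero => simp
  | add a b ha hb =>
    rw [mul_add, map_add, ha, hb, smul_add, map_add]
    ring
  | single h c =>
    rw [AddMonoidAlgebra.single_mul_single, eulerOp_single, eulerOp_single,
      AddMonoidAlgebra.smul_single, ← AddMonoidAlgebra.single_add,
      AddMonoidAlgebra.single_mul_single, one_mul, one_mul, map_add, Int.cast_add, add_mul,
      smul_eq_mul]

end EulerOperator

namespace SmoothFan

/-! ### Laurent polynomials in the Cox variables -/

section Laurent

variable {N : Type u} [AddCommGroup N] [Module.Free ℤ N] (Δ : SmoothFan N) (k : Type u) [Field k]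

lemma coxEmbedding_charToFunctionField (hΔ : Δ.IsComplete)
    (a : AddMonoidAlgebra k (Module.Dual ℤ N)) :
    Δ.coxEmbedding k hΔ (Δ.charToFunctionField k a) =
      algebraMap (Δ.LaurentCoxRing k) (Δ.CoxField k) (Δ.charToLaurent k a) := by
  have := Δ.isFractionRing_torus k
  refine (IsFractionRing.lift_algebraMap (Δ.torusToCox_injective k hΔ) _).trans ?_
  change algebraMap _ _ (Δ.charToLaurent k (AddMonoidAlgebra.mapDomain _
    ((RingEquiv.ofBijective _ (Δ.chartSection_bijective k Δ.zeroCone)).symm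
      (RingEquiv.ofBijective _ (Δ.chartSection_bijective k Δ.zeroCone) _)))) = _
  rw [RingEquiv.symm_apply_apply]
  congr 2
  induction a using AddMonoidAlgebra.induction_linear with
  | zero => simp
  | add a b ha hb => rw [map_add, AddMonoidAlgebra.mapDomain_add, ha, hb]
  | single m c =>
    change AddMonoidAlgebra.mapDomain _ (AddMonoidAlgebra.mapDomain _ _) = _
    rw [AddMonoidAlgebra.mapDomain_single, AddMonoidAlgebra.mapDomain_single]
    rfl

variable {Δ k}

lemma charToLaurent_single (m : Module.Dual ℤ N) (c : k) :
    Δ.charToLaurent k (.single m c) = .single (Δ.rayValues m) c :=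
  AddMonoidAlgebra.mapDomain_single

lemma eulerOp_charToLaurent (ρ : Δ.Ray) (a : AddMonoidAlgebra k (Module.Dual ℤ N)) :
    eulerOp (fun b : Δ.Ray → ℤ => b ρ) (Δ.charToLaurent k a) =
      Δ.charToLaurent k (eulerOp (fun m => m ρ.1) a) := by
  induction a using AddMonoidAlgebra.induction_linear with
  | zero => simp
  | add a b ha hb => simp only [map_add, ha, hb]
  | single m c =>
    rw [charToLaurent_single, eulerOp_single, eulerOp_single, charToLaurent_single]
    rfl

lemma charToFunctionField_eulerOp (v : N) (a : AddMonoidAlgebra k (Module.Dual ℤ N)) :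
    Δ.charToFunctionField k (eulerOp (fun m => m v) a) =
      Δ.logDer (pairingLog v 1) (Δ.charToFunctionField k a) := by
  induction a using AddMonoidAlgebra.induction_linear with
  | zero => simp
  | add a b ha hb => simp only [map_add, ha, hb]
  | single m c =>
    rw [eulerOp_single, logDer_char, pairingLog_apply, one_mul, charToFunctionField_single,
      charToFunctionField_single, map_mul, map_intCast, mul_assoc]

lemma coxToLaurent_monomial (m : Δ.Ray →₀ ℕ) (c : k) :
    Δ.coxToLaurent k (MvPolynomial.monomial m c) = .single (fun ρ => (m ρ : ℤ)) c := by
  classical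
  rw [coxToLaurent, MvPolynomial.aeval_monomial, Finsupp.prod]
  simp only [AddMonoidAlgebra.single_pow, one_pow]
  rw [AddMonoidAlgebra.prod_single]
  change AddMonoidAlgebra.single 0 c * _ = _
  rw [AddMonoidAlgebra.single_mul_single, zero_add, Finset.prod_const_one, mul_one]
  congr 1
  funext ρ
  rw [Finset.sum_apply, Finset.sum_eq_single ρ]
  · simp
  · intro ρ' _ h
    simp [h.symm]
  · intro h
    simp [Finsupp.notMem_support_iff.mp h]

lemma coxToLaurent_X_mul_pderiv (ρ : Δ.Ray) (F : Δ.CoxRing k) :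
    Δ.coxToLaurent k (MvPolynomial.X ρ * MvPolynomial.pderiv ρ F) =
      eulerOp (fun b : Δ.Ray → ℤ => b ρ) (Δ.coxToLaurent k F) := by
  induction F using MvPolynomial.induction_on' with
  | monomial m c =>
    rw [MvPolynomial.X_mul_pderiv_monomial, map_nsmul, coxToLaurent_monomial, eulerOp_single,
      AddMonoidAlgebra.smul_single, nsmul_eq_mul, Int.cast_natCast]
  | add F G hF hG => simp only [map_add, mul_add, hF, hG]

/-- Euler's formula for gradings by an arbitrary abelian group. -/
lemma sum_mul_eulerOp {A : Type*} [AddCommGroup A] {w : Δ.Ray → A} {β : A} {F : Δ.CoxRing k}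
    (hF : F.IsWeightedHomogeneous w β) (φ : A →+ ℤ) :
    ∑ ρ, φ (w ρ) • eulerOp (fun b : Δ.Ray → ℤ => b ρ) (Δ.coxToLaurent k F) =
      φ β • Δ.coxToLaurent k F := by
  have h : ∀ m ∈ F.support, ∀ c : k,
      ∑ ρ, φ (w ρ) • eulerOp (fun b : Δ.Ray → ℤ => b ρ)
        (Δ.coxToLaurent k (MvPolynomial.monomial m c)) =
      φ β • Δ.coxToLaurent k (MvPolynomial.monomial m c) := fun m hm c => by
    have hw : β = ∑ ρ, m ρ • w ρ := by
      rw [← hF (MvPolynomial.mem_support_iff.mp hm), Finsupp.weight_apply,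
        Finsupp.sum_fintype _ _ (by simp)]
    simp only [coxToLaurent_monomial, eulerOp_single, AddMonoidAlgebra.smul_single]
    refine (map_sum (AddMonoidAlgebra.singleAddHom (fun ρ => (m ρ : ℤ))) _ _).symm.trans ?_
    refine congrArg (AddMonoidAlgebra.single _) ?_
    rw [hw, map_sum, Finset.sum_smul]
    refine Finset.sum_congr rfl fun ρ _ => ?_
    rw [map_nsmul, nsmul_eq_mul, zsmul_eq_mul, zsmul_eq_mul, Int.cast_mul, Int.cast_natCast]
    ring
  rw [F.as_sum]
  simp only [map_sum, Finset.smul_sum]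
  rw [Finset.sum_comm]
  refine Finset.sum_congr rfl fun m hm => ?_
  simpa only [Finset.smul_sum] using h m hm _

end Laurent

/-! ### The derivatives of the equation of a divisor -/

section Jacobian

variable {N : Type u} [AddCommGroup N] [Module.Free ℤ N] {Δ : SmoothFan N} {k : Type u} [Field k]
  {U V : (Δ.toricVariety k).Opens} {F : Δ.CoxRing k} {D : CartierDivisor (Δ.toricVariety k)}

/-- `F` on the chart `U_σ`: it is `x^b f`, where `f` is a Laurent polynomial in the characters, and
`b` vanishes on `σ`. -/
structure ChartEquation (F : Δ.CoxRing k) (σ : Δ.cones) where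
  b : Δ.Ray → ℤ
  f : AddMonoidAlgebra k (Module.Dual ℤ N)
  ne_zero : Δ.charToFunctionField k f ≠ 0
  b_eq_zero : ∀ ρ : Δ.Ray, ρ.1 ∈ σ.1 → b ρ = 0
  eq : Δ.coxToLaurent k F = .single b 1 * Δ.charToLaurent k f

lemma IsZeroDivisor.exists_chartEquation (hD : Δ.IsZeroDivisor F D) (σ : Δ.cones) :
    ∃ E : ChartEquation F σ, ∀ x ∈ Δ.chartOpen k σ, D.IsLocalEquation x (Units.mk0 _ E.ne_zero) := by
  obtain ⟨b, f, hf, hb, h, hx⟩ := hD σ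
  exact ⟨⟨b, f, hf, hb, h⟩, hx⟩

namespace ChartEquation

variable {σ τ : Δ.cones}

lemma coxElement_eq (hΔ : Δ.IsComplete) (E : ChartEquation F σ) :
    Δ.coxElement F = algebraMap (Δ.LaurentCoxRing k) (Δ.CoxField k) (.single E.b 1) *
      Δ.coxEmbedding k hΔ (Δ.charToFunctionField k E.f) := by
  rw [coxElement, E.eq, map_mul, coxEmbedding_charToFunctionField]

lemma coxElement_ne_zero (hΔ : Δ.IsComplete) (E : ChartEquation F σ) : Δ.coxElement F ≠ 0 := by
  rw [E.coxElement_eq hΔ]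
  refine mul_ne_zero ?_ ((map_ne_zero _).mpr E.ne_zero)
  exact (map_ne_zero_iff _ (IsFractionRing.injective _ _)).mpr
    (AddMonoidAlgebra.single_ne_zero.mpr one_ne_zero)

/-- `x_ρ (∂F/∂x_ρ) / F` as a rational function on `X`. -/
noncomputable def logCoeff (E : ChartEquation F σ) (ρ : Δ.Ray) : (Δ.toricVariety k).functionField :=
  E.b ρ + Δ.logDer (pairingLog ρ.1 1) (Δ.charToFunctionField k E.f) / Δ.charToFunctionField k E.f

lemma logCoeff_mul (E : ChartEquation F σ) (ρ : Δ.Ray) :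
    E.logCoeff ρ * Δ.charToFunctionField k E.f =
      E.b ρ * Δ.charToFunctionField k E.f +
        Δ.logDer (pairingLog ρ.1 1) (Δ.charToFunctionField k E.f) := by
  rw [logCoeff, add_mul, div_mul_cancel₀ _ E.ne_zero]

lemma coxEmbedding_logCoeff (hΔ : Δ.IsComplete) (E : ChartEquation F σ) (ρ : Δ.Ray) :
    Δ.coxEmbedding k hΔ (E.logCoeff ρ) * Δ.coxElement F =
      Δ.coxElement (MvPolynomial.X ρ * MvPolynomial.pderiv ρ F) := by
  have h1 := eulerOp_single_mul (k := k) (Pi.evalAddMonoidHom (fun _ : Δ.Ray => ℤ) ρ) E.b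
    (Δ.charToLaurent k E.f)
  have h2 : Δ.coxElement (MvPolynomial.X ρ * MvPolynomial.pderiv ρ F) =
      algebraMap (Δ.LaurentCoxRing k) (Δ.CoxField k) (.single E.b 1) *
        Δ.coxEmbedding k hΔ (E.b ρ * Δ.charToFunctionField k E.f +
          Δ.logDer (pairingLog ρ.1 1) (Δ.charToFunctionField k E.f)) := by
    rw [coxElement, coxToLaurent_X_mul_pderiv, E.eq, ← charToFunctionField_eulerOp,
      map_add (Δ.coxEmbedding k hΔ), map_mul (Δ.coxEmbedding k hΔ), map_intCast,
      coxEmbedding_charToFunctionField, coxEmbedding_charToFunctionField,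
      ← eulerOp_charToLaurent, ← map_intCast (algebraMap (Δ.LaurentCoxRing k) (Δ.CoxField k)),
      ← map_mul, ← map_add, ← map_mul]
    refine congrArg _ (h1.trans ?_)
    rw [Int.cast_smul_eq_zsmul, zsmul_eq_mul]
    rfl
  rw [h2, ← logCoeff_mul, map_mul, E.coxElement_eq hΔ]
  ring

lemma logCoeff_eq (hΔ : Δ.IsComplete) (E : ChartEquation F σ) (E' : ChartEquation F τ)
    (ρ : Δ.Ray) : E.logCoeff ρ = E'.logCoeff ρ := by
  refine (Δ.coxEmbedding k hΔ).injective ?_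
  refine mul_right_cancel₀ (E.coxElement_ne_zero hΔ) ?_
  rw [coxEmbedding_logCoeff, coxEmbedding_logCoeff]

lemma sum_logCoeff (hΔ : Δ.IsComplete) (E : ChartEquation F σ) {A : Type*} [AddCommGroup A]
    {w : Δ.Ray → A} {β : A} (hF : F.IsWeightedHomogeneous w β) (φ : A →+ ℤ) :
    ∑ ρ, (φ (w ρ) : (Δ.toricVariety k).functionField) * E.logCoeff ρ = φ β := by
  refine (Δ.coxEmbedding k hΔ).injective ?_
  refine mul_right_cancel₀ (E.coxElement_ne_zero hΔ) ?_
  have h := congrArg (algebraMap (Δ.LaurentCoxRing k) (Δ.CoxField k)) (sum_mul_eulerOp hF φ)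
  rw [map_sum, Finset.sum_mul, map_intCast, coxElement, ← zsmul_eq_mul, ← map_zsmul, ← h, map_sum]
  refine Finset.sum_congr rfl fun ρ _ => ?_
  rw [map_mul, map_intCast, mul_assoc]
  refine (congrArg _ (E.coxEmbedding_logCoeff hΔ ρ)).trans ?_
  rw [coxElement, coxToLaurent_X_mul_pderiv, map_zsmul, zsmul_eq_mul]

/-- The equation of `F` is regular on `U_σ`, because the exponents in `F` are nonnegative. -/
lemma mem (hΔ : Δ.IsComplete) (E : ChartEquation F σ) {x : Δ.toricVariety k}
    (hx : x ∈ Δ.chartOpen k σ) : Δ.charToFunctionField k E.f ∈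
      (algebraMap ((Δ.toricVariety k).presheaf.stalk x) (Δ.toricVariety k).functionField).range := by
  have hnn : ∀ b : Δ.Ray → ℤ, (Δ.coxToLaurent k F).coeff b ≠ 0 → ∀ ρ, 0 ≤ b ρ := by
    classical
    intro b hb ρ
    rw [F.as_sum, map_sum, AddMonoidAlgebra.coeff_sum, Finsupp.finsetSum_apply] at hb
    obtain ⟨m, -, hm⟩ := Finset.exists_ne_zero_of_sum_ne_zero hb
    rw [coxToLaurent_monomial, AddMonoidAlgebra.coeff_single, Finsupp.single_apply] at hm
    have h := (ite_ne_right_iff.mp hm).1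
    rw [← h]
    exact Int.natCast_nonneg _
  have hco : ∀ m, (Δ.coxToLaurent k F).coeff (E.b + Δ.rayValues m) = E.f.coeff m := fun m => by
    rw [E.eq, AddMonoidAlgebra.coeff_single_mul_apply, one_mul, neg_add_cancel_left]
    exact Finsupp.mapDomain_apply (Δ.rayValues_injective hΔ) _ _
  rw [← AddMonoidAlgebra.sum_coeff_single E.f, Finsupp.sum, map_sum]
  refine sum_mem fun m hm => ?_
  rw [charToFunctionField_single]
  refine mul_mem (constFunction_mem x _) (charUnit_mem hx fun v hv => ?_)
  let ρ : Δ.Ray := ⟨v, Δ.face_mem _ σ.2 _ (Set.singleton_subset_iff.mpr hv)⟩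
  have h := hnn _ (by rw [hco]; exact Finsupp.mem_support_iff.mp hm) ρ
  rw [Pi.add_apply, E.b_eq_zero ρ hv, zero_add] at h
  exact h

/-- `x_ρ ∂/∂x_ρ` followed by a section of `O_X(D_ρ)` sends the equation of `D` to a regular
function. -/
lemma logCoeff_mem (hΔ : Δ.IsComplete) (E : ChartEquation F σ) {x : Δ.toricVariety k}
    (hx : x ∈ Δ.chartOpen k σ) (ρ : Δ.Ray) {s : (Δ.toricVariety k).functionField}
    (hs : (Δ.rayDivisor k ρ).RegularAt x s) : s * E.b ρ ∈
      (algebraMap ((Δ.toricVariety k).presheaf.stalk x) (Δ.toricVariety k).functionField).range ∧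
    s * E.logCoeff ρ * Δ.charToFunctionField k E.f ∈
      (algebraMap ((Δ.toricVariety k).presheaf.stalk x) (Δ.toricVariety k).functionField).range := by
  have h1 : s * E.b ρ ∈ (algebraMap ((Δ.toricVariety k).presheaf.stalk x)
      (Δ.toricVariety k).functionField).range := by
    by_cases hρ : ρ.1 ∈ σ.1
    · rw [E.b_eq_zero ρ hρ, Int.cast_zero, mul_zero]
      exact zero_mem _
    · exact mul_mem (mem_of_regularAt_rayDivisor hρ hx hs) (intCast_mem _ _)
  refine ⟨h1, ?_⟩
  rw [mul_assoc, logCoeff_mul, mul_add, ← mul_assoc, ← logDer_pairingLog]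
  exact add_mem (mul_mem h1 (E.mem hΔ hx))
    (logDer_mem hx _ (fun m hm => ray_mul_mem hx hs hm) (E.mem hΔ hx))

end ChartEquation

lemma IsZeroDivisor.isEffective (hΔ : Δ.IsComplete) (hD : Δ.IsZeroDivisor F D) : D.IsEffective :=
  fun x => by
    obtain ⟨σ, hx⟩ := Δ.iSup_chartOpen k x
    obtain ⟨E, hE⟩ := hD.exists_chartEquation σ
    refine (hE x hx).regularAt_iff.mpr ?_
    rw [one_mul]
    exact E.mem hΔ hx

/-- The rational function `x_ρ (∂F/∂x_ρ) / F`. -/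
noncomputable def logPartial (hD : Δ.IsZeroDivisor F D) (ρ : Δ.Ray) :
    (Δ.toricVariety k).functionField :=
  (hD.exists_chartEquation Δ.zeroCone).choose.logCoeff ρ

lemma logPartial_eq (hΔ : Δ.IsComplete) (hD : Δ.IsZeroDivisor F D) (ρ : Δ.Ray) {σ : Δ.cones}
    (E : ChartEquation F σ) : logPartial hD ρ = E.logCoeff ρ :=
  ChartEquation.logCoeff_eq hΔ _ E ρ

lemma regularAt_mul_logPartial (hΔ : Δ.IsComplete) (hD : Δ.IsZeroDivisor F D) (ρ : Δ.Ray)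
    (x : Δ.toricVariety k) (s : (Δ.toricVariety k).functionField)
    (hs : (Δ.rayDivisor k ρ).RegularAt x s) : D.RegularAt x (s * logPartial hD ρ) := by
  obtain ⟨σ, hx⟩ := Δ.iSup_chartOpen k x
  obtain ⟨E, hE⟩ := hD.exists_chartEquation σ
  rw [logPartial_eq hΔ hD ρ E]
  exact (hE x hx).regularAt_iff.mpr (E.logCoeff_mem hΔ hx ρ hs).2

open Limits

/-- The map `⨁ O_X(D_ρ) → O_X(D)` with components `∂F/∂x_ρ`. -/
noncomputable def jacobianMap (hΔ : Δ.IsComplete) (hD : Δ.IsZeroDivisor F D) :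
    Δ.rayModule k ⟶ lineBundle D :=
  biproduct.desc fun ρ => lineBundleMul _ D (logPartial hD ρ) (regularAt_mul_logPartial hΔ hD ρ)

lemma value_jacobianMap (hΔ : Δ.IsComplete) (hD : Δ.IsZeroDivisor F D) (t : Γ(Δ.rayModule k, U))
    (x : U) : lineBundle.value ((jacobianMap hΔ hD).app U t) x =
      ∑ ρ, lineBundle.value (rayComponent ρ t) x * logPartial hD ρ := by
  rw [jacobianMap, desc_app, lineBundle.value_sum]
  rfl

lemma isJacobianMap_jacobianMap (hΔ : Δ.IsComplete) (hD : Δ.IsZeroDivisor F D) :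
    IsJacobianMap hΔ F (jacobianMap hΔ hD) := fun U ρ s x => by
  rw [jacobianMap, desc_app_raySection, homogenize, homogenize, value_lineBundleMul, map_mul,
    mul_assoc, logPartial, ChartEquation.coxEmbedding_logCoeff, coxElement, map_mul, map_mul,
    mul_assoc]
  rfl

lemma isMulBy_effectiveInclusion (hΔ : Δ.IsComplete) (hE : D.IsEffective) :
    IsMulBy hΔ F (effectiveInclusion hE) :=
  fun U g x => by rw [homogenize, value_effectiveInclusion]

/-- For a local equation `f` of `D` and a multiple `f a` of it, `x_ρ ∂(f a)/∂x_ρ - (x_ρ ∂F/∂x_ρ / F) f a`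
is again a multiple of `f`: the terms with the derivatives of `f` cancel. -/
lemma regularAt_neg_logDer_sub (hΔ : Δ.IsComplete) (hD : Δ.IsZeroDivisor F D) (ρ : Δ.Ray)
    (x : Δ.toricVariety k) {s t : (Δ.toricVariety k).functionField}
    (hs : (Δ.rayDivisor k ρ).RegularAt x s) (ht : (-D).RegularAt x t) :
    (-D).RegularAt x (Δ.logDer (pairingLog ρ.1 s) t - s * logPartial hD ρ * t) := by
  obtain ⟨σ, hx⟩ := Δ.iSup_chartOpen k x
  obtain ⟨E, hE⟩ := hD.exists_chartEquation σ
  set f := Δ.charToFunctionField k E.f with hf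
  have hne : f ≠ 0 := E.ne_zero
  have h1 := ht _ (hE x hx).neg
  set a := t * ((Units.mk0 _ E.ne_zero)⁻¹ : ((Δ.toricVariety k).functionField)ˣ) with ha
  have hta : t = f * a := by
    rw [ha, mul_left_comm]
    exact (mul_one t).symm.trans (congrArg _ (Units.mul_inv (Units.mk0 _ E.ne_zero)).symm)
  refine (hE x hx).neg.regularAt_iff.mpr ?_
  have h2 : (Δ.logDer (pairingLog ρ.1 s) t - s * logPartial hD ρ * t) *
      ((Units.mk0 _ E.ne_zero)⁻¹ : ((Δ.toricVariety k).functionField)ˣ) =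
      Δ.logDer (pairingLog ρ.1 s) a - s * E.b ρ * a := by
    have h3 := E.logCoeff_mul ρ
    rw [logPartial_eq hΔ hD ρ E, hta, Derivation.leibniz, smul_eq_mul, smul_eq_mul,
      logDer_pairingLog _ s f, Units.val_inv_eq_inv_val, ← div_eq_mul_inv]
    refine (div_eq_iff hne).mpr ?_
    linear_combination -(s * a) * h3
  rw [h2]
  exact sub_mem (logDer_mem hx _ (fun m hm => ray_mul_mem hx hs hm) h1)
    (mul_mem (E.logCoeff_mem hΔ hx ρ hs).1 h1)

lemma eulerRight_normalDerivative (hΔ : Δ.IsComplete) (hD : Δ.IsZeroDivisor F D)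
    (hE : D.IsEffective) :
    eulerRight ≫ normalDerivative (Δ.structureMorphism k) hE =
      jacobianMap hΔ hD ≫ normalRestriction D := by
  refine biproduct.hom_ext' _ _ fun ρ => ?_
  rw [eulerRight, jacobianMap, biproduct.ι_desc_assoc, biproduct.ι_desc_assoc]
  refine modulesHom_ext fun U s => internalHom.ext_apply fun V hV t => ?_
  refine (apply_normalDerivative (Δ.structureMorphism k) hE hV _ t).trans
    (Eq.trans ?_ (apply_normalRestriction hV _ t).symm)
  refine (restrictToDivisor_eq_iff _ _).mpr fun x => ?_
  change (-D).RegularAt x.1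
    (rationalFunction x (tangentSheaf.apply ((rayField ρ).app U s) hV (idealSection hE t)) -
      rationalFunction x (lineBundlePairing hV ((lineBundleMul (Δ.rayDivisor k ρ) D
        (logPartial hD ρ) (regularAt_mul_logPartial hΔ hD ρ)).app U s) t))
  rw [isLogarithmic_rayField ρ s ⟨x.1, hV x.2⟩ V hV _ x, rationalFunction_idealSection,
    rationalFunction_lineBundlePairing, value_lineBundleMul]
  exact regularAt_neg_logDer_sub hΔ hD ρ x.1
    (lineBundle.regularAt_value s ⟨x.1, hV x.2⟩) (lineBundle.regularAt_value t x)

end Jacobian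

/-! ### The maps from `N_1(X) ⊗ O_X` -/

section EulerLeft

open Limits

variable {N : Type u} [AddCommGroup N] [Module.Free ℤ N] {Δ : SmoothFan N} {k : Type u} [Field k]
  {U V : (Δ.toricVariety k).Opens} {F : Δ.CoxRing k} {D : CartierDivisor (Δ.toricVariety k)}

/-- The map `N_1(X) ⊗ O_X → O_X`, `φ ⊗ g ↦ φ(β) g`. -/
noncomputable def degreeMap (β : Pic (Δ.toricVariety k)) :
    Δ.curveModule k ⟶ structureModule (Δ.toricVariety k) :=
  constantTensor.eval (AddMonoidHom.eval β)

lemma isDegreeMap_degreeMap (β : Pic (Δ.toricVariety k)) : IsDegreeMap β (degreeMap β) :=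
  fun _ g φ => constantTensor.evalSection_tmul (AddMonoidHom.eval β) g φ

/-- The map `N_1(X) ⊗ O_X → ⨁ O_X(D_ρ)` of the Euler sequence. -/
noncomputable def eulerLeft : Δ.curveModule k ⟶ Δ.rayModule k :=
  biproduct.lift fun ρ => degreeMap (Δ.rayClass k ρ) ≫ effectiveInclusion (isEffective_rayDivisor ρ)

lemma value_rayComponent_eulerLeft (ρ : Δ.Ray) (s : Γ(Δ.curveModule k, U)) (x : U) :
    lineBundle.value (rayComponent ρ (eulerLeft.app U s)) x =
      rationalFunction x (constantTensor.evalSection (AddMonoidHom.eval (Δ.rayClass k ρ)) s) := by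
  rw [eulerLeft, rayComponent_lift_app]
  rfl

lemma isEulerLeft_eulerLeft (hΔ : Δ.IsComplete) :
    IsEulerLeft hΔ (eulerLeft : Δ.curveModule k ⟶ Δ.rayModule k) := fun U g φ ρ x => by
  rw [homogenize, value_rayComponent_eulerLeft, constantTensor.evalSection_tmul,
    rationalFunction_zsmul, map_zsmul, smul_mul_assoc]
  rfl

lemma eulerLeft_jacobianMap (hΔ : Δ.IsComplete) (hD : Δ.IsZeroDivisor F D) (hE : D.IsEffective)
    {β : Pic (Δ.toricVariety k)} (hF : F.IsWeightedHomogeneous (fun ρ => Δ.rayClass k ρ) β) :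
    eulerLeft ≫ jacobianMap hΔ hD = degreeMap β ≫ effectiveInclusion hE := by
  refine modulesHom_ext fun U s => lineBundle.value_ext fun x => ?_
  refine (value_jacobianMap hΔ hD _ x).trans ?_
  refine Eq.trans ?_ (value_effectiveInclusion hE _ x).symm
  refine (Finset.sum_congr rfl fun ρ _ => congrArg (· * logPartial hD ρ)
    (value_rayComponent_eulerLeft ρ s x)).trans ?_
  simp only [constantTensor.rationalFunction_evalSection, constantTensor.evalValue]
  refine Eq.trans ?_ (constantTensor.rationalFunction_evalSection _ s x).symm
  rw [constantTensor.evalValue]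
  generalize constantTensor.germ s x = t
  induction t with
  | zero => simp
  | add a b ha hb => simp only [map_add, add_mul, Finset.sum_add_distrib, ha, hb]
  | tmul g φ =>
    simp only [constantTensor.evalAux_tmul, zsmul_eq_mul, map_mul, map_intCast]
    have h := ChartEquation.sum_logCoeff hΔ (hD.exists_chartEquation Δ.zeroCone).choose hF φ
    change _ = ((φ β : ℤ) : (Δ.toricVariety k).functionField) * _
    rw [← h, Finset.sum_mul]
    exact Finset.sum_congr rfl fun ρ _ => mul_right_comm _ _ _

end EulerLeft

end SmoothFan

/-! ### Units of group algebras -/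

section Units

/-- Units of the group algebra are monomials: if the supports of `a` and `b` are not both singletons,
by `TwoUniqueSums` two of the products of their monomials cannot cancel, so `a * b` is not a monomial. -/
lemma AddMonoidAlgebra.exists_single_of_mul_eq_one {k G : Type*} [Field k] [AddCommGroup G]
    [TwoUniqueSums G] {a b : AddMonoidAlgebra k G} (hab : a * b = 1) :
    ∃ (g : G) (c : k), c ≠ 0 ∧ a = .single g c := by
  classical
  have ha : a ≠ 0 := left_ne_zero_of_mul_eq_one hab
  have hb : b ≠ 0 := right_ne_zero_of_mul_eq_one hab
  have ha' : 0 < a.coeff.support.card := Finset.card_pos.mpr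
    (Finsupp.support_nonempty_iff.mpr fun h => ha (AddMonoidAlgebra.coeff_eq_zero.mp h))
  have hb' : 0 < b.coeff.support.card := Finset.card_pos.mpr
    (Finsupp.support_nonempty_iff.mpr fun h => hb (AddMonoidAlgebra.coeff_eq_zero.mp h))
  have hcard : a.coeff.support.card * b.coeff.support.card ≤ 1 := by
    by_contra! h
    obtain ⟨p, hp, q, hq, hpq, hup, huq⟩ := TwoUniqueSums.uniqueAdd_of_one_lt_card h
    -- A sum that is represented only once occurs in `a * b = 1`, so it is zero.
    have key : ∀ p : G × G, p ∈ a.coeff.support ×ˢ b.coeff.support →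
        UniqueAdd a.coeff.support b.coeff.support p.1 p.2 → p.1 + p.2 = 0 := fun p hp hu => by
      have h1 := AddMonoidAlgebra.coeff_mul_add_of_uniqueAdd hu
      rw [hab, AddMonoidAlgebra.one_def, AddMonoidAlgebra.coeff_single, Finsupp.single_apply] at h1
      by_contra h0
      rw [if_neg (Ne.symm h0)] at h1
      rw [Finset.mem_product, Finsupp.mem_support_iff, Finsupp.mem_support_iff] at hp
      exact mul_ne_zero hp.1 hp.2 h1.symm
    have h2 := hup (Finset.mem_product.mp hq).1 (Finset.mem_product.mp hq).2
      ((key q hq huq).trans (key p hp hup).symm)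
    exact hpq (Prod.ext h2.1.symm h2.2.symm)
  have h1 : a.coeff.support.card = 1 := by nlinarith
  obtain ⟨g, c, hc, h⟩ := Finsupp.card_support_eq_one'.mp h1
  exact ⟨g, c, hc, AddMonoidAlgebra.coeff_injective h⟩

instance {N : Type*} [AddCommGroup N] : TwoUniqueSums (Module.Dual ℤ N) :=
  TwoUniqueSums.of_injective_addHom
    (AddMonoidHom.mk' (fun (m : Module.Dual ℤ N) (v : N) => m v) fun _ _ => rfl).toAddHom
    DFunLike.coe_injective inferInstance

end Units

/-! ### Cartier divisors on factorial affine schemes -/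

section Factorial

variable {X : Scheme.{u}} [IsIntegral X] {U : X.Opens} [Nonempty U]

lemma algebraMap_functionField (x : U) (g : Γ(X, U)) :
    algebraMap Γ(X, U) X.functionField g = rationalFunction x g :=
  (Scheme.algebraMap_germ_eq_germToFunctionField _ _ _).symm

lemma exists_algebraMap_eq {r : X.functionField}
    (hr : ∀ x ∈ U, r ∈ (algebraMap (X.presheaf.stalk x) X.functionField).range) :
    ∃ g : Γ(X, U), algebraMap Γ(X, U) X.functionField g = r := by
  obtain ⟨x⟩ : Nonempty U := inferInstance
  refine ⟨sectionOfRegular (fun _ => r) (fun _ _ => rfl) fun x => hr x.1 x.2, ?_⟩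
  exact (algebraMap_functionField x _).trans (rationalFunction_sectionOfRegular _ _ _ x)

/-- The rational functions on `X` that are sections of `O_X(D)` over `U`. -/
noncomputable def regularSubmodule (D : CartierDivisor X) (U : X.Opens) [Nonempty U] :
    Submodule Γ(X, U) X.functionField where
  carrier := {r | ∀ x ∈ U, D.RegularAt x r}
  zero_mem' := fun x _ f _ => by simp
  add_mem' := fun ha hb x hx => (ha x hx).add (hb x hx)
  smul_mem' := fun c r hr x hx => by
    have h := (hr x hx).mul (rationalFunction_mem ⟨x, hx⟩ c)
    rwa [← algebraMap_functionField, ← Algebra.smul_def] at h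

/-- `O(-D)` and `O(D)` are inverse fractional ideals on affine open sets. -/
lemma regularSubmodule_neg_mul (hU : IsAffineOpen U) (D : CartierDivisor X) :
    regularSubmodule (-D) U * regularSubmodule D U = 1 := by
  refine le_antisymm (Submodule.mul_le.mpr fun r hr s hs => ?_) (Submodule.one_le.mpr ?_)
  · refine Submodule.mem_one.mpr (exists_algebraMap_eq fun x hx => ?_)
    rw [mul_comm]
    exact (hs x hx).mul_neg (hr x hx)
  · let I : Ideal Γ(X, U) :=
      (regularSubmodule (-D) U * regularSubmodule D U).comap (Algebra.linearMap Γ(X, U) _)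
    -- Where `f` is an equation of `D` and `h` vanishes outside, `h^(n+m) = (h^n f) (h^m f⁻¹)` lies in
    -- the product; such functions `h` generate the unit ideal.
    have hI : I = ⊤ := by
      rw [← Ideal.radical_eq_top, ← I.radical.span_eq, ← hU.iSup_basicOpen_eq_self_iff]
      refine le_antisymm (iSup_le fun h => X.basicOpen_le _) fun x hx => ?_
      obtain ⟨W, f, -, hWU, hxW, hf⟩ := D.exists_affine_isLocalEquation hx
      obtain ⟨h, hhW, hxh⟩ := hU.exists_basicOpen_le (V := W) ⟨x, hxW⟩ hx
      obtain ⟨n, hn⟩ := (-D).exists_pow_mul_regularAt hU h f fun y hy =>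
        (hf y (hhW hy)).neg.regularAt_iff.mpr ⟨1, by simp⟩
      obtain ⟨m, hm⟩ := D.exists_pow_mul_regularAt hU h (f⁻¹ : (X.functionField)ˣ) fun y hy =>
        (hf y (hhW hy)).regularAt_iff.mpr ⟨1, by simp⟩
      have hh : h ∈ I.radical := by
        refine ⟨n + m, ?_⟩
        have h1 := Submodule.mul_mem_mul (M := regularSubmodule (-D) U)
          (N := regularSubmodule D U) (m := rationalFunction ⟨x, hx⟩ h ^ n * f)
          (n := rationalFunction ⟨x, hx⟩ h ^ m * (f⁻¹ : (X.functionField)ˣ))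
          (fun y hy => rationalFunction_eq ⟨y, hy⟩ ⟨x, hx⟩ h ▸ hn ⟨y, hy⟩)
          (fun y hy => rationalFunction_eq ⟨y, hy⟩ ⟨x, hx⟩ h ▸ hm ⟨y, hy⟩)
        rw [mul_mul_mul_comm, Units.mul_inv, mul_one, ← pow_add, ← algebraMap_functionField,
          ← map_pow] at h1
        exact h1
      exact Opens.mem_iSup.mpr ⟨⟨h, hh⟩, hxh⟩
    have h1 : (1 : Γ(X, U)) ∈ I := hI ▸ Submodule.mem_top
    simpa [I] using h1

/-- A Cartier divisor on an affine open set with factorial coordinate ring is given by one equation,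
because the invertible fractional ideals of a factorial ring are principal. -/
lemma CartierDivisor.exists_equation_of_factorial (hU : IsAffineOpen U)
    (hfac : UniqueFactorizationMonoid Γ(X, U)) (D : CartierDivisor X) :
    ∃ g : (X.functionField)ˣ, ∀ x ∈ U, D.IsLocalEquation x g := by
  have : IsGCDMonoid Γ(X, U) := ⟨UniqueFactorizationMonoid.toGCDMonoid _⟩
  have h1 := regularSubmodule_neg_mul hU D
  let J : (Submodule Γ(X, U) X.functionField)ˣ := ⟨_, _, h1, (mul_comm _ _).trans h1⟩
  have : FaithfulSMul Γ(X, U) X.functionField :=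
    (faithfulSMul_iff_algebraMap_injective _ _).mpr (X.germToFunctionField_injective U)
  have hJ : J ∈ (Submodule.unitsToPic Γ(X, U) X.functionField).ker := Subsingleton.elim _ _
  rw [Submodule.ker_unitsToPic] at hJ
  obtain ⟨g, hg⟩ := hJ
  have hgJ : Submodule.span Γ(X, U) {(g : X.functionField)} = regularSubmodule (-D) U :=
    congrArg Units.val hg
  -- `O(-D)` is generated by `g` over `U`, and near `x` it is generated by `f`; up to a power of a
  -- function `h` with `h x ≠ 0` the two generators divide each other.
  refine ⟨g, fun x hx => ?_⟩
  obtain ⟨W, f, -, hWU, hxW, hf⟩ := D.exists_affine_isLocalEquation hx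
  obtain ⟨h, hhW, hxh⟩ := hU.exists_basicOpen_le (V := W) ⟨x, hxW⟩ hx
  obtain ⟨n, hn⟩ := (-D).exists_pow_mul_regularAt hU h f fun y hy =>
    (hf y (hhW hy)).neg.regularAt_iff.mpr ⟨1, by simp⟩
  have hgr : (g : X.functionField) ∈ regularSubmodule (-D) U :=
    hgJ ▸ Submodule.mem_span_singleton_self _
  obtain ⟨a, ha⟩ := hgr x hx _ (hf x hxW).neg
  have hfr : rationalFunction ⟨x, hx⟩ h ^ n * f ∈ regularSubmodule (-D) U :=
    fun y hy => rationalFunction_eq ⟨y, hy⟩ ⟨x, hx⟩ h ▸ hn ⟨y, hy⟩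
  rw [← hgJ] at hfr
  obtain ⟨c, hc⟩ := Submodule.mem_span_singleton.mp hfr
  rw [Algebra.smul_def, algebraMap_functionField ⟨x, hx⟩] at hc
  have hu : IsUnit (X.presheaf.germ U x hx h) := (X.mem_basicOpen h x hx).mp hxh
  have hau : IsUnit a := by
    refine isUnit_of_dvd_unit ?_ (hu.pow n)
    refine ⟨X.presheaf.germ U x hx c, algebraMap_stalk_injective x ?_⟩
    rw [map_mul, map_pow, ha]
    change rationalFunction ⟨x, hx⟩ h ^ n = _ * rationalFunction ⟨x, hx⟩ c
    rw [mul_right_comm, mul_comm (g : X.functionField), hc, mul_assoc, Units.mul_inv, mul_one]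
  refine (isLocalEquation_iff (hf x hxW)).mpr ⟨hau.unit, Units.ext ?_⟩
  refine ha.trans ?_
  rw [mul_comm]
  rfl

end Factorial

/-! ### Cones of full dimension -/

section FullCone

variable {N : Type u} [AddCommGroup N]

/-- A complete fan has a cone of full dimension, since `N_ℝ` is not a finite union of hyperplanes. -/
lemma SmoothFan.exists_full_cone (Δ : SmoothFan N) (hΔ : Δ.IsComplete) :
    ∃ (σ : Δ.cones) (b : Module.Basis (Fin (Module.finrank ℤ N)) ℤ N), σ.1 = Set.range b := by
  by_contra! hne
  have key : ∀ σ : Δ.cones, ∃ m : Module.Dual ℤ N, (∀ v ∈ σ.1, m v = 0) ∧ m ≠ 0 := fun σ => by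
    obtain ⟨b, hb⟩ := Δ.smooth σ.1 σ.2
    obtain ⟨_, ⟨i, rfl⟩, hi⟩ := Set.exists_of_ssubset (hb.ssubset_of_ne (hne σ b))
    refine ⟨b.coord i, fun v hv => ?_, fun h => ?_⟩
    · obtain ⟨j, rfl⟩ := hb hv
      rw [Module.Basis.coord_apply, Module.Basis.repr_self,
        Finsupp.single_eq_of_ne (by rintro rfl; exact hi hv)]
    · have := LinearMap.congr_fun h (b i)
      simp at this
  choose m hm hm0 using key
  let L : Δ.cones → (ℝ ⊗[ℤ] N →ₗ[ℝ] ℝ) := fun σ => Module.Dual.baseChange ℝ (m σ)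
  have hL : ∀ σ (w : N), L σ ((1 : ℝ) ⊗ₜ[ℤ] w) = m σ w := fun σ w => by simp [L]
  have := Δ.finite.to_subtype
  obtain ⟨σ, hσ⟩ := Subspace.exists_eq_top_of_iUnion_eq_univ (k := ℝ)
    (p := fun σ : Δ.cones => LinearMap.ker (L σ)) (Set.eq_univ_of_forall fun y => by
      obtain ⟨σ, hσ, hy⟩ := hΔ y
      refine Set.mem_iUnion.mpr ⟨⟨σ, hσ⟩, ?_⟩
      refine Submodule.span_le.mpr ?_ (PointedCone.hull_le_span ℝ _ hy)
      rintro _ ⟨w, hw, rfl⟩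
      change L _ _ = 0
      rw [hL, hm ⟨σ, hσ⟩ w hw, Int.cast_zero])
  -- One of the hyperplanes `ker L_σ` is everything, which contradicts `m σ ≠ 0`.
  refine hm0 σ (LinearMap.ext fun v => ?_)
  have h : (1 : ℝ) ⊗ₜ[ℤ] v ∈ LinearMap.ker (L σ) := hσ ▸ Submodule.mem_top
  have h' := LinearMap.mem_ker.mp h
  rw [hL] at h'
  exact_mod_cast h'

end FullCone

/-! ### The coordinate rings of the charts are factorial -/

section FactorialChart

variable {N : Type u} [AddCommGroup N] (k : Type u) [Field k]

/-- The linear forms that are nonnegative on a basis are the sums of the dual basis. -/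
lemma exists_finsupp_equiv_dualMonoid {ι : Type*} [Finite ι] (b : Module.Basis ι ℤ N) :
    Nonempty ((ι →₀ ℕ) ≃+ dualMonoid (Set.range b)) := by
  let f : (ι →₀ ℕ) →+ dualMonoid (Set.range b) :=
    { toFun := fun c => ⟨b.constr ℤ fun i => (c i : ℤ), by
        rintro _ ⟨i, rfl⟩
        rw [b.constr_basis]
        exact Int.natCast_nonneg _⟩
      map_zero' := Subtype.ext (b.ext fun i => by
        change b.constr ℤ (fun i => ((0 : ι →₀ ℕ) i : ℤ)) (b i) = 0
        rw [b.constr_basis]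
        rfl)
      map_add' := fun c d => Subtype.ext (b.ext fun i => by
        change b.constr ℤ (fun i => ((c + d) i : ℤ)) (b i) =
          b.constr ℤ (fun i => (c i : ℤ)) (b i) + b.constr ℤ (fun i => (d i : ℤ)) (b i)
        rw [b.constr_basis, b.constr_basis, b.constr_basis]
        exact Nat.cast_add _ _) }
  have hf : ∀ c i, (f c).1 (b i) = (c i : ℤ) := fun c i => b.constr_basis ℤ (fun i => (c i : ℤ)) i
  refine ⟨AddEquiv.ofBijective f ⟨fun c d h => Finsupp.ext fun i => ?_, fun m => ?_⟩⟩
  · have h1 := hf c i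
    rw [h, hf] at h1
    exact_mod_cast h1.symm
  · refine ⟨Finsupp.equivFunOnFinite.symm fun i => (m.1 (b i)).toNat,
      Subtype.ext (b.ext fun i => ?_)⟩
    rw [hf]
    exact Int.toNat_of_nonneg (m.2 _ ⟨i, rfl⟩)

/-- The coordinate ring of a smooth affine toric variety is a localization of a polynomial ring. -/
lemma uniqueFactorizationMonoid_chartRing [Module.Free ℤ N] (Δ : SmoothFan N) (σ : Δ.cones) :
    UniqueFactorizationMonoid (ChartRing k σ.1) := by
  classical
  obtain ⟨b, hb⟩ := Δ.smooth σ.1 σ.2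
  obtain ⟨e⟩ := exists_finsupp_equiv_dualMonoid b
  have h1 : UniqueFactorizationMonoid (ChartRing k (Set.range b)) :=
    (AddMonoidAlgebra.mapDomainRingEquiv k e).toMulEquiv.uniqueFactorizationMonoid
      (inferInstanceAs (UniqueFactorizationMonoid (MvPolynomial (Fin (Module.finrank ℤ N)) k)))
  -- Inverting the product of the coordinates that belong to the `b_i` outside of `σ` gives the chart.
  let m : Module.Dual ℤ N := b.constr ℤ fun i => if b i ∈ σ.1 then 0 else 1
  have hm : ∀ i, m (b i) = if b i ∈ σ.1 then 0 else 1 := b.constr_basis ℤ _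
  have hm' : m ∈ dualMonoid (Set.range b) := by
    rintro _ ⟨i, rfl⟩
    rw [hm]
    split_ifs <;> simp
  let _ := (chartMap k hb).toAlgebra
  have h2 := isLocalization_chartMap k hb (Set.finite_range b) ⟨m, hm'⟩
    (fun v hv => by
      obtain ⟨i, rfl⟩ := hb hv
      exact (hm i).trans (if_pos hv))
    (by
      rintro _ ⟨⟨i, rfl⟩, hi⟩
      exact ((hm i).trans (if_neg hi)).symm ▸ one_pos)
  exact UniqueFactorizationMonoid.of_isLocalization
    (.powers (.single ⟨m, hm'⟩ 1 : ChartRing k (Set.range b))) _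

end FactorialChart

namespace SmoothFan

/-! ### Regular and invertible characters -/

section RegularCharacters

variable {N : Type u} [AddCommGroup N] [Module.Free ℤ N] {Δ : SmoothFan N} {k : Type u} [Field k]

lemma exists_equation (σ : Δ.cones) (D : CartierDivisor (Δ.toricVariety k)) :
    ∃ g : ((Δ.toricVariety k).functionField)ˣ, ∀ x ∈ Δ.chartOpen k σ, D.IsLocalEquation x g :=
  D.exists_equation_of_factorial (isAffineOpen_chartOpen σ)
    ((RingEquiv.ofBijective _ (Δ.chartSection_bijective k σ)).toMulEquiv.uniqueFactorizationMonoid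
      (uniqueFactorizationMonoid_chartRing k Δ σ))

lemma exists_chartRing_of_regular {σ : Δ.cones} {z : (Δ.toricVariety k).functionField}
    (hz : ∀ x ∈ Δ.chartOpen k σ, z ∈
      (algebraMap ((Δ.toricVariety k).presheaf.stalk x) (Δ.toricVariety k).functionField).range) :
    ∃ a : ChartRing k σ.1, Δ.charToFunctionField k (chartInclusion k σ.1 a) = z := by
  obtain ⟨g, hg⟩ := exists_algebraMap_eq hz
  obtain ⟨a, rfl⟩ := (Δ.chartSection_bijective k σ).2 g
  exact ⟨a, (Δ.germToFunctionField_chartSection k σ a).symm.trans hg⟩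

lemma mem_dualMonoid_of_regular {σ : Δ.cones} {m : Module.Dual ℤ N}
    (hm : ∀ x ∈ Δ.chartOpen k σ, (Δ.charUnit k m : (Δ.toricVariety k).functionField) ∈
      (algebraMap ((Δ.toricVariety k).presheaf.stalk x) (Δ.toricVariety k).functionField).range) :
    m ∈ dualMonoid σ.1 := by
  obtain ⟨a, ha⟩ := exists_chartRing_of_regular hm
  have h := congrArg (fun c => c.coeff m) (Δ.charToFunctionField_injective k ha)
  by_contra h0
  have h1 : (chartInclusion k σ.1 a).coeff m = 0 := by
    refine Finsupp.mapDomain_of_notMem_range _ _ ?_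
    rintro ⟨m', rfl⟩
    exact h0 m'.2
  rw [h1, AddMonoidAlgebra.coeff_single, Finsupp.single_eq_same] at h
  exact zero_ne_one h

lemma mem_range_of_mem_stalkUnits {x : Δ.toricVariety k} {f : ((Δ.toricVariety k).functionField)ˣ}
    (hf : f ∈ stalkUnits (Δ.toricVariety k) x) : (f : (Δ.toricVariety k).functionField) ∈
      (algebraMap ((Δ.toricVariety k).presheaf.stalk x) (Δ.toricVariety k).functionField).range := by
  obtain ⟨a, rfl⟩ := hf
  exact ⟨a, rfl⟩

lemma eq_zero_of_mem_stalkUnits {σ : Δ.cones} {m : Module.Dual ℤ N}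
    (hm : ∀ x ∈ Δ.chartOpen k σ, Δ.charUnit k m ∈ stalkUnits (Δ.toricVariety k) x) :
    ∀ v ∈ σ.1, m v = 0 := fun v hv => by
  have h1 := mem_dualMonoid_of_regular (fun x hx => mem_range_of_mem_stalkUnits (hm x hx)) v hv
  have h2 := mem_dualMonoid_of_regular (m := -m) (fun x hx => mem_range_of_mem_stalkUnits
    (by rw [charUnit_neg]; exact inv_mem (hm x hx))) v hv
  rw [LinearMap.neg_apply] at h2
  omega

/-- Up to constants, the invertible functions on the torus are the characters. -/
lemma exists_char_of_unit {f : ((Δ.toricVariety k).functionField)ˣ}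
    (hf : ∀ x ∈ Δ.chartOpen k Δ.zeroCone, f ∈ stalkUnits (Δ.toricVariety k) x) :
    ∃ m, ∀ x, f⁻¹ * Δ.charUnit k m ∈ stalkUnits (Δ.toricVariety k) x := by
  obtain ⟨a, ha⟩ := exists_chartRing_of_regular
    (fun x hx => mem_range_of_mem_stalkUnits (hf x hx))
  obtain ⟨b, hb⟩ := exists_chartRing_of_regular
    (fun x hx => mem_range_of_mem_stalkUnits (inv_mem (hf x hx)))
  have hab : chartInclusion k (Δ.zeroCone).1 a * chartInclusion k (Δ.zeroCone).1 b = 1 := by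
    apply Δ.charToFunctionField_injective k
    rw [map_mul, ha, hb, map_one, Units.mul_inv]
  obtain ⟨m, c, hc, h⟩ := AddMonoidAlgebra.exists_single_of_mul_eq_one hab
  rw [h, charToFunctionField_single] at ha
  refine ⟨m, fun x => ?_⟩
  obtain ⟨y, hy⟩ := constFunction_mem (Δ := Δ) x c
  obtain ⟨y', hy'⟩ := constFunction_mem (Δ := Δ) x c⁻¹
  have hyy' : y * y' = 1 := by
    apply algebraMap_stalk_injective x
    rw [map_mul, hy, hy', ← map_mul, mul_inv_cancel₀ hc, map_one, map_one]
  refine ⟨⟨y', y, (mul_comm _ _).trans hyy', hyy'⟩, Units.ext ?_⟩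
  change algebraMap _ _ y' = _
  rw [hy', Units.val_mul, map_inv₀, eq_comm, Units.inv_mul_eq_iff_eq_mul, ← ha]
  have : Δ.constFunction k c ≠ 0 := (map_ne_zero _).mpr hc
  field_simp

end RegularCharacters

/-! ### The Picard group of a toric variety -/

section InvariantDivisors

variable {N : Type u} [AddCommGroup N] [Module.Free ℤ N] {Δ : SmoothFan N} {k : Type u} [Field k]

/-- A generator of a cone of the fan, as a ray. -/
def rayOf (σ : Δ.cones) {v : N} (hv : v ∈ σ.1) : Δ.Ray :=
  ⟨v, Δ.face_mem _ σ.2 _ (Set.singleton_subset_iff.mpr hv)⟩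

lemma charUnit_zsmul (n : ℤ) (m : Module.Dual ℤ N) :
    Δ.charUnit k (n • m) = Δ.charUnit k m ^ n :=
  map_zsmul (AddMonoidHom.mk' (fun m => Additive.ofMul (Δ.charUnit k m))
    fun m m' => congrArg Additive.ofMul (Δ.charUnit_add k m m')) n m

/-- The divisor `∑ a_ρ D_ρ`. -/
noncomputable def invariantDivisor : (Δ.Ray → ℤ) →+ CartierDivisor (Δ.toricVariety k) :=
  AddMonoidHom.mk' (fun a => ∑ ρ, a ρ • Δ.rayDivisor k ρ) fun a b => by
    simp only [Pi.add_apply, add_smul, Finset.sum_add_distrib]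

lemma invariantDivisor_apply (a : Δ.Ray → ℤ) :
    invariantDivisor (k := k) a = ∑ ρ, a ρ • Δ.rayDivisor k ρ := rfl

lemma isLocalEquation_invariantDivisor_aux (a : Δ.Ray → ℤ) {σ : Δ.cones} {x : Δ.toricVariety k}
    (hx : x ∈ Δ.chartOpen k σ) :
    (invariantDivisor a).IsLocalEquation x (Δ.charUnit k (∑ ρ, a ρ • Δ.rayForm ρ σ)) := by
  classical
  rw [invariantDivisor_apply]
  induction (Finset.univ : Finset Δ.Ray) using Finset.induction_on with
  | empty =>
    rw [Finset.sum_empty, Finset.sum_empty, charUnit_zero]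
    exact CartierDivisor.isLocalEquation_zero
  | insert ρ s hρ ih =>
    rw [Finset.sum_insert hρ, Finset.sum_insert hρ, charUnit_add, charUnit_zsmul]
    refine CartierDivisor.IsLocalEquation.add ?_ ih
    exact congrArg (fun z : _ ⧸ stalkUnits (Δ.toricVariety k) x => z ^ a ρ)
      (isLocalEquation_rayForm ρ hx)

/-- On `U_σ` the divisor `∑ a_ρ D_ρ` has the equation `χ^m` for every `m` with `⟨m, ρ⟩ = a_ρ` for the
generators `ρ` of `σ`. -/
lemma isLocalEquation_invariantDivisor (a : Δ.Ray → ℤ) {σ : Δ.cones} {x : Δ.toricVariety k}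
    (hx : x ∈ Δ.chartOpen k σ) {m : Module.Dual ℤ N}
    (hm : ∀ v (hv : v ∈ σ.1), m v = a (rayOf σ hv)) :
    (invariantDivisor a).IsLocalEquation x (Δ.charUnit k m) := by
  classical
  refine (isLocalEquation_invariantDivisor_aux a hx).trans
    (Δ.charUnit_mk_eq k hx hx (fun v => m v) _ _ (fun v hv => ?_) fun v hv => rfl)
  rw [hm v hv, LinearMap.sum_apply, Finset.sum_eq_single (rayOf σ hv)]
  · rw [LinearMap.smul_apply, rayForm_spec _ _ _ _ hv, if_pos (show v = (rayOf σ hv).1 from rfl), smul_eq_mul, mul_one]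
  · intro ρ _ hρ
    rw [LinearMap.smul_apply, rayForm_spec _ _ _ _ hv,
      if_neg (fun h => hρ (Subtype.ext h.symm)), smul_zero]
  · simp

lemma eq_on_of_isLocalEquation {D : CartierDivisor (Δ.toricVariety k)} {σ : Δ.cones}
    {m m' : Module.Dual ℤ N}
    (h : ∀ x ∈ Δ.chartOpen k σ, D.IsLocalEquation x (Δ.charUnit k m))
    (h' : ∀ x ∈ Δ.chartOpen k σ, D.IsLocalEquation x (Δ.charUnit k m')) :
    ∀ v ∈ σ.1, m v = m' v := fun v hv => by
  have h1 := eq_zero_of_mem_stalkUnits (k := k) (m := m' - m) (fun x hx => by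
    rw [charUnit_sub, mul_comm]
    exact (CartierDivisor.isLocalEquation_iff (h x hx)).mp (h' x hx)) v hv
  rw [LinearMap.sub_apply] at h1
  omega

lemma principalDivisor_charUnit (m : Module.Dual ℤ N) :
    principalDivisor (Δ.toricVariety k) (Additive.ofMul (Δ.charUnit k m)) =
      invariantDivisor (Δ.rayValues m) :=
  CartierDivisor.ext_of_isLocalEquation fun x => by
    obtain ⟨σ, hx⟩ := Δ.iSup_chartOpen k x
    exact ⟨_, CartierDivisor.isLocalEquation_principal _,
      isLocalEquation_invariantDivisor _ hx fun v hv => rfl⟩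

/-- Every divisor is linearly equivalent to a torus-invariant one: its restriction to the torus has
an equation, and after division by it the equations on the charts are characters. -/
lemma exists_invariantDivisor (D : CartierDivisor (Δ.toricVariety k)) :
    ∃ (a : Δ.Ray → ℤ) (f : ((Δ.toricVariety k).functionField)ˣ),
      D = invariantDivisor a + principalDivisor _ (Additive.ofMul f) := by
  obtain ⟨f, hf⟩ := exists_equation Δ.zeroCone D
  -- `D'` has the equation `1` on the torus, so its equations on the charts are units there.
  set D' := D - principalDivisor _ (Additive.ofMul f) with hD'
  have h1 : ∀ x ∈ Δ.chartOpen k Δ.zeroCone, D'.IsLocalEquation x 1 := fun x hx => by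
    have := (hf x hx).add (CartierDivisor.isLocalEquation_principal f).neg
    rwa [mul_inv_cancel, ← sub_eq_add_neg] at this
  have key : ∀ σ : Δ.cones, ∃ m, ∀ x ∈ Δ.chartOpen k σ, D'.IsLocalEquation x (Δ.charUnit k m) :=
    fun σ => by
      obtain ⟨g, hg⟩ := exists_equation σ D'
      obtain ⟨m, hm⟩ := exists_char_of_unit (f := g) fun x hx => by
        have h2 := (CartierDivisor.isLocalEquation_iff (h1 x hx)).mp
          (hg x (Δ.chartOpen_mono k (Set.empty_subset σ.1) hx))
        rwa [inv_one, one_mul] at h2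
      exact ⟨m, fun x hx => (CartierDivisor.isLocalEquation_iff (hg x hx)).mpr (hm x)⟩
  choose m hm using key
  let τ : Δ.Ray → Δ.cones := fun ρ => ⟨{ρ.1}, ρ.2⟩
  refine ⟨fun ρ => m (τ ρ) ρ.1, f, sub_eq_iff_eq_add.mp ?_⟩
  refine CartierDivisor.ext_of_isLocalEquation fun x => ?_
  obtain ⟨σ, hx⟩ := Δ.iSup_chartOpen k x
  refine ⟨_, hm σ x hx, isLocalEquation_invariantDivisor _ hx fun v hv => ?_⟩
  refine eq_on_of_isLocalEquation (σ := τ (rayOf σ hv)) (fun x hx => ?_)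
    (hm (τ (rayOf σ hv))) v rfl
  exact hm σ x (Δ.chartOpen_mono k (Set.singleton_subset_iff.mpr hv) hx)

/-- A rational function whose divisor is torus-invariant is a unit on the torus, so it is a multiple of a
character. -/
lemma eq_rayValues_of_principal {a : Δ.Ray → ℤ} {f : ((Δ.toricVariety k).functionField)ˣ}
    (h : invariantDivisor a = principalDivisor _ (Additive.ofMul f)) :
    ∃ m, a = Δ.rayValues m := by
  obtain ⟨m, hm⟩ := exists_char_of_unit (f := f) fun x hx => by
    have h1 := isLocalEquation_invariantDivisor a hx (m := 0) fun v hv => hv.elim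
    rw [h, charUnit_zero] at h1
    have h2 := (CartierDivisor.isLocalEquation_iff h1).mp (CartierDivisor.isLocalEquation_principal f)
    rwa [inv_one, one_mul] at h2
  refine ⟨m, funext fun ρ => ?_⟩
  obtain ⟨m', hm'⟩ := Δ.exists_dual (σ := {ρ.1}) ρ.2 fun _ => a ρ
  have h1 := eq_on_of_isLocalEquation (k := k) (D := invariantDivisor a) (σ := ⟨{ρ.1}, ρ.2⟩)
    (m := m) (m' := m')
    (fun x hx => h ▸ (CartierDivisor.isLocalEquation_iff (CartierDivisor.isLocalEquation_principal f)).mpr (hm x))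
    (fun x hx => isLocalEquation_invariantDivisor a hx fun v hv => by
      obtain rfl := hv
      exact hm' _ rfl) ρ.1 rfl
  exact ((hm' _ rfl).symm.trans h1.symm)

/-- The class of `∑ a_ρ D_ρ`. -/
noncomputable def invariantClass : (Δ.Ray → ℤ) →+ Pic (Δ.toricVariety k) :=
  (QuotientAddGroup.mk' _).comp invariantDivisor

lemma invariantClass_surjective :
    Function.Surjective (invariantClass : (Δ.Ray → ℤ) →+ Pic (Δ.toricVariety k)) := fun β => by
  obtain ⟨D, rfl⟩ := QuotientAddGroup.mk_surjective β
  obtain ⟨a, f, h⟩ := exists_invariantDivisor D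
  refine ⟨a, (QuotientAddGroup.eq.mpr ?_)⟩
  rw [h, neg_add_cancel_left]
  exact ⟨_, rfl⟩

lemma invariantClass_eq_zero_iff {a : Δ.Ray → ℤ} :
    invariantClass (k := k) a = 0 ↔ ∃ m, a = Δ.rayValues m := by
  refine (QuotientAddGroup.eq_zero_iff _).trans ⟨?_, ?_⟩
  · rintro ⟨f, hf⟩
    exact eq_rayValues_of_principal (f := f.toMul) hf.symm
  · rintro ⟨m, rfl⟩
    exact ⟨_, principalDivisor_charUnit m⟩

lemma invariantClass_apply (a : Δ.Ray → ℤ) :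
    invariantClass (k := k) a = ∑ ρ, a ρ • Δ.rayClass k ρ := by
  change QuotientAddGroup.mk' _ (∑ ρ, a ρ • Δ.rayDivisor k ρ) = _
  rw [map_sum]
  rfl

end InvariantDivisors

/-! ### Relations between the rays -/

section Relations

variable {N : Type u} [AddCommGroup N] {Δ : SmoothFan N} (σ : Δ.cones)

/-- The rays that are not contained in `σ`. -/
abbrev OuterRay : Type u := {ρ : Δ.Ray // ρ.1 ∉ σ.1}

noncomputable instance : Fintype (OuterRay σ) := Fintype.ofFinite _

variable {σ} {b : Module.Basis (Fin (Module.finrank ℤ N)) ℤ N}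

/-- In a relation between the generators of the rays, the coefficients at the generators of a cone of
full dimension are determined by the other ones. -/
lemma eq_neg_sum_of_relation (hb : σ.1 = Set.range b) {G : Type*} [AddCommGroup G] {z : Δ.Ray → G}
    (hz : ∀ m : Module.Dual ℤ N, ∑ ρ, m ρ.1 • z ρ = 0) {ρ : Δ.Ray}
    {i : Fin (Module.finrank ℤ N)} (hi : b i = ρ.1) :
    z ρ = -∑ ρ' : OuterRay σ, b.coord i ρ'.1.1 • z ρ'.1 := by
  classical
  have hρ : ρ.1 ∈ σ.1 := hb ▸ ⟨i, hi⟩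
  have h1 := hz (b.coord i)
  rw [← Finset.sum_filter_add_sum_filter_not Finset.univ (fun ρ' : Δ.Ray => ρ'.1 ∈ σ.1),
    Finset.sum_eq_single ρ] at h1
  · rw [← hi, Module.Basis.coord_apply, Module.Basis.repr_self, Finsupp.single_eq_same,
      one_smul] at h1
    rw [eq_neg_iff_add_eq_zero, ← h1]
    exact congrArg _ (Finset.sum_subtype (p := fun ρ' : Δ.Ray => ρ'.1 ∉ σ.1)
      (Finset.univ.filter fun ρ' : Δ.Ray => ¬ρ'.1 ∈ σ.1) (fun ρ' => by simp)
      fun ρ' => b.coord i ρ'.1 • z ρ').symm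
  · intro ρ' hρ' hne
    obtain ⟨j, hj⟩ : ρ'.1 ∈ Set.range b := hb ▸ (Finset.mem_filter.mp hρ').2
    rw [← hj, Module.Basis.coord_apply, Module.Basis.repr_self, Finsupp.single_eq_of_ne,
      zero_smul]
    rintro rfl
    exact hne (Subtype.ext (hj.symm.trans hi))
  · intro h
    exact (h (Finset.mem_filter.mpr ⟨Finset.mem_univ _, hρ⟩)).elim

end Relations

/-! ### Bases of `N_1(X)` -/

section Curves

variable {N : Type u} [AddCommGroup N] [Module.Free ℤ N] {Δ : SmoothFan N} {k : Type u} [Field k]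

lemma N1_ext {φ ψ : Δ.N1 k} (h : ∀ ρ, φ (Δ.rayClass k ρ) = ψ (Δ.rayClass k ρ)) : φ = ψ := by
  refine AddMonoidHom.ext fun β => ?_
  obtain ⟨a, rfl⟩ := invariantClass_surjective β
  rw [invariantClass_apply, map_sum, map_sum]
  exact Finset.sum_congr rfl fun ρ _ => by rw [map_zsmul, map_zsmul, h]

/-- Curve classes are relations between the generators of the rays. -/
lemma sum_N1 (φ : Δ.N1 k) (u : Module.Dual ℤ N) : ∑ ρ, φ (Δ.rayClass k ρ) * u ρ.1 = 0 := by
  have h := congrArg φ ((invariantClass_eq_zero_iff (k := k)).mpr ⟨u, rfl⟩)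
  rw [invariantClass_apply, map_sum, map_zero] at h
  rw [← h]
  refine Finset.sum_congr rfl fun ρ _ => ?_
  rw [map_zsmul, smul_eq_mul, mul_comm]
  rfl

/-- A functional on the torus-invariant divisors that kills the principal ones is a curve class. -/
lemma exists_N1 (L : (Δ.Ray → ℤ) →+ ℤ) (hL : ∀ m, L (Δ.rayValues m) = 0) :
    ∃ φ : Δ.N1 k, ∀ a, φ (invariantClass a) = L a := by
  let g : {g : (Δ.Ray → ℤ) →+ ℤ //
      (invariantClass : (Δ.Ray → ℤ) →+ Pic (Δ.toricVariety k)).ker ≤ g.ker} :=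
    ⟨L, fun a ha => by
      obtain ⟨m, rfl⟩ := invariantClass_eq_zero_iff.mp ha
      exact hL m⟩
  exact ⟨AddMonoidHom.liftOfSurjective _ invariantClass_surjective g,
    fun a => AddMonoidHom.liftOfRightInverse_comp_apply _ _ _ g a⟩

variable {σ : Δ.cones} {b : Module.Basis (Fin (Module.finrank ℤ N)) ℤ N}

/-- If `σ` has full dimension, the classes of the `D_ρ` with `ρ` not in `σ` form a basis of the Picard
group; this is the dual basis. -/
lemma exists_dualCurve (hb : σ.1 = Set.range b) (ρ : OuterRay σ) : ∃ φ : Δ.N1 k,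
    φ (Δ.rayClass k ρ.1) = 1 ∧ ∀ ρ' : OuterRay σ, ρ' ≠ ρ → φ (Δ.rayClass k ρ'.1) = 0 := by
  classical
  have hbσ : ∀ i, b i ∈ σ.1 := fun i => hb ▸ ⟨i, rfl⟩
  -- The relation `ρ = ∑ b_i^*(ρ) b_i`, as a functional on `∑ a_ρ D_ρ`.
  let L : (Δ.Ray → ℤ) →+ ℤ := AddMonoidHom.mk'
    (fun a => a ρ.1 - ∑ i, a (rayOf σ (hbσ i)) * b.coord i ρ.1.1) fun a a' => by
      simp only [Pi.add_apply, add_mul, Finset.sum_add_distrib]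
      ring
  have hLapp : ∀ a, L a = a ρ.1 - ∑ i, a (rayOf σ (hbσ i)) * b.coord i ρ.1.1 := fun a => rfl
  obtain ⟨φ, hφ⟩ := exists_N1 (k := k) L fun m => by
    rw [hLapp, sub_eq_zero]
    change m ρ.1.1 = ∑ i, m (b i) * b.coord i ρ.1.1
    conv_lhs => rw [← b.sum_repr ρ.1.1]
    rw [map_sum]
    refine Finset.sum_congr rfl fun i _ => ?_
    rw [map_smul, smul_eq_mul, mul_comm]
    rfl
  have h1 : ∀ ρ' : Δ.Ray, Δ.rayClass k ρ' = invariantClass (Pi.single ρ' 1) := fun ρ' => by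
    rw [invariantClass_apply, Finset.sum_eq_single ρ']
    · rw [Pi.single_eq_same, one_smul]
    · intro ρ'' _ h
      rw [Pi.single_eq_of_ne h, zero_smul]
    · simp
  have h2 : ∀ ρ' : OuterRay σ, φ (Δ.rayClass k ρ'.1) = (Pi.single ρ'.1 1 : Δ.Ray → ℤ) ρ.1 :=
    fun ρ' => by
      rw [h1, hφ, hLapp, sub_eq_self]
      refine Finset.sum_eq_zero fun i _ => ?_
      rw [Pi.single_eq_of_ne, zero_mul]
      intro h
      exact ρ'.2 (h ▸ hbσ i)
  refine ⟨φ, ?_, fun ρ' h => ?_⟩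
  · rw [h2, Pi.single_eq_same]
  · rw [h2, Pi.single_eq_of_ne fun h' => h (Subtype.ext h'.symm)]

/-- The curve class dual to `D_ρ`. -/
noncomputable def dualCurve (hb : σ.1 = Set.range b) (ρ : OuterRay σ) : Δ.N1 k := (exists_dualCurve hb ρ).choose

lemma dualCurve_self (hb : σ.1 = Set.range b) (ρ : OuterRay σ) : dualCurve (k := k) hb ρ (Δ.rayClass k ρ.1) = 1 :=
  (exists_dualCurve hb ρ).choose_spec.1

lemma dualCurve_of_ne (hb : σ.1 = Set.range b) {ρ ρ' : OuterRay σ} (h : ρ' ≠ ρ) :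
    dualCurve (k := k) hb ρ (Δ.rayClass k ρ'.1) = 0 :=
  (exists_dualCurve hb ρ).choose_spec.2 ρ' h

/-- The relations that belong to the classes `dualCurve` form a basis of all relations. -/
lemma eq_sum_dualCurve_of_relation (hb : σ.1 = Set.range b) {G : Type*} [AddCommGroup G]
    {z : Δ.Ray → G} (hz : ∀ m : Module.Dual ℤ N, ∑ ρ, m ρ.1 • z ρ = 0) (ρ : Δ.Ray) :
    ∑ ρ' : OuterRay σ, dualCurve (k := k) hb ρ' (Δ.rayClass k ρ) • z ρ'.1 = z ρ := by
  classical
  by_cases hρ : ρ.1 ∈ σ.1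
  · obtain ⟨i, hi⟩ : ρ.1 ∈ Set.range b := hb ▸ hρ
    rw [eq_neg_sum_of_relation hb hz hi, ← Finset.sum_neg_distrib]
    refine Finset.sum_congr rfl fun ρ' _ => ?_
    rw [← neg_smul]
    refine congrArg (· • z ρ'.1) ?_
    refine (eq_neg_sum_of_relation hb (z := fun ρ => dualCurve (k := k) hb ρ' (Δ.rayClass k ρ))
      (fun m => ?_) hi).trans (congrArg _ ?_)
    · refine (Finset.sum_congr rfl fun ρ _ => ?_).trans (sum_N1 (dualCurve (k := k) hb ρ') m)
      rw [smul_eq_mul, mul_comm]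
    · rw [Finset.sum_eq_single ρ' (fun ρ'' _ h => by rw [dualCurve_of_ne hb h, smul_zero])
        (by simp), dualCurve_self, smul_eq_mul, mul_one]
  · refine (Finset.sum_eq_single (⟨ρ, hρ⟩ : OuterRay σ) (fun ρ' _ h => ?_) (by simp)).trans ?_
    · exact (congrArg (· • z ρ'.1) (dualCurve_of_ne hb h.symm)).trans (zero_smul _ _)
    · exact (congrArg (· • z ρ) (dualCurve_self hb _)).trans (one_smul _ _)

lemma sum_dualCurve (hb : σ.1 = Set.range b) (φ : Δ.N1 k) :
    ∑ ρ : OuterRay σ, φ (Δ.rayClass k ρ.1) • dualCurve (k := k) hb ρ = φ := by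
  refine N1_ext fun ρ => ?_
  rw [AddMonoidHom.finsetSum_apply]
  refine Eq.trans (Finset.sum_congr rfl fun ρ' _ => ?_)
    (eq_sum_dualCurve_of_relation (k := k) hb (z := fun ρ => φ (Δ.rayClass k ρ)) (fun m => ?_) ρ)
  · rw [AddMonoidHom.smul_apply, smul_eq_mul, smul_eq_mul, mul_comm]
  · refine (Finset.sum_congr rfl fun ρ _ => ?_).trans (sum_N1 φ m)
    rw [smul_eq_mul, mul_comm]

end Curves

end SmoothFan

/-! ### Bases of `A ⊗ O_X` -/

section ConstantTensorFrame

variable {X : Scheme.{u}} [IsIntegral X] {A : Type u} [AddCommGroup A] {U : X.Opens}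
  {ι : Type*}

namespace constantTensor

lemma evalSection_zero (ψ : A →+ ℤ) : evalSection ψ (0 : Γ(constantTensor A X, U)) = 0 :=
  map_zero (AddMonoidHom.mk' (evalSection ψ) (evalSection_add ψ))

lemma evalSection_sum (ψ : A →+ ℤ) (t : Finset ι) (s : ι → Γ(constantTensor A X, U)) :
    evalSection ψ (∑ i ∈ t, s i) = ∑ i ∈ t, evalSection ψ (s i) :=
  map_sum (AddMonoidHom.mk' (evalSection ψ) (evalSection_add ψ)) s t

variable [Fintype ι]

/-- A finite system `a_i ∈ A`, `ψ_i ∈ Hom(A, ℤ)` with `∑ ψ_i(c) a_i = c` expands the sections of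
`A ⊗ O_X`. -/
lemma sum_tmul_evalSection {a : ι → A} {ψ : ι → A →+ ℤ} (h : ∀ c, ∑ i, ψ i c • a i = c)
    (s : Γ(constantTensor A X, U)) : ∑ i, tmul (evalSection (ψ i) s) (a i) = s := by
  refine germ_ext fun x => ?_
  have h1 : ∀ i, X.presheaf.germ U x.1 x.2 (evalSection (ψ i) s) =
      evalAux (X.presheaf.stalk x.1) (ψ i) (germ s x) := fun i =>
    algebraMap_stalk_injective x.1 (rationalFunction_evalSection (ψ i) s x)
  simp only [germ_sum, germ_tmul, h1]
  generalize germ s x = t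
  induction t with
  | zero => simp
  | add a b ha hb => simp only [map_add, TensorProduct.add_tmul, Finset.sum_add_distrib, ha, hb]
  | tmul g c =>
    conv_rhs => rw [← h c, TensorProduct.tmul_sum]
    refine Finset.sum_congr rfl fun i _ => ?_
    rw [evalAux_tmul, TensorProduct.smul_tmul]

lemma coherentOn [DecidableEq ι] (hU : IsAffineOpen U) {a : ι → A} {ψ : ι → A →+ ℤ}
    (h : ∀ c, ∑ i, ψ i c • a i = c) (h' : ∀ i j, ψ i (a j) = if i = j then 1 else 0) :
    CoherentOn (constantTensor A X) U := by
  have key : ∀ (V : X.Opens) (hV : V ≤ U) (c : ι → Γ(X, V)),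
      ∑ i, c i • (constantTensor A X).presheaf.map (homOfLE hV).op (tmul 1 (a i)) =
        ∑ i, tmul (c i) (a i) := fun V hV c =>
    Finset.sum_congr rfl fun i _ => by rw [res_tmul, map_one, smul_tmul, mul_one]
  refine coherentOn_of_frame hU (fun i => tmul 1 (a i))
    (fun V hV s => ⟨fun i => evalSection (ψ i) s, ?_⟩) fun V hV c hc i => ?_
  · rw [key, sum_tmul_evalSection h]
  · rw [key] at hc
    have h2 := congrArg (evalSection (ψ i)) hc
    rw [evalSection_sum, evalSection_zero, Finset.sum_eq_single i, evalSection_tmul, h', if_pos rfl,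
      one_smul] at h2
    · exact h2
    · intro j _ hj
      rw [evalSection_tmul, h', if_neg hj.symm, zero_smul]
    · simp

end constantTensor

end ConstantTensorFrame

namespace SmoothFan

/-! ### Exactness of the Euler sequence -/

section EulerSequence

variable {N : Type u} [AddCommGroup N] [Module.Free ℤ N] {Δ : SmoothFan N} {k : Type u} [Field k]
  {U V : (Δ.toricVariety k).Opens}

lemma coherentOn_curveModule (hΔ : Δ.IsComplete) (hU : IsAffineOpen U) :
    CoherentOn (Δ.curveModule k) U := by
  classical
  obtain ⟨σ, b, hb⟩ := Δ.exists_full_cone hΔ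
  refine constantTensor.coherentOn hU (a := fun ρ : OuterRay σ => dualCurve hb ρ)
    (ψ := fun ρ => AddMonoidHom.eval (Δ.rayClass k ρ.1)) (sum_dualCurve hb) fun ρ ρ' => ?_
  rw [AddMonoidHom.eval_apply_apply]
  split_ifs with h
  · rw [h, dualCurve_self]
  · rw [dualCurve_of_ne hb h]

lemma eq_zero_of_eulerLeft_eq_zero (hΔ : Δ.IsComplete) {s : Γ(Δ.curveModule k, U)}
    (hs : eulerLeft.app U s = 0) : s = 0 := by
  obtain ⟨σ, b, hb⟩ := Δ.exists_full_cone hΔ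
  have h0 : ∀ ρ : Δ.Ray, constantTensor.evalSection (AddMonoidHom.eval (Δ.rayClass k ρ)) s = 0 :=
    fun ρ => section_ext_rationalFunction fun x => by
      rw [← value_rayComponent_eulerLeft, hs, rayComponent_zero, lineBundle.value_zero,
        rationalFunction_zero]
  rw [← constantTensor.sum_tmul_evalSection (a := fun ρ : OuterRay σ => dualCurve hb ρ)
    (ψ := fun ρ => AddMonoidHom.eval (Δ.rayClass k ρ.1)) (sum_dualCurve hb) s]
  exact Finset.sum_eq_zero fun ρ _ => by rw [h0, constantTensor.tmul_zero_left]

lemma eulerRight_eulerLeft (s : Γ(Δ.curveModule k, U)) :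
    eulerRight.app U (eulerLeft.app U s) = 0 := by
  refine tangent_ext_of_isLogarithmic fun x hx => ⟨_, 0, AddMonoidHom.ext fun m => ?_,
    isLogarithmic_eulerRight _ ⟨x, hx⟩, IsLogarithmic.zero⟩
  rw [AddMonoidHom.finsetSum_apply, AddMonoidHom.zero_apply]
  simp only [pairingLog_apply, value_rayComponent_eulerLeft,
    constantTensor.rationalFunction_evalSection, constantTensor.evalValue]
  generalize constantTensor.germ s ⟨x, hx⟩ = t
  induction t with
  | zero => simp
  | add a b ha hb => simp only [map_add, add_mul, Finset.sum_add_distrib, ha, hb, add_zero]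
  | tmul g φ =>
    have h := congrArg (Int.cast : ℤ → (Δ.toricVariety k).functionField) (sum_N1 φ m)
    rw [Int.cast_sum, Int.cast_zero] at h
    rw [← mul_zero (algebraMap _ _ g), ← h, Finset.mul_sum]
    refine Finset.sum_congr rfl fun ρ _ => ?_
    rw [constantTensor.evalAux_tmul, map_zsmul, zsmul_eq_mul, Int.cast_mul,
      AddMonoidHom.eval_apply_apply]
    ring

/-- If sections `z_ρ` of the `O_X(D_ρ)` satisfy the relations `∑ ⟨m, ρ⟩ z_ρ = 0`, they have no poles:
on `U_σ` the relation for the form dual to a generator `ρ` of `σ` expresses `z_ρ` by the `z_ρ'` with `ρ'`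
not in `σ`, whose poles do not meet `U_σ`. -/
lemma regular_of_relation {x : Δ.toricVariety k} {z : Δ.Ray → (Δ.toricVariety k).functionField}
    (hz : ∀ ρ, (Δ.rayDivisor k ρ).RegularAt x (z ρ))
    (h : ∀ m : Module.Dual ℤ N, ∑ ρ, m ρ.1 • z ρ = 0) (ρ : Δ.Ray) : z ρ ∈
      (algebraMap ((Δ.toricVariety k).presheaf.stalk x) (Δ.toricVariety k).functionField).range := by
  classical
  obtain ⟨σ, hx⟩ := Δ.iSup_chartOpen k x
  by_cases hρ : ρ.1 ∈ σ.1
  swap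
  · exact mem_of_regularAt_rayDivisor hρ hx (hz ρ)
  have h1 := h (Δ.rayForm ρ σ)
  rw [← Finset.add_sum_erase _ _ (Finset.mem_univ ρ), rayForm_spec _ _ _ _ hρ, if_pos rfl,
    one_smul] at h1
  rw [eq_neg_of_add_eq_zero_left h1]
  refine neg_mem (sum_mem fun ρ' h' => ?_)
  by_cases hρ' : ρ'.1 ∈ σ.1
  · rw [rayForm_spec _ _ _ _ hρ', if_neg fun h => Finset.ne_of_mem_erase h' (Subtype.ext h),
      zero_smul]
    exact zero_mem _
  · exact zsmul_mem (mem_of_regularAt_rayDivisor hρ' hx (hz ρ')) _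

lemma exists_of_eulerRight_eq_zero (hΔ : Δ.IsComplete) {t : Γ(Δ.rayModule k, U)}
    (ht : eulerRight.app U t = 0) : ∃ s, eulerLeft.app U s = t := by
  obtain ⟨σ, b, hb⟩ := Δ.exists_full_cone hΔ
  have hrel : ∀ (x : U) (m : Module.Dual ℤ N),
      ∑ ρ : Δ.Ray, m ρ.1 • lineBundle.value (rayComponent ρ t) x = 0 := fun x m => by
    have h1 := isLogarithmic_eulerRight t x
    rw [ht] at h1
    have h2 := DFunLike.congr_fun (h1.unique IsLogarithmic.zero x.2) m
    rw [AddMonoidHom.finsetSum_apply] at h2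
    refine Eq.trans (Finset.sum_congr rfl fun ρ _ => ?_) h2
    rw [pairingLog_apply, zsmul_eq_mul, mul_comm]
  let g : Δ.Ray → Γ(Δ.toricVariety k, U) := fun ρ =>
    sectionOfRegular (lineBundle.value (rayComponent ρ t)) (lineBundle.value_eq _) fun x =>
      regular_of_relation (z := fun ρ => lineBundle.value (rayComponent ρ t) x)
        (fun ρ => lineBundle.regularAt_value _ _) (hrel x) ρ
  refine ⟨∑ ρ : OuterRay σ, constantTensor.tmul (g ρ.1) (dualCurve hb ρ),
    rayModule_ext fun ρ x => ?_⟩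
  rw [value_rayComponent_eulerLeft, constantTensor.evalSection_sum, rationalFunction_sum]
  refine Eq.trans (Finset.sum_congr rfl fun ρ' _ => ?_)
    (eq_sum_dualCurve_of_relation (k := k) hb (hrel x) ρ)
  rw [constantTensor.evalSection_tmul, rationalFunction_zsmul, rationalFunction_sectionOfRegular,
    AddMonoidHom.eval_apply_apply]

lemma exists_eulerRight_of_regularAt {ρ : Δ.Ray} {z : (Δ.toricVariety k).functionField} (x : U)
    (hz : ∀ y ∈ U, (Δ.rayDivisor k ρ).RegularAt y z) :
    ∃ t : Γ(Δ.rayModule k, U), IsLogarithmic (eulerRight.app U t) (pairingLog ρ.1 z) := by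
  refine ⟨raySection ρ (lineBundle.mk (fun _ => z) (fun _ _ => rfl) fun y => hz y.1 y.2), ?_⟩
  rw [eulerRight, desc_app_raySection]
  exact isLogarithmic_rayField ρ _ x

lemma exists_eulerRight_sum {ι : Type*} [Fintype ι]
    {c : ι → Module.Dual ℤ N →+ (Δ.toricVariety k).functionField}
    (h : ∀ i, ∃ t : Γ(Δ.rayModule k, U), IsLogarithmic (eulerRight.app U t) (c i)) :
    ∃ t : Γ(Δ.rayModule k, U), IsLogarithmic (eulerRight.app U t) (∑ i, c i) := by
  choose t ht using h
  refine ⟨∑ i, t i, ?_⟩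
  rw [map_sum]
  exact IsLogarithmic.sum _ fun i _ => ht i

lemma sum_pairingLog_basis (b : Module.Basis (Fin (Module.finrank ℤ N)) ℤ N)
    (c : Module.Dual ℤ N →+ (Δ.toricVariety k).functionField) :
    ∑ i, pairingLog (b i) (c (b.coord i)) = c := by
  refine AddMonoidHom.ext fun m => ?_
  have hm : ∑ i, m (b i) • b.coord i = m := b.ext fun j => by
    simp
  rw [AddMonoidHom.finsetSum_apply]
  conv_rhs => rw [← hm, map_sum]
  exact Finset.sum_congr rfl fun i _ => by
    rw [pairingLog_apply, map_zsmul, zsmul_eq_mul, mul_comm]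

/-- The vector fields `χ^m ↦ ⟨m, v⟩ z χ^m` with `z` regular come from the `O_X(D_ρ)`, as the generators of
the rays span `N`. -/
lemma exists_eulerRight_of_regular (hΔ : Δ.IsComplete) (v : N)
    {z : (Δ.toricVariety k).functionField} (x : U) (hz : ∀ y ∈ U, z ∈
      (algebraMap ((Δ.toricVariety k).presheaf.stalk y) (Δ.toricVariety k).functionField).range) :
    ∃ t : Γ(Δ.rayModule k, U), IsLogarithmic (eulerRight.app U t) (pairingLog v z) := by
  obtain ⟨σ, b, hb⟩ := Δ.exists_full_cone hΔ
  rw [← sum_pairingLog_basis b (pairingLog v z)]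
  refine exists_eulerRight_sum fun i => ?_
  refine exists_eulerRight_of_regularAt (ρ := rayOf σ (hb ▸ ⟨i, rfl⟩ : b i ∈ σ.1)) x
    fun y hy => (isEffective_rayDivisor _).regularAt ?_
  exact mul_mem (hz y hy) (intCast_mem _ _)

/-- On `U_σ` the derivations are spanned by `∂/∂x_i`, with `x_i` the coordinates for a basis `b` of `N`
that contains the generators of `σ`. If `b_i` generates a ray of `σ`, then `∂/∂x_i` comes from `O_X(D_ρ)`;
otherwise `x_i` is invertible on `U_σ`, and `x_i ∂/∂x_i` comes from the sections of all `O_X(D_ρ)`. -/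
lemma exists_eulerRight_locally (hΔ : Δ.IsComplete) (δ : Γ(Δ.tangentModule k, U))
    {x : Δ.toricVariety k} (hx : x ∈ U) : ∃ (V : (Δ.toricVariety k).Opens) (hV : V ≤ U), x ∈ V ∧
      ∃ t : Γ(Δ.rayModule k, V),
        eulerRight.app V t = (Δ.tangentModule k).presheaf.map (homOfLE hV).op δ := by
  classical
  obtain ⟨σ, hσ⟩ := Δ.iSup_chartOpen k x
  obtain ⟨b, hb⟩ := Δ.smooth σ.1 σ.2
  obtain ⟨c, hc⟩ := exists_isLogarithmic δ
  refine ⟨U ⊓ Δ.chartOpen k σ, inf_le_left, ⟨hx, hσ⟩, ?_⟩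
  have hcoord : ∀ i, ∀ v ∈ σ.1, b.coord i v = if v = b i then 1 else 0 := fun i v hv => by
    obtain ⟨j, rfl⟩ := hb hv
    simp only [Module.Basis.coord_apply, Module.Basis.repr_self, Finsupp.single_apply,
      b.injective.eq_iff]
  have hreg : ∀ i, ∀ y ∈ U ⊓ Δ.chartOpen k σ, c (b.coord i) * Δ.charUnit k (b.coord i) ∈
      (algebraMap ((Δ.toricVariety k).presheaf.stalk y) (Δ.toricVariety k).functionField).range :=
    fun i y hy => by
      rw [← logDer_charUnit]
      refine hc.mem hy.1 (charUnit_mem hy.2 fun v hv => ?_)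
      rw [hcoord i v hv]
      split_ifs <;> simp
  obtain ⟨t, ht⟩ : ∃ t : Γ(Δ.rayModule k, U ⊓ Δ.chartOpen k σ), IsLogarithmic
      (eulerRight.app _ t) (∑ i, pairingLog (b i) (c (b.coord i))) := by
    refine exists_eulerRight_sum fun i => ?_
    by_cases hi : b i ∈ σ.1
    · exact exists_eulerRight_of_regularAt (ρ := rayOf σ hi) ⟨x, hx, hσ⟩ fun y hy =>
        (Δ.rayDivisor_isLocalEquation k (rayOf σ hi) hy.2 _ (hcoord i)).regularAt_iff.mpr
          (hreg i y hy)
    · refine exists_eulerRight_of_regular hΔ (b i) ⟨x, hx, hσ⟩ fun y hy => ?_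
      have h1 := charUnit_mem (k := k) hy.2 (m := -b.coord i) fun v hv => by
        rw [LinearMap.neg_apply, hcoord i v hv, if_neg (by rintro rfl; exact hi hv), neg_zero]
      have h2 := mul_mem (hreg i y hy) h1
      rwa [charUnit_neg, Units.mul_inv_cancel_right] at h2
  rw [sum_pairingLog_basis] at ht
  exact ⟨t, ht.ext (hc.res _)⟩

/-- The Euler sequence `0 → N_1(X) ⊗ O_X → ⨁ O_X(D_ρ) → T_X → 0`. -/
theorem shortExact_euler (hΔ : Δ.IsComplete) :
    ∃ w : (eulerLeft : Δ.curveModule k ⟶ Δ.rayModule k) ≫ eulerRight = 0,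
      (ShortComplex.mk _ _ w).ShortExact :=
  shortExact_of_sections _ _ (fun _ _ hs => eq_zero_of_eulerLeft_eq_zero hΔ hs)
    (fun _ s => eulerRight_eulerLeft s) (fun _ _ ht => exists_of_eulerRight_eq_zero hΔ ht)
    fun _ δ _ hx => exists_eulerRight_locally hΔ δ hx

end EulerSequence

end SmoothFan

theorem proposition4p1 {k N : Type u} [Field k] [AddCommGroup N] [Module.Free ℤ N]
    [Module.Finite ℤ N] (Δ : SmoothFan N) (hΔ : Δ.IsComplete)
    (F : Δ.CoxRing k) (hF0 : F ≠ 0) (β : Pic (Δ.toricVariety k))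
    (hF : F.IsWeightedHomogeneous (fun ρ : Δ.Ray => Δ.rayClass k ρ) β)
    (D : CartierDivisor (Δ.toricVariety k)) (hD : Δ.IsZeroDivisor F D) :
    ∃ (a : Δ.curveModule k ⟶ Δ.rayModule k) (b : Δ.rayModule k ⟶ Δ.tangentModule k)
      (c : structureModule (Δ.toricVariety k) ⟶ lineBundle D)
      (e : lineBundle D ⟶ normalSheaf D)
      (v₁ : Δ.curveModule k ⟶ structureModule (Δ.toricVariety k))
      (v₂ : Δ.rayModule k ⟶ lineBundle D)
      (v₃ : Δ.tangentModule k ⟶ normalSheaf D),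
      (SmoothFan.IsEulerLeft hΔ a ∧ SmoothFan.IsEulerRight b ∧
        SmoothFan.IsMulBy hΔ F c ∧ IsNormalRestriction D e ∧
        SmoothFan.IsDegreeMap β v₁ ∧ SmoothFan.IsJacobianMap hΔ F v₂ ∧
        IsNormalDerivative (Δ.structureMorphism k) D v₃) ∧
      (IsCoherent (Δ.curveModule k) ∧ IsCoherent (Δ.rayModule k) ∧
        IsCoherent (Δ.tangentModule k) ∧ IsCoherent (structureModule (Δ.toricVariety k)) ∧
        IsCoherent (lineBundle D) ∧ IsCoherent (normalSheaf D)) ∧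
      (∃ w : a ≫ b = 0, (ShortComplex.mk a b w).ShortExact) ∧
      (∃ w : c ≫ e = 0, (ShortComplex.mk c e w).ShortExact) ∧
      a ≫ v₂ = v₁ ≫ c ∧ b ≫ v₃ = v₂ ≫ e := by

  have hE := hD.isEffective hΔ
  have hchart : ∀ M : (Δ.toricVariety k).Modules, (∀ σ, CoherentOn M (Δ.chartOpen k σ)) →
      IsCoherent M := fun M h => isCoherent_of_coherentOn fun x => by
    obtain ⟨σ, hx⟩ := Δ.iSup_chartOpen k x
    exact ⟨_, SmoothFan.isAffineOpen_chartOpen σ, hx, h σ⟩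
  refine ⟨SmoothFan.eulerLeft, SmoothFan.eulerRight, effectiveInclusion hE, normalRestriction D,
    SmoothFan.degreeMap β, SmoothFan.jacobianMap hΔ hD,
    normalDerivative (Δ.structureMorphism k) hE,
    ⟨SmoothFan.isEulerLeft_eulerLeft hΔ, SmoothFan.isEulerRight_eulerRight,
      SmoothFan.isMulBy_effectiveInclusion hΔ hE, isNormalRestriction_normalRestriction,
      SmoothFan.isDegreeMap_degreeMap β, SmoothFan.isJacobianMap_jacobianMap hΔ hD,
      isNormalDerivative_normalDerivative _ hE⟩,
    ⟨hchart _ fun σ => SmoothFan.coherentOn_curveModule hΔ (SmoothFan.isAffineOpen_chartOpen σ),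
      hchart _ SmoothFan.coherentOn_rayModule, hchart _ SmoothFan.coherentOn_tangentModule,
      isCoherent_structureModule _, isCoherent_lineBundle, isCoherent_normalSheaf hE⟩,
    SmoothFan.shortExact_euler hΔ, shortExact_normal hE,
    SmoothFan.eulerLeft_jacobianMap hΔ hD hE hF,
    SmoothFan.eulerRight_normalDerivative hΔ hD hE⟩
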